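/- Let $\mathcal A=\{1,\dots,m\}$ and let $\zeta:\mathcal A\to\mathcal A^+$ be a substitution (every letter is sent to a non-empty finite word), extended to words by concatenation, with substitution matrix $\mathsf S(i,j)=$ number of symbols $i$ in $\zeta(j)$. Let $X_\zeta\subset\mathcal A^{\mathbb Z}$ be the set of all $x$ such that every block $x[-n,n]$ occurs as a subword of some $\zeta^k(a)$, $k\in\mathbb N$, $a\in\mathcal A$, and let $T$ be the left shift on $X_\zeta$. Assume that $\zeta$ is primitive (some power of $\mathsf S$ has only positive entries) and aperiodic ($T$ has no periodic points in $X_\zeta$), that the characteristic polynomial of $\mathsf S$ is irreducible over $\mathbb Q$, and that $|\theta_2|>1$, where $\theta_1>|\theta_2|\ge\dots$ are the eigenvalues of $\mathsf S$ ordered by magnitude. Let $\mu$ be the (unique) $T$-invariant Borel probability measure on $X_\zeta$. For $\vec s$ in the simplex $\Delta^{m-1}=\{\vec s\in\mathbb R^m: s_j>0 \text{ for all } j,\ \sum_j s_j=1\}$ let $(\mathfrak X_\zeta^{\vec s},\widetilde\mu,h_t)$ be the suspension flow over $(X_\zeta,T,\mu)$ with roof function equal to $s_j$ on the cylinder $\{x: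 x_0=j\}$, where $\widetilde\mu$ is the normalized restriction of $\mu\times\mathrm{Leb}$. A Lip-cylindrical function is a function $f(x,t)=\psi_{x_0}(t)$, $0\le t< s_{x_0}$, with $\psi_a:[0,s_a]\to\mathbb C$ Lipschitz for every $a\in\mathcal A$; put $\|f\|_L=\max_a\|\psi_a\|_L$, where $\|\psi\|_L$ is the supremum norm plus the best Lipschitz constant. The spectral measure $\sigma_f$ is the finite positive Borel measure on $\mathbb R$ with $\int e^{2\pi i\omega t}\,d\sigma_f(\omega)=\langle f\circ h_t,f\rangle_{L^2(\widetilde\mu)}$ for all $t\in\mathbb R$. Then there exist constants $\widetilde\gamma,Z>0$ and a function $C:\mathbb R\to(0,\infty)$, all depending only on $\zeta$, such that for Lebesgue-almost every $\vec s\in\Delta^{m-1}$ there is $r_0=r_0(\vec s)>0$ such that for every Lip-cylindrical function $f$ on $\mathfrak X_\zeta^{\vec s}$ (not necessarily of mean zero) and every $\omega\ne0$, $$\sigma_f([\omega-r,\omega+r])\le C(\|f\|_L)\, r^{\widetilde\gamma}\qquad\text{for all } 0<r<r_0|\omega|^Z .$$ -/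

import Mathlib

open MeasureTheory Set
open scoped ComplexConjugate

noncomputable section

/-- A substitution on the alphabet `Fin m`: every letter is sent to a non-empty finite word. -/
structure Substitution (m : ℕ) where
  toFun : Fin m → List (Fin m)
  ne_nil : ∀ a, toFun a ≠ []

namespace Substitution

variable {m : ℕ}

/-- The extension of `ζ` to words by concatenation. -/
def onWord (ζ : Substitution m) (w : List (Fin m)) : List (Fin m) := w.flatMap ζ.toFun

/-- The word `ζ^k(a)`. -/
def iter (ζ : Substitution m) (k : ℕ) (a : Fin m) : List (Fin m) := ζ.onWord^[k] [a]

/-- The substitution matrix: the entry `(i, j)` is the number of symbols `i` in `ζ(j)`. -/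
def matrix (ζ : Substitution m) : Matrix (Fin m) (Fin m) ℤ :=
  Matrix.of fun i j => ((ζ.toFun j).count i : ℤ)

/-- `ζ` is primitive: some power of the substitution matrix has only positive entries. -/
def Primitive (ζ : Substitution m) : Prop := ζ.matrix.IsPrimitive

/-- The moduli `|θ₁| ≥ |θ₂| ≥ …` of the complex eigenvalues of the substitution matrix, listed
with algebraic multiplicity in decreasing order. -/
def eigenvalueModuli (ζ : Substitution m) : List ℝ :=
  ((ζ.matrix.map (Int.cast : ℤ → ℂ)).charpoly.roots.map (fun z => ‖z‖)).sort (· ≥ ·)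

/-- `|θ₂|`, with the value `0` if there is no second eigenvalue. -/
def secondModulus (ζ : Substitution m) : ℝ := ζ.eigenvalueModuli.getD 1 0

end Substitution

/-- The left shift on two-sided sequences. -/
def leftShift {m : ℕ} (x : ℤ → Fin m) : ℤ → Fin m := fun n => x (n + 1)

/-- The block `x[-n, n]`. -/
def centralBlock {m : ℕ} (x : ℤ → Fin m) (n : ℕ) : List (Fin m) :=
  List.ofFn fun i : Fin (2 * n + 1) => x ((i : ℤ) - n)

namespace Substitution

variable {m : ℕ}

/-- The substitution space `X_ζ`: every central block of `x` is a subword (that is, a contiguous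
block) of some `ζ^k(a)`. -/
def space (ζ : Substitution m) : Set (ℤ → Fin m) :=
  {x | ∀ n : ℕ, ∃ (k : ℕ) (a : Fin m), centralBlock x n <:+: ζ.iter k a}

/-- `ζ` is aperiodic: the system `(X_ζ, T)` has no periodic points. -/
def Aperiodic (ζ : Substitution m) : Prop :=
  ∀ x ∈ ζ.space, x ∉ Function.periodicPts (leftShift (m := m))

/-- `μ` is a shift-invariant Borel probability measure on `X_ζ`, viewed as a measure on the
sequence space that gives no mass to the complement of `X_ζ`. If `ζ` is primitive, there is
exactly one such measure. -/
structure IsInvariantMeasure (ζ : Substitution m) (μ : Measure (ℤ → Fin m)) : Prop where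
  isProbabilityMeasure : IsProbabilityMeasure μ
  measurePreserving : MeasurePreserving leftShift μ μ
  compl_space : μ ζ.spaceᶜ = 0

end Substitution

/-- The open simplex of strictly positive roof vectors with coordinates summing to `1`. -/
def openSimplex (m : ℕ) : Set (Fin m → ℝ) := {s | (∀ j, 0 < s j) ∧ ∑ j, s j = 1}

/-- Lebesgue measure on the simplex, as the `(m - 1)`-dimensional Hausdorff measure; on the
hyperplane spanned by the simplex this is a positive constant multiple of Lebesgue measure. -/
def simplexMeasure (m : ℕ) : Measure (Fin m → ℝ) :=
  (Measure.hausdorffMeasure ((m : ℝ) - 1)).restrict (openSimplex m)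

section Suspension

variable {m : ℕ}

/-- The additive cocycle of the roof function: `s_{x_0} + … + s_{x_{n-1}}` for `n ≥ 0` and
`-(s_{x_n} + … + s_{x_{-1}})` for `n < 0`. -/
def roofSum (s : Fin m → ℝ) (x : ℤ → Fin m) (n : ℤ) : ℝ :=
  ∑ i ∈ Finset.Ico 0 n, s (x i) - ∑ i ∈ Finset.Ico n 0, s (x i)

/-- For a strictly positive `s`, the unique integer `n` with
`roofSum s x n ≤ u < roofSum s x (n + 1)`. -/
def tileIndex (s : Fin m → ℝ) (x : ℤ → Fin m) (u : ℝ) : ℤ := sSup {n : ℤ | roofSum s x n ≤ u}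

/-- The suspension space `{(x, t) : x ∈ X_ζ, 0 ≤ t < s_{x_0}}`; the points `(x, s_{x_0})` are
identified with `(T x, 0)` and not repeated. -/
def suspensionSpace (ζ : Substitution m) (s : Fin m → ℝ) : Set ((ℤ → Fin m) × ℝ) :=
  {p | p.1 ∈ ζ.space ∧ 0 ≤ p.2 ∧ p.2 < s (p.1 0)}

/-- The suspension flow `h_τ`: move up by `τ`, with `(x, s_{x_0})` identified with `(T x, 0)`. -/
def suspensionFlow (s : Fin m → ℝ) (τ : ℝ) (p : (ℤ → Fin m) × ℝ) : (ℤ → Fin m) × ℝ :=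
  let n := tileIndex s p.1 (p.2 + τ)
  (fun i => p.1 (i + n), p.2 + τ - roofSum s p.1 n)

/-- The invariant probability measure of the suspension flow induced by `μ`: the normalized
restriction of the product of `μ` with Lebesgue measure to the suspension space. -/
def suspensionMeasure (ζ : Substitution m) (s : Fin m → ℝ) (μ : Measure (ℤ → Fin m)) :
    Measure ((ℤ → Fin m) × ℝ) :=
  ProbabilityTheory.cond (μ.prod volume) (suspensionSpace ζ s)

/-- The cylindrical function `f(x, t) = ψ_{x_0}(t)`. -/
def cylFun (ψ : Fin m → ℝ → ℂ) (p : (ℤ → Fin m) × ℝ) : ℂ := ψ (p.1 0) p.2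

/-- `ψ_a ∈ Lip[0, s_a]` for every letter `a`. -/
def IsLipData (s : Fin m → ℝ) (ψ : Fin m → ℝ → ℂ) : Prop :=
  ∀ a, ∃ K, LipschitzOnWith K (ψ a) (Icc 0 (s a))

/-- The Lipschitz norm on `[0, b]`: the supremum norm plus the best Lipschitz constant. -/
def lipNormIcc (b : ℝ) (φ : ℝ → ℂ) : ℝ :=
  sSup ((fun t => ‖φ t‖) '' Icc 0 b) +
    sInf {K : ℝ | 0 ≤ K ∧ ∀ t ∈ Icc 0 b, ∀ u ∈ Icc 0 b, ‖φ t - φ u‖ ≤ K * |t - u|}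

/-- `‖f‖_L = max_a ‖ψ_a‖_L`. -/
def cylLipNorm (s : Fin m → ℝ) (ψ : Fin m → ℝ → ℂ) : ℝ := ⨆ a, lipNormIcc (s a) (ψ a)

end Suspension

/-- `σ` is the spectral measure of `f` for the flow `h` on `(Y, ν)`: the finite positive Borel
measure on `ℝ` with `∫ e^{2πiωt} dσ(ω) = ⟨f ∘ h_t, f⟩` for all real `t`. -/
structure IsSpectralMeasure {Y : Type*} [MeasurableSpace Y] (ν : Measure Y) (h : ℝ → Y → Y)
    (f : Y → ℂ) (σ : Measure ℝ) : Prop where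
  isFiniteMeasure : IsFiniteMeasure σ
  fourier : ∀ t : ℝ, ∫ ω : ℝ, Complex.exp (2 * Real.pi * Complex.I * ω * t) ∂σ =
    ∫ y, f (h t y) * conj (f y) ∂ν

end

/-!
Integrating `f` against `e^{-2πiωu}` over a flow line of length `R` amounts, up to two incomplete
tiles, to a twisted exponential sum over a word of the substitution, with the twist of a letter
given by its roof length, and a uniform bound for these integrals at `R ~ 1 / r` bounds
`σ_f [ω - r, ω + r]`. Choose a return word `c v` such that `c v c` occurs in every `ζ^q(b)`. If
`ω` times the roof length of `ζ^n(c v)` is far from the integers, the two copies of `ζ^n(c)` in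
`ζ^(n+q)(b)` are out of phase, and the normalized maximal twisted sum contracts by a fixed factor
between the levels `n` and `n + q`.

Hence the twisted sums decay exponentially in the level as soon as a positive proportion of the
levels `k < n` is far from the integers, and this is where the Erdős–Kahane argument enters. The
roof lengths satisfy the linear recurrence given by the characteristic polynomial of `S`. When
nearly all of them, multiplied by `ω`, are close to integers, the nearest integers satisfy the same
recurrence except at few places, so there are few such integer sequences, and each of them
determines the pairings of `ω • s` with the eigenvectors for `θ₁` and `θ₂` up to an exponentially
small error, because `|θ₁|, |θ₂| > 1`. The quotient of the two pairings no longer depends on `ω`,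
so the exceptional roof vectors form a null set by Borel–Cantelli, simultaneously for all
frequencies with `|log |ω|| ≤ κ n`. For larger frequencies the integrals of the Lipschitz functions
`ψ_a` over single tiles are already `O(1 / |ω|)`.
-/

noncomputable section

open scoped FourierTransform

/-! ### Words and substitutions -/

section FlatMapInfix

variable {α β : Type*} {g : α → List β} {N : ℕ}

lemma exists_eq_flatMap_append_of_isPrefix (hg : ∀ a, (g a).length ≤ N) {w : List α} {u : List β}
    (h : u <+: w.flatMap g) :
    ∃ (w' : List α) (q : List β), u = w'.flatMap g ++ q ∧ q.length ≤ N := by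
  induction w generalizing u with
  | nil => exact ⟨[], [], by simpa using h, by simp⟩
  | cons c w ih =>
    obtain ⟨z, hz⟩ := h
    rw [List.flatMap_cons] at hz
    rcases List.append_eq_append_iff.1 hz with ⟨z', hc, -⟩ | ⟨z', hu, hw⟩
    · exact ⟨[], u, by simp, (by simp [hc] : u.length ≤ (g c).length).trans (hg c)⟩
    · obtain ⟨w', q, hz', hq⟩ := ih ⟨z, hw.symm⟩
      exact ⟨c :: w', q, by simp [hu, hz'], hq⟩

lemma exists_eq_append_flatMap_append_of_isInfix (hg : ∀ a, (g a).length ≤ N) {w : List α}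
    {u : List β} (h : u <:+: w.flatMap g) :
    ∃ (p : List β) (w' : List α) (q : List β),
      u = p ++ w'.flatMap g ++ q ∧ p.length ≤ N ∧ q.length ≤ N := by
  induction w with
  | nil => exact ⟨[], [], [], by simpa using h, by simp, by simp⟩
  | cons c w ih =>
    obtain ⟨y, z, hyz⟩ := h
    rw [List.flatMap_cons, List.append_assoc] at hyz
    rcases List.append_eq_append_iff.1 hyz with ⟨y', hc, huz⟩ | ⟨y', -, hw⟩
    · rcases List.append_eq_append_iff.1 huz with ⟨z', hy', -⟩ | ⟨z', hu, hw⟩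
      · have hle : u.length ≤ (g c).length := by
          rw [hc, hy', List.length_append, List.length_append]
          omega
        exact ⟨u, [], [], by simp, hle.trans (hg c), by simp⟩
      · obtain ⟨w', q, hz', hq⟩ := exists_eq_flatMap_append_of_isPrefix hg ⟨z, hw.symm⟩
        exact ⟨y', w', q, by simp [hu, hz'],
          (by simp [hc] : y'.length ≤ (g c).length).trans (hg c), hq⟩
    · exact ih ⟨y', z, by simp [hw]⟩

end FlatMapInfix

section PopVec

variable {α : Type*} [DecidableEq α]

/-- The population vector of a word: the number of occurrences of each letter. -/
def popVec (w : List α) : α → ℤ := fun a => (w.count a : ℤ)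

lemma popVec_append (u w : List α) : popVec (u ++ w) = popVec u + popVec w := by
  ext a; simp [popVec]

lemma popVec_singleton (a : α) : popVec [a] = Pi.single a 1 := by
  ext b
  obtain rfl | hab := eq_or_ne a b
  · simp [popVec]
  · simp [popVec, hab, hab.symm]

end PopVec

namespace Substitution

variable {m : ℕ} (ζ : Substitution m)

lemma onWord_append (u w : List (Fin m)) : ζ.onWord (u ++ w) = ζ.onWord u ++ ζ.onWord w := by
  simp [onWord]

lemma length_le_length_onWord (w : List (Fin m)) : w.length ≤ (ζ.onWord w).length := by
  induction w with
  | nil => simp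
  | cons a w ih =>
    have ha := List.length_pos_iff.2 (ζ.ne_nil a)
    simp only [onWord, List.flatMap_cons, List.length_append, List.length_cons] at *
    omega

lemma popVec_onWord (w : List (Fin m)) : popVec (ζ.onWord w) = ζ.matrix.mulVec (popVec w) := by
  induction w with
  | nil => ext i; simp [popVec, onWord, Matrix.mulVec, dotProduct]
  | cons a w ih =>
    rw [← List.singleton_append, onWord_append, popVec_append, popVec_append, ih,
      Matrix.mulVec_add, popVec_singleton, Matrix.mulVec_single_one]
    congr 1
    ext i
    simp [popVec, onWord, matrix]

/-- The word `ζ^n(w)`; the word `ζ.iter n a` is the case `w = [a]`. -/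
def iterWord (n : ℕ) (w : List (Fin m)) : List (Fin m) := ζ.onWord^[n] w

@[simp] lemma iterWord_zero (w : List (Fin m)) : ζ.iterWord 0 w = w := rfl

lemma iterWord_succ (n : ℕ) (w : List (Fin m)) :
    ζ.iterWord (n + 1) w = ζ.onWord (ζ.iterWord n w) :=
  Function.iterate_succ_apply' _ _ _

lemma iter_add (n k : ℕ) (a : Fin m) : ζ.iter (n + k) a = ζ.iterWord n (ζ.iter k a) :=
  Function.iterate_add_apply _ _ _ _

lemma iterWord_append (n : ℕ) (u w : List (Fin m)) :
    ζ.iterWord n (u ++ w) = ζ.iterWord n u ++ ζ.iterWord n w := by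
  induction n with
  | zero => rfl
  | succ n ih => rw [iterWord_succ, ih, onWord_append, ← iterWord_succ, ← iterWord_succ]

@[simp] lemma iterWord_nil (n : ℕ) : ζ.iterWord n [] = [] :=
  Function.iterate_fixed rfl n

lemma iterWord_cons (n : ℕ) (a : Fin m) (w : List (Fin m)) :
    ζ.iterWord n (a :: w) = ζ.iter n a ++ ζ.iterWord n w :=
  ζ.iterWord_append n [a] w

lemma iterWord_eq_flatMap (n : ℕ) (w : List (Fin m)) : ζ.iterWord n w = w.flatMap (ζ.iter n) := by
  induction w with
  | nil => simp
  | cons a w ih => rw [iterWord_cons, ih, List.flatMap_cons]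

lemma iterWord_isInfix (n : ℕ) {u w : List (Fin m)} (h : u <:+: w) :
    ζ.iterWord n u <:+: ζ.iterWord n w := by
  obtain ⟨p, q, rfl⟩ := h
  rw [iterWord_append, iterWord_append]
  exact List.infix_append _ _ _

lemma popVec_iterWord (n : ℕ) (w : List (Fin m)) :
    popVec (ζ.iterWord n w) = (ζ.matrix ^ n).mulVec (popVec w) := by
  induction n with
  | zero => simp
  | succ n ih => rw [iterWord_succ, popVec_onWord, ih, Matrix.mulVec_mulVec, pow_succ']

lemma monotone_length_iterWord (w : List (Fin m)) : Monotone fun n => (ζ.iterWord n w).length :=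
  monotone_nat_of_le_succ fun n => by
    rw [iterWord_succ]
    exact ζ.length_le_length_onWord _

lemma length_iter_pos (n : ℕ) (a : Fin m) : 0 < (ζ.iter n a).length :=
  Nat.lt_of_lt_of_le Nat.zero_lt_one (ζ.monotone_length_iterWord [a] n.zero_le)

/-- The maximal length of the words `ζ^n(a)`, the scale of the `n`-th level of the
substitution. -/
def maxLen (n : ℕ) : ℕ := Finset.univ.sup fun a => (ζ.iter n a).length

lemma length_iter_le_maxLen (n : ℕ) (a : Fin m) : (ζ.iter n a).length ≤ ζ.maxLen n :=
  Finset.le_sup (f := fun a => (ζ.iter n a).length) (Finset.mem_univ a)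

lemma maxLen_mono : Monotone ζ.maxLen := fun _ _ h =>
  Finset.sup_mono_fun fun a _ => ζ.monotone_length_iterWord [a] h

lemma length_iterWord_le (n : ℕ) (w : List (Fin m)) :
    (ζ.iterWord n w).length ≤ w.length * ζ.maxLen n := by
  induction w with
  | nil => simp
  | cons a w ih =>
    rw [iterWord_cons, List.length_append, List.length_cons, add_mul, one_mul]
    have := ζ.length_iter_le_maxLen n a
    omega

lemma maxLen_add_le (n k : ℕ) : ζ.maxLen (n + k) ≤ ζ.maxLen n * ζ.maxLen k := by
  refine Finset.sup_le fun a _ => ?_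
  rw [iter_add, mul_comm]
  exact (ζ.length_iterWord_le n _).trans
    (Nat.mul_le_mul_right _ (ζ.length_iter_le_maxLen k a))

lemma maxLen_le_pow (n : ℕ) : ζ.maxLen n ≤ ζ.maxLen 1 ^ n := by
  induction n with
  | zero => exact Finset.sup_le fun a _ => by simp [iter]
  | succ n ih =>
    rw [pow_succ]
    exact (ζ.maxLen_add_le n 1).trans (Nat.mul_le_mul_right _ ih)

lemma exists_eq_append_iterWord_append_of_isInfix (n : ℕ) {k : ℕ} {a : Fin m} {u : List (Fin m)}
    (h : u <:+: ζ.iter k a) :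
    ∃ p w q, u = p ++ ζ.iterWord n w ++ q ∧ p.length ≤ ζ.maxLen n ∧ q.length ≤ ζ.maxLen n := by
  rcases lt_or_ge k n with hk | hk
  · exact ⟨u, [], [], by simp,
      h.length_le.trans ((ζ.length_iter_le_maxLen k a).trans (ζ.maxLen_mono hk.le)), by simp⟩
  · obtain ⟨j, rfl⟩ := Nat.exists_eq_add_of_le hk
    simp only [iter_add, iterWord_eq_flatMap] at h ⊢
    exact exists_eq_append_flatMap_append_of_isInfix (ζ.length_iter_le_maxLen n) h

/-- `c :: v` is a return word to the letter `c` whose occurrence followed by `c` is seen in all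
the words `ζ^q(b)`. -/
def IsReturnWord (q : ℕ) (c : Fin m) (v : List (Fin m)) : Prop :=
  ∀ b, (c :: v ++ [c]) <:+: ζ.iter q b

variable {ζ}

lemma Primitive.exists_forall_mem_iter (h : ζ.Primitive) : ∃ p, ∀ a b, a ∈ ζ.iter p b := by
  obtain ⟨p, -, hp⟩ := h.exists_pos_pow
  refine ⟨p, fun a b => ?_⟩
  have hcount : popVec (ζ.iter p b) a = (ζ.matrix ^ p) a b := by
    simpa [popVec_singleton, iter, iterWord] using congrFun (ζ.popVec_iterWord p [b]) a
  have hpos : 0 < popVec (ζ.iter p b) a := hcount ▸ hp a b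
  simpa [popVec] using hpos

section AllLetters

variable {p : ℕ} (hp : ∀ a b, a ∈ ζ.iter p b)
include hp

lemma iter_isInfix_iter_add (n : ℕ) (a b : Fin m) : ζ.iter n a <:+: ζ.iter (n + p) b := by
  rw [iter_add]
  exact ζ.iterWord_isInfix (u := [a]) n (List.singleton_infix_iff _ _ |>.2 (hp a b))

lemma maxLen_le_length_iter_mul (n : ℕ) (a : Fin m) :
    ζ.maxLen n ≤ (ζ.iter n a).length * ζ.maxLen p := by
  refine Finset.sup_le fun b _ => (iter_isInfix_iter_add hp n b a).length_le.trans ?_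
  rw [add_comm, iter_add]
  exact ζ.length_iterWord_le p _

lemma exists_return_word (hm : 2 ≤ m) :
    ∃ q c v, ζ.IsReturnWord q c v := by
  have : Nontrivial (Fin m) := Fin.nontrivial_iff_two_le.2 hm
  obtain ⟨c, d, hcd⟩ := exists_pair_ne (Fin m)
  obtain ⟨a, a', w, hw⟩ : ∃ a a' w, ζ.iter p c = a :: a' :: w := by
    have hc := hp c c
    have hd := hp d c
    match h : ζ.iter p c with
    | [] => simp [h] at hc
    | [x] =>
      rw [h, List.mem_singleton] at hc hd
      exact absurd (hc.trans hd.symm) hcd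
    | x :: y :: w => exact ⟨x, y, w, rfl⟩
  obtain ⟨s₁, t₁, h₁⟩ := List.append_of_mem (hp c a)
  obtain ⟨s₂, t₂, h₂⟩ := List.append_of_mem (hp c a')
  refine ⟨p + p + p, c, t₁ ++ s₂, fun b => .trans ?_ (iter_isInfix_iter_add hp (p + p) c b)⟩
  rw [iter_add, hw, iterWord_cons, iterWord_cons, h₁, h₂]
  exact ⟨s₁, t₂ ++ ζ.iterWord p w, by simp⟩

end AllLetters

end Substitution

/-! ### Twisted sums and the return word contraction -/

section DistInt

/-- The distance of a real number to the nearest integer. -/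
def distInt (x : ℝ) : ℝ := |x - round x|

/-- The number of indices `k < n` for which `x k` is at distance at least `ρ` from the integers. -/
def farCount (ρ : ℝ) (x : ℕ → ℝ) (n : ℕ) : ℕ := Nat.count (fun k => ρ ≤ distInt (x k)) n

lemma distInt_nonneg (x : ℝ) : 0 ≤ distInt x := abs_nonneg _

lemma distInt_le_half (x : ℝ) : distInt x ≤ 1 / 2 := abs_sub_round x

lemma abs_cos_pi_mul (x : ℝ) : |Real.cos (Real.pi * x)| = Real.cos (Real.pi * distInt x) := by
  have hx : Real.pi * distInt x = |Real.pi * x - (round x : ℤ) * Real.pi| := by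
    rw [distInt, ← abs_of_pos Real.pi_pos, ← abs_mul, abs_of_pos Real.pi_pos]
    ring_nf
  have hcos : 0 ≤ Real.cos (Real.pi * distInt x) :=
    Real.cos_nonneg_of_mem_Icc ⟨by nlinarith [Real.pi_pos, distInt_nonneg x],
      by nlinarith [Real.pi_pos, distInt_le_half x]⟩
  rw [← abs_of_nonneg hcos, hx, Real.cos_abs, Real.cos_sub_int_mul_pi, abs_mul, abs_zpow]
  simp

lemma norm_one_add_fourierChar (x : ℝ) : ‖1 + (𝐞 x : ℂ)‖ = 2 * |Real.cos (Real.pi * x)| := by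
  have hfactor : 1 + (𝐞 x : ℂ) = 𝐞 (x / 2) * (2 * Real.cos (Real.pi * x) : ℝ) := by
    push_cast
    rw [Complex.two_cos, mul_add, Real.fourierChar_apply, Real.fourierChar_apply,
      ← Complex.exp_add, ← Complex.exp_add, add_comm, ← Complex.exp_zero]
    congr 2 <;> · push_cast; ring
  rw [hfactor, norm_mul, Circle.norm_coe, one_mul, Complex.norm_real, Real.norm_eq_abs, abs_mul,
    abs_two]

lemma norm_one_add_fourierChar_le {ρ x : ℝ} (hρ : 0 ≤ ρ) (hx : ρ ≤ distInt x) :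
    ‖1 + (𝐞 x : ℂ)‖ ≤ 2 * Real.cos (Real.pi * ρ) := by
  rw [norm_one_add_fourierChar, abs_cos_pi_mul]
  gcongr
  exact Real.cos_le_cos_of_nonneg_of_le_pi (by positivity)
    (by nlinarith [Real.pi_pos, distInt_le_half x]) (by gcongr)

end DistInt

section GeometricDecay

variable {A : ℕ → ℝ} {q : ℕ}

lemma prod_range_succ_window_le (hA0 : ∀ n, 0 ≤ A n) (hq : q ≠ 0) {n : ℕ} {c : ℝ}
    (h : A (n + q) ≤ c * A n) :
    ∏ i ∈ Finset.range q, A (n + 1 + i) ≤ c * ∏ i ∈ Finset.range q, A (n + i) := by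
  obtain ⟨k, rfl⟩ := Nat.exists_eq_succ_of_ne_zero hq
  have hshift : ∀ i, n + 1 + i = n + (i + 1) := fun i => by ring
  simp only [Nat.succ_eq_add_one, hshift] at h ⊢
  rw [Finset.prod_range_succ, Finset.prod_range_succ' _ k, add_zero, mul_left_comm]
  gcongr
  exact Finset.prod_nonneg fun i _ => hA0 _

lemma prod_range_window_le_mul_pow_count (hA : Antitone A) (hA0 : ∀ n, 0 ≤ A n) (hq : q ≠ 0)
    {c : ℝ} (hc : 0 ≤ c) (G : ℕ → Prop) [DecidablePred G] (hG : ∀ n, G n → A (n + q) ≤ c * A n)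
    (n : ℕ) : ∏ i ∈ Finset.range q, A (n + i) ≤ A 0 ^ q * c ^ Nat.count G n := by
  induction n with
  | zero =>
    calc ∏ i ∈ Finset.range q, A (0 + i) ≤ ∏ _i ∈ Finset.range q, A 0 :=
          Finset.prod_le_prod (fun _ _ => hA0 _) fun _ _ => hA (Nat.zero_le _)
      _ = _ := by simp
  | succ n ih =>
    rw [Nat.count_succ]
    split_ifs with hn
    · calc _ ≤ c * ∏ i ∈ Finset.range q, A (n + i) :=
            prod_range_succ_window_le hA0 hq (hG n hn)
        _ ≤ c * (A 0 ^ q * c ^ Nat.count G n) := by gcongr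
        _ = _ := by ring
    · refine le_trans ?_ ih
      simpa using prod_range_succ_window_le hA0 hq (c := 1)
        ((hA (Nat.le_add_right n q)).trans_eq (one_mul _).symm)

/- The product of `q` consecutive terms is multiplied by at most `ν ^ q` at each good index, even
if the good indices are less than `q` apart; the power `q` is removed only at the end. -/
lemma le_mul_pow_count_of_antitone (hA : Antitone A) (hA0 : ∀ n, 0 ≤ A n) (hq : q ≠ 0)
    {ν : ℝ} (hν : 0 ≤ ν) (G : ℕ → Prop) [DecidablePred G]
    (hG : ∀ n, G n → A (n + q) ≤ ν ^ q * A n) (n : ℕ) :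
    A (n + q) ≤ A 0 * ν ^ Nat.count G n := by
  rw [← pow_le_pow_iff_left₀ (hA0 _) (mul_nonneg (hA0 _) (pow_nonneg hν _)) hq]
  calc A (n + q) ^ q = ∏ _i ∈ Finset.range q, A (n + q) := by simp
    _ ≤ ∏ i ∈ Finset.range q, A (n + i) :=
      Finset.prod_le_prod (fun _ _ => hA0 _) fun i hi =>
        hA (Nat.add_le_add_left (Finset.mem_range.1 hi).le n)
    _ ≤ A 0 ^ q * (ν ^ q) ^ Nat.count G n :=
      prod_range_window_le_mul_pow_count hA hA0 hq (by positivity) G hG n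
    _ = _ := by rw [mul_pow, ← pow_mul, ← pow_mul, mul_comm q]

end GeometricDecay

section TwistedSum

variable {α : Type*} (ω : ℝ) (s : α → ℝ) (φ : α → ℂ)

/-- The total roof length of a word for the roof vector `s`. -/
def roofWord (w : List α) : ℝ := (w.map s).sum

lemma roofWord_cons (a : α) (w : List α) : roofWord s (a :: w) = s a + roofWord s w := by
  simp [roofWord]

lemma roofWord_append (u w : List α) : roofWord s (u ++ w) = roofWord s u + roofWord s w := by
  simp [roofWord]

lemma roofWord_eq_dotProduct [Fintype α] [DecidableEq α] (w : List α) :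
    roofWord s w = s ⬝ᵥ fun a => (popVec w a : ℝ) := by
  induction w with
  | nil => simp [roofWord, popVec]
  | cons a w ih =>
    rw [roofWord_cons, ih, ← List.singleton_append, popVec_append, popVec_singleton]
    simp [dotProduct, mul_add, Finset.sum_add_distrib, Pi.single_apply]

/-- The exponential sum of the weights `φ` along a word, in which each letter is twisted by the
roof length of the letters before it. -/
def twistedSum : List α → ℂ
  | [] => 0
  | a :: w => φ a + 𝐞 (-(ω * s a)) * twistedSum w

lemma twistedSum_append (u w : List α) :
    twistedSum ω s φ (u ++ w) =
      twistedSum ω s φ u + 𝐞 (-(ω * roofWord s u)) * twistedSum ω s φ w := by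
  induction u with
  | nil => simp [twistedSum, roofWord]
  | cons a u ih =>
    rw [List.cons_append, twistedSum, twistedSum, ih, roofWord_cons, mul_add ω, neg_add,
      AddChar.map_add_eq_mul, Circle.coe_mul]
    ring

lemma norm_twistedSum_append_le (u w : List α) :
    ‖twistedSum ω s φ (u ++ w)‖ ≤ ‖twistedSum ω s φ u‖ + ‖twistedSum ω s φ w‖ := by
  rw [twistedSum_append]
  refine (norm_add_le _ _).trans_eq ?_
  rw [norm_mul, Circle.norm_coe, one_mul]

lemma norm_twistedSum_append_append_self_le (u w : List α) :
    ‖twistedSum ω s φ (u ++ w ++ u)‖ ≤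
      ‖1 + (𝐞 (ω * roofWord s (u ++ w)) : ℂ)‖ * ‖twistedSum ω s φ u‖ + ‖twistedSum ω s φ w‖ := by
  have hconj : ‖1 + (𝐞 (-(ω * roofWord s (u ++ w))) : ℂ)‖ =
      ‖1 + (𝐞 (ω * roofWord s (u ++ w)) : ℂ)‖ := by
    rw [norm_one_add_fourierChar, norm_one_add_fourierChar, mul_neg, Real.cos_neg]
  rw [twistedSum_append, twistedSum_append, ← hconj, ← norm_mul]
  refine (le_of_eq ?_).trans ((norm_add_le _ _).trans_eq
    (congrArg _ (by rw [norm_mul, Circle.norm_coe, one_mul] :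
      ‖(𝐞 (-(ω * roofWord s u)) : ℂ) * twistedSum ω s φ w‖ = _)))
  congr 1
  ring

variable {φ} in
lemma norm_twistedSum_le {M : ℝ} (hM : ∀ a, ‖φ a‖ ≤ M) (w : List α) :
    ‖twistedSum ω s φ w‖ ≤ M * w.length := by
  induction w with
  | nil => simp [twistedSum]
  | cons a w ih =>
    calc ‖twistedSum ω s φ (a :: w)‖ ≤ ‖φ a‖ + ‖twistedSum ω s φ w‖ := by
          simpa [twistedSum] using norm_twistedSum_append_le ω s φ [a] w
      _ ≤ M + M * w.length := add_le_add (hM a) ih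
      _ = M * (a :: w).length := by push_cast [List.length_cons]; ring

end TwistedSum

namespace Substitution

variable {m : ℕ} (ζ : Substitution m) (ω : ℝ) (s : Fin m → ℝ) (φ : Fin m → ℂ)

/-- The maximal twisted sum over the words `ζ^n(a)`, normalized by their lengths. -/
def maxTwistedSum (n : ℕ) : ℝ := ⨆ a, ‖twistedSum ω s φ (ζ.iter n a)‖ / (ζ.iter n a).length

lemma maxTwistedSum_nonneg (n : ℕ) : 0 ≤ ζ.maxTwistedSum ω s φ n :=
  Real.iSup_nonneg fun _ => by positivity

lemma norm_twistedSum_iter_le (n : ℕ) (a : Fin m) :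
    ‖twistedSum ω s φ (ζ.iter n a)‖ ≤ ζ.maxTwistedSum ω s φ n * (ζ.iter n a).length := by
  rw [← div_le_iff₀ (by exact_mod_cast ζ.length_iter_pos n a)]
  exact le_ciSup (f := fun a => ‖twistedSum ω s φ (ζ.iter n a)‖ / (ζ.iter n a).length)
    (Set.finite_range _).bddAbove a

lemma norm_twistedSum_iterWord_le (n : ℕ) (w : List (Fin m)) :
    ‖twistedSum ω s φ (ζ.iterWord n w)‖ ≤ ζ.maxTwistedSum ω s φ n * (ζ.iterWord n w).length := by
  induction w with
  | nil => simp [twistedSum]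
  | cons a w ih =>
    rw [iterWord_cons, List.length_append, Nat.cast_add, mul_add]
    exact (norm_twistedSum_append_le ω s φ _ _).trans
      (add_le_add (ζ.norm_twistedSum_iter_le ω s φ n a) ih)

lemma maxTwistedSum_le [Nonempty (Fin m)] {n : ℕ} {B : ℝ}
    (h : ∀ a, ‖twistedSum ω s φ (ζ.iter n a)‖ ≤ B * (ζ.iter n a).length) :
    ζ.maxTwistedSum ω s φ n ≤ B :=
  ciSup_le fun a => by
    rw [div_le_iff₀ (by exact_mod_cast ζ.length_iter_pos n a)]
    exact h a

lemma antitone_maxTwistedSum [Nonempty (Fin m)] : Antitone (ζ.maxTwistedSum ω s φ) :=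
  antitone_nat_of_succ_le fun n => ζ.maxTwistedSum_le ω s φ fun a => by
    rw [iter_add]
    exact ζ.norm_twistedSum_iterWord_le ω s φ n _

variable {ζ} {p q : ℕ} {c : Fin m} {v : List (Fin m)}

lemma IsReturnWord.ne_zero (hv : ζ.IsReturnWord q c v) : q ≠ 0 := by
  rintro rfl
  simpa [iter] using (hv c).length_le

lemma length_iter_add_le (hp : ∀ a b, a ∈ ζ.iter p b) (n q : ℕ) (b c : Fin m) :
    (ζ.iter (n + q) b).length ≤ (ζ.iter n c).length * (ζ.maxLen p * ζ.maxLen q) :=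
  calc _ ≤ ζ.maxLen n * ζ.maxLen q := (ζ.length_iter_le_maxLen _ b).trans (ζ.maxLen_add_le n q)
    _ ≤ (ζ.iter n c).length * ζ.maxLen p * ζ.maxLen q :=
      Nat.mul_le_mul_right _ (maxLen_le_length_iter_mul hp n c)
    _ = _ := mul_assoc _ _ _

/- The two occurrences of `ζ^n(c)` around the out-of-phase return word nearly cancel: together they
contribute at most `2 cos (πρ)` times the maximum instead of twice the maximum. -/
lemma IsReturnWord.norm_twistedSum_iter_add_le (hv : ζ.IsReturnWord q c v) {ρ : ℝ} (hρ : 0 ≤ ρ)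
    {n : ℕ} (hn : ρ ≤ distInt (ω * roofWord s (ζ.iterWord n (c :: v)))) (b : Fin m) :
    ‖twistedSum ω s φ (ζ.iter (n + q) b)‖ ≤ ζ.maxTwistedSum ω s φ n *
      ((ζ.iter (n + q) b).length - (2 - 2 * Real.cos (Real.pi * ρ)) * (ζ.iter n c).length) := by
  obtain ⟨P, Q, hPQ⟩ := hv b
  have hword : ζ.iter (n + q) b = ζ.iterWord n P ++
      (ζ.iter n c ++ ζ.iterWord n v ++ ζ.iter n c ++ ζ.iterWord n Q) := by
    rw [iter_add, ← hPQ]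
    simp only [iterWord_append, iterWord_cons, iterWord_nil, List.append_assoc, List.append_nil]
  rw [iterWord_cons] at hn
  have hlen : ((ζ.iter (n + q) b).length : ℝ) = (ζ.iterWord n P).length +
      (2 * (ζ.iter n c).length + (ζ.iterWord n v).length + (ζ.iterWord n Q).length) := by
    rw [hword]
    simp only [List.length_append]
    push_cast
    ring
  set A := ζ.maxTwistedSum ω s φ n
  have hmid : ‖twistedSum ω s φ (ζ.iter n c ++ ζ.iterWord n v ++ ζ.iter n c)‖ ≤
      2 * Real.cos (Real.pi * ρ) * (A * (ζ.iter n c).length) + A * (ζ.iterWord n v).length := by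
    refine (norm_twistedSum_append_append_self_le ω s φ _ _).trans ?_
    gcongr
    · exact (norm_nonneg _).trans (norm_one_add_fourierChar_le hρ hn)
    · exact norm_one_add_fourierChar_le hρ hn
    · exact ζ.norm_twistedSum_iter_le ω s φ n c
    · exact ζ.norm_twistedSum_iterWord_le ω s φ n v
  calc ‖twistedSum ω s φ (ζ.iter (n + q) b)‖
      ≤ ‖twistedSum ω s φ (ζ.iterWord n P)‖ +
          (‖twistedSum ω s φ (ζ.iter n c ++ ζ.iterWord n v ++ ζ.iter n c)‖ +
            ‖twistedSum ω s φ (ζ.iterWord n Q)‖) := by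
        rw [hword]
        exact (norm_twistedSum_append_le ω s φ _ _).trans
          (add_le_add_right (norm_twistedSum_append_le ω s φ _ _) _)
    _ ≤ A * (ζ.iterWord n P).length + (2 * Real.cos (Real.pi * ρ) * (A * (ζ.iter n c).length) +
          A * (ζ.iterWord n v).length + A * (ζ.iterWord n Q).length) := by
        gcongr
        · exact ζ.norm_twistedSum_iterWord_le ω s φ n P
        · exact ζ.norm_twistedSum_iterWord_le ω s φ n Q
    _ = A * ((ζ.iter (n + q) b).length -
          (2 - 2 * Real.cos (Real.pi * ρ)) * (ζ.iter n c).length) := by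
        rw [hlen]
        ring

lemma IsReturnWord.maxTwistedSum_add_le (hv : ζ.IsReturnWord q c v)
    (hp : ∀ a b, a ∈ ζ.iter p b) {ρ : ℝ} (hρ : 0 ≤ ρ) {n : ℕ}
    (hn : ρ ≤ distInt (ω * roofWord s (ζ.iterWord n (c :: v)))) :
    ζ.maxTwistedSum ω s φ (n + q) ≤
      (1 - (2 - 2 * Real.cos (Real.pi * ρ)) / (ζ.maxLen p * ζ.maxLen q)) *
        ζ.maxTwistedSum ω s φ n := by
  have : Nonempty (Fin m) := ⟨c⟩
  refine ζ.maxTwistedSum_le ω s φ fun b =>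
    (hv.norm_twistedSum_iter_add_le ω s φ hρ hn b).trans ?_
  have hlen : ((ζ.iter (n + q) b).length : ℝ) ≤
      (ζ.iter n c).length * (ζ.maxLen p * ζ.maxLen q) := by
    exact_mod_cast length_iter_add_le hp n q b c
  have hpos : (0 : ℝ) < ζ.maxLen p * ζ.maxLen q := by
    have hmax : ∀ k, (0 : ℝ) < ζ.maxLen k := fun k => by
      exact_mod_cast (ζ.length_iter_pos k c).trans_le (ζ.length_iter_le_maxLen k c)
    exact mul_pos (hmax p) (hmax q)
  have hgap : (2 - 2 * Real.cos (Real.pi * ρ)) / (ζ.maxLen p * ζ.maxLen q) *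
      (ζ.iter (n + q) b).length ≤ (2 - 2 * Real.cos (Real.pi * ρ)) * (ζ.iter n c).length := by
    rw [div_mul_eq_mul_div, div_le_iff₀ hpos, mul_assoc]
    gcongr
    linarith [Real.cos_le_one (Real.pi * ρ)]
  rw [mul_comm (1 - _) (ζ.maxTwistedSum ω s φ n), mul_assoc]
  gcongr
  · exact ζ.maxTwistedSum_nonneg ω s φ n
  · linarith

lemma IsReturnWord.exists_contraction_factor (hv : ζ.IsReturnWord q c v)
    (hp : ∀ a b, a ∈ ζ.iter p b) {ρ : ℝ} (hρ : 0 < ρ) (hρ1 : ρ ≤ 1) :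
    ∃ ν : ℝ, 0 < ν ∧ ν < 1 ∧ ∀ (ω : ℝ) (s : Fin m → ℝ) (φ : Fin m → ℂ) (n : ℕ),
      ρ ≤ distInt (ω * roofWord s (ζ.iterWord n (c :: v))) →
        ζ.maxTwistedSum ω s φ (n + q) ≤ ν ^ q * ζ.maxTwistedSum ω s φ n := by
  set κ : ℝ := (2 - 2 * Real.cos (Real.pi * ρ)) / (ζ.maxLen p * ζ.maxLen q)
  have hcos : Real.cos (Real.pi * ρ) < 1 := by
    simpa using Real.cos_lt_cos_of_nonneg_of_le_pi le_rfl
      (by nlinarith [Real.pi_pos] : Real.pi * ρ ≤ Real.pi) (by positivity)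
  have hκ : 0 < κ := by
    have hp0 := (ζ.length_iter_pos p c).trans_le (ζ.length_iter_le_maxLen p c)
    have hq0 := (ζ.length_iter_pos q c).trans_le (ζ.length_iter_le_maxLen q c)
    exact div_pos (by linarith) (by positivity)
  have hpos : (0 : ℝ) < max (1 - κ) (1 / 2) := by positivity
  have hlt : max (1 - κ) (1 / 2) < 1 := max_lt (by linarith) (by norm_num)
  refine ⟨max (1 - κ) (1 / 2) ^ (q : ℝ)⁻¹, Real.rpow_pos_of_pos hpos _,
    Real.rpow_lt_one hpos.le hlt (by simpa [Nat.pos_iff_ne_zero] using hv.ne_zero),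
    fun ω s φ n hn => ?_⟩
  rw [Real.rpow_inv_natCast_pow hpos.le hv.ne_zero]
  refine (hv.maxTwistedSum_add_le ω s φ hp hρ.le hn).trans ?_
  gcongr
  · exact ζ.maxTwistedSum_nonneg ω s φ n
  · exact le_max_left _ _

lemma IsReturnWord.exists_norm_twistedSum_iterWord_le (hv : ζ.IsReturnWord q c v)
    (hp : ∀ a b, a ∈ ζ.iter p b) {ρ : ℝ} (hρ : 0 < ρ) (hρ1 : ρ ≤ 1) :
    ∃ ν : ℝ, 0 < ν ∧ ν < 1 ∧ ∀ (ω : ℝ) (s : Fin m → ℝ) (φ : Fin m → ℂ) (M : ℝ),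
      (∀ a, ‖φ a‖ ≤ M) → ∀ (n : ℕ) (w : List (Fin m)),
        ‖twistedSum ω s φ (ζ.iterWord (n + q) w)‖ ≤
          M * ν ^ farCount ρ (fun k => ω * roofWord s (ζ.iterWord k (c :: v))) n *
            (ζ.iterWord (n + q) w).length := by
  obtain ⟨ν, hν0, hν1, hcontract⟩ := hv.exists_contraction_factor hp hρ hρ1
  refine ⟨ν, hν0, hν1, fun ω s φ M hM n w => ?_⟩
  have : Nonempty (Fin m) := ⟨c⟩
  have hzero : ζ.maxTwistedSum ω s φ 0 ≤ M :=
    ζ.maxTwistedSum_le ω s φ fun a => norm_twistedSum_le ω s hM _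
  refine (ζ.norm_twistedSum_iterWord_le ω s φ (n + q) w).trans ?_
  gcongr
  refine (le_mul_pow_count_of_antitone (ζ.antitone_maxTwistedSum ω s φ)
    (ζ.maxTwistedSum_nonneg ω s φ) hv.ne_zero hν0.le _ (hcontract ω s φ) n).trans ?_
  rw [farCount]
  gcongr

end Substitution

/-! ### Perron–Frobenius theory -/

section PerronFrobenius

open Matrix

variable {n : Type*} [Fintype n] {A : Matrix n n ℝ}

lemma pow_mulVec_of_mulVec_eq_smul {R : Type*} [CommSemiring R] [DecidableEq n] {A : Matrix n n R}
    {θ : R} {w : n → R} (hw : A *ᵥ w = θ • w) (k : ℕ) : (A ^ k) *ᵥ w = θ ^ k • w := by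
  induction k with
  | zero => simp
  | succ k ih => rw [pow_succ', ← mulVec_mulVec, ih, mulVec_smul, hw, smul_smul, pow_succ]

lemma mulVec_nonneg_of_nonneg (hA : ∀ i j, 0 ≤ A i j) {x : n → ℝ} (hx : 0 ≤ x) : 0 ≤ A *ᵥ x :=
  fun i => Finset.sum_nonneg fun j _ => mul_nonneg (hA i j) (hx j)

lemma mulVec_pos_of_pos (hA : ∀ i j, 0 < A i j) {x : n → ℝ} (hx : 0 ≤ x) (hx0 : x ≠ 0) (i : n) :
    0 < (A *ᵥ x) i := by
  obtain ⟨j, hj⟩ := Function.ne_iff.1 hx0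
  exact Finset.sum_pos' (fun k _ => mul_nonneg (hA i k).le (hx k))
    ⟨j, Finset.mem_univ j, mul_pos (hA i j) ((hx j).lt_of_ne' hj)⟩

lemma le_sum_of_smul_le_mulVec (hA : ∀ i j, 0 ≤ A i j) {t : ℝ} {x : n → ℝ}
    (hx : x ∈ stdSimplex ℝ n) (h : t • x ≤ A *ᵥ x) : t ≤ ∑ i, ∑ j, A i j :=
  calc t = ∑ i, (t • x) i := by simp [← Finset.mul_sum, hx.2]
    _ ≤ ∑ i, ∑ j, A i j * x j := Finset.sum_le_sum fun i _ => h i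
    _ ≤ ∑ i, ∑ j, A i j := Finset.sum_le_sum fun i _ => Finset.sum_le_sum fun j _ =>
      mul_le_of_le_one_right (hA i j)
        (hx.2 ▸ Finset.single_le_sum (fun k _ => hx.1 k) (Finset.mem_univ j))

lemma exists_pos_smul_mem_stdSimplex {u : n → ℝ} (hu : 0 ≤ u) (hu0 : u ≠ 0) :
    ∃ c : ℝ, 0 < c ∧ c • u ∈ stdSimplex ℝ n := by
  have hsum : 0 < ∑ i, u i := by
    obtain ⟨i, hi⟩ := Function.ne_iff.1 hu0
    exact Finset.sum_pos' (fun i _ => hu i) ⟨i, Finset.mem_univ i, (hu i).lt_of_ne' hi⟩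
  refine ⟨(∑ i, u i)⁻¹, inv_pos.2 hsum, fun i => mul_nonneg (inv_pos.2 hsum).le (hu i), ?_⟩
  simp [← Finset.mul_sum, hsum.ne']

lemma isCompact_setOf_smul_le_mulVec (A : Matrix n n ℝ) (B : ℝ) :
    IsCompact ((Icc 0 B ×ˢ stdSimplex ℝ n) ∩ {y : ℝ × (n → ℝ) | y.1 • y.2 ≤ A *ᵥ y.2}) := by
  refine (isCompact_Icc.prod (isCompact_stdSimplex (𝕜 := ℝ) n)).inter_right
    (isClosed_le (by fun_prop) ?_)
  exact continuous_const.matrix_mulVec continuous_snd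

lemma exists_collatzWielandt_maximizer [Nonempty n] (hA : ∀ i j, 0 ≤ A i j) :
    ∃ (r : ℝ) (x : n → ℝ), 0 ≤ x ∧ x ≠ 0 ∧ r • x ≤ A *ᵥ x ∧
      ∀ (t : ℝ) (u : n → ℝ), 0 ≤ u → u ≠ 0 → t • u ≤ A *ᵥ u → t ≤ r := by
  classical
  set T := (Icc 0 (∑ i, ∑ j, A i j) ×ˢ stdSimplex ℝ n) ∩ {y | y.1 • y.2 ≤ A *ᵥ y.2}
  have hmem {t : ℝ} {x : n → ℝ} (ht : 0 ≤ t) (hx : x ∈ stdSimplex ℝ n) (h : t • x ≤ A *ᵥ x) :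
      (t, x) ∈ T := ⟨⟨⟨ht, le_sum_of_smul_le_mulVec hA hx h⟩, hx⟩, h⟩
  obtain ⟨x₀, hx₀⟩ := (inferInstance : Nonempty (stdSimplex ℝ n))
  have hT : T.Nonempty :=
    ⟨_, hmem le_rfl hx₀ (by simpa using mulVec_nonneg_of_nonneg hA hx₀.1)⟩
  obtain ⟨⟨r, x⟩, ⟨⟨hr, hx⟩, hrx⟩, hmax⟩ :=
    (isCompact_setOf_smul_le_mulVec A _).exists_isMaxOn hT continuousOn_fst
  refine ⟨r, x, hx.1, ?_, hrx, fun t u hu hu0 h => ?_⟩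
  · rintro rfl
    simpa using hx.2
  rcases lt_or_ge t 0 with ht | ht
  · exact ht.le.trans hr.1
  · obtain ⟨c, hc, hcu⟩ := exists_pos_smul_mem_stdSimplex hu hu0
    refine hmax (hmem ht hcu ?_)
    rw [mulVec_smul, smul_comm]
    exact smul_le_smul_of_nonneg_left h hc.le

lemma exists_lt_smul_le_mulVec [Nonempty n] {r : ℝ} {y : n → ℝ} (hy : ∀ i, 0 < y i)
    (h : ∀ i, 0 < (A *ᵥ y - r • y) i) : ∃ t, r < t ∧ t • y ≤ A *ᵥ y := by
  obtain ⟨i₀, hi₀⟩ := Finite.exists_min fun i => (A *ᵥ y - r • y) i / y i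
  refine ⟨r + (A *ᵥ y - r • y) i₀ / y i₀, lt_add_of_pos_right _ (div_pos (h i₀) (hy i₀)),
    fun i => ?_⟩
  have hi := (le_div_iff₀ (hy i)).1 (hi₀ i)
  simp only [Pi.sub_apply, Pi.smul_apply, smul_eq_mul] at hi ⊢
  linarith

variable [DecidableEq n]

lemma mulVec_eq_smul_of_collatzWielandt_maximizer [Nonempty n] {p : ℕ}
    (hp : ∀ i j, 0 < (A ^ p) i j) {r : ℝ} {x : n → ℝ} (hx : 0 ≤ x) (hx0 : x ≠ 0)
    (hrx : r • x ≤ A *ᵥ x) (hmax : ∀ (t : ℝ) (u : n → ℝ), 0 ≤ u → u ≠ 0 → t • u ≤ A *ᵥ u → t ≤ r) :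
    A *ᵥ x = r • x := by
  by_contra hne
  have hpos := mulVec_pos_of_pos hp hx hx0
  have hgap := mulVec_pos_of_pos hp (sub_nonneg.2 hrx) (sub_ne_zero.2 hne)
  have hcomm : (A ^ p) *ᵥ (A *ᵥ x - r • x) = A *ᵥ ((A ^ p) *ᵥ x) - r • ((A ^ p) *ᵥ x) := by
    rw [mulVec_sub, mulVec_smul, mulVec_mulVec, mulVec_mulVec, ← pow_succ, ← pow_succ']
  rw [hcomm] at hgap
  obtain ⟨t, hrt, ht⟩ := exists_lt_smul_le_mulVec hpos hgap
  obtain ⟨i⟩ := ‹Nonempty n›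
  exact hrt.not_ge (hmax t _ (fun i => (hpos i).le)
    (fun h => (hpos i).ne' (congrFun h i)) ht)

theorem exists_perron_eigenvector [Nonempty n] (hA : A.IsPrimitive) :
    ∃ (r : ℝ) (w : n → ℝ), (∀ i, 0 < w i) ∧ A *ᵥ w = r • w ∧
      ∀ (θ : ℂ) (v : n → ℂ), v ≠ 0 → A.map Complex.ofReal *ᵥ v = θ • v → ‖θ‖ ≤ r := by
  obtain ⟨p, -, hp⟩ := hA.exists_pos_pow
  obtain ⟨r, x, hx, hx0, hrx, hmax⟩ := exists_collatzWielandt_maximizer hA.nonneg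
  have heig : A *ᵥ x = r • x := mulVec_eq_smul_of_collatzWielandt_maximizer hp hx hx0 hrx hmax
  refine ⟨r, x, fun i => (hx i).lt_of_ne' fun hi => ?_, heig, fun θ v hv hθ => ?_⟩
  · have hpos := mulVec_pos_of_pos hp hx hx0 i
    rw [pow_mulVec_of_mulVec_eq_smul heig, Pi.smul_apply, hi, Pi.zero_apply, smul_zero] at hpos
    exact hpos.false
  · refine hmax ‖θ‖ (fun i => ‖v i‖) (fun i => norm_nonneg _) (fun h => hv ?_) fun i => ?_
    · exact funext fun i => norm_eq_zero.1 (congrFun h i)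
    · calc ‖θ‖ * ‖v i‖ = ‖(A.map Complex.ofReal *ᵥ v) i‖ := by
            rw [hθ, Pi.smul_apply, norm_smul]
        _ ≤ ∑ j, ‖A.map Complex.ofReal i j * v j‖ := norm_sum_le _ _
        _ = (A *ᵥ fun i => ‖v i‖) i := by
            simp [mulVec, dotProduct, abs_of_nonneg (hA.nonneg i _)]

end PerronFrobenius

/-! ### Krylov recurrences -/

section Krylov

open Matrix Polynomial

variable {m : ℕ} {R K : Type*} [CommRing R] [Field K]

/-- The Krylov matrix of `A` and `v`, with columns `v, A v, …, A ^ (m - 1) v`. -/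
def krylov (A : Matrix (Fin m) (Fin m) R) (v : Fin m → R) : Matrix (Fin m) (Fin m) R :=
  of fun i j => ((A ^ (j : ℕ)) *ᵥ v) i

lemma map_pow_mulVec {R' : Type*} [CommRing R'] (f : R →+* R') (A : Matrix (Fin m) (Fin m) R)
    (v : Fin m → R) (k : ℕ) : f ∘ ((A ^ k) *ᵥ v) = ((A.map f) ^ k) *ᵥ (f ∘ v) := by
  ext i
  rw [Function.comp_apply, RingHom.map_mulVec, Matrix.map_pow]

lemma krylov_map {R' : Type*} [CommRing R'] (f : R →+* R') (A : Matrix (Fin m) (Fin m) R)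
    (v : Fin m → R) : (krylov A v).map f = krylov (A.map f) (f ∘ v) := by
  ext i j
  exact congrFun (map_pow_mulVec f A v j) i

lemma det_krylov_map_ne_zero_iff {R' : Type*} [CommRing R'] {f : R →+* R'}
    (hf : Function.Injective f) (A : Matrix (Fin m) (Fin m) R) (v : Fin m → R) :
    (krylov (A.map f) (f ∘ v)).det ≠ 0 ↔ (krylov A v).det ≠ 0 := by
  rw [← krylov_map, ← RingHom.mapMatrix_apply, ← RingHom.map_det, map_ne_zero_iff f hf]

lemma krylov_mulVec (A : Matrix (Fin m) (Fin m) R) (v q : Fin m → R) :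
    krylov A v *ᵥ q = ∑ j, q j • ((A ^ (j : ℕ)) *ᵥ v) := by
  ext i
  simp [krylov, mulVec, dotProduct, mul_comm]

lemma aeval_mulVec_ne_zero {A : Matrix (Fin m) (Fin m) K} (hA : Irreducible A.charpoly)
    {P : K[X]} (hP0 : P ≠ 0) (hP : P.degree < m) {v : Fin m → K} (hv : v ≠ 0) :
    aeval A P *ᵥ v ≠ 0 := by
  intro hPv
  have hcop : IsCoprime A.charpoly P := by
    refine hA.coprime_iff_not_dvd.2 fun hdvd => (degree_le_of_dvd hdvd hP0).not_gt ?_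
    rwa [charpoly_degree_eq_dim, Fintype.card_fin]
  obtain ⟨a, b, hab⟩ := hcop
  have hone := congrArg (fun Q => aeval A Q *ᵥ v) hab
  simp only [map_add, map_mul, aeval_self_charpoly, mul_zero, zero_add, map_one, one_mulVec,
    ← mulVec_mulVec, hPv, mulVec_zero] at hone
  exact hv hone.symm

lemma det_krylov_ne_zero {A : Matrix (Fin m) (Fin m) K} (hA : Irreducible A.charpoly)
    {v : Fin m → K} (hv : v ≠ 0) : (krylov A v).det ≠ 0 := by
  intro hdet
  obtain ⟨q, hq0, hq⟩ := exists_mulVec_eq_zero_iff.2 hdet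
  set P : K[X] := ∑ j : Fin m, C (q j) * X ^ (j : ℕ) with hP
  have hcoeff (j : Fin m) : P.coeff j = q j := by
    simp [hP, finsetSum_coeff, coeff_C_mul, coeff_X_pow, Fin.val_inj, Finset.sum_ite_eq]
  have hP0 : P ≠ 0 := fun h => hq0 (funext fun j => by simp [← hcoeff j, h])
  refine aeval_mulVec_ne_zero hA hP0 (degree_sum_fin_lt q) hv ?_
  rw [← hq, krylov_mulVec, hP, map_sum, sum_mulVec]
  refine Finset.sum_congr rfl fun j _ => ?_
  rw [← smul_eq_C_mul, map_smul, map_pow, aeval_X, smul_mulVec]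

lemma exists_pow_smul_eigenvector_eq_sum {A : Matrix (Fin m) (Fin m) K} {v : Fin m → K}
    (hdet : (krylov A v).det ≠ 0) {θ : K} {w : Fin m → K} (hw : A *ᵥ w = θ • w) :
    ∃ q : Fin m → K, ∀ k : ℕ, θ ^ k • w = ∑ j : Fin m, q j • ((A ^ (k + (j : ℕ))) *ᵥ v) := by
  refine ⟨(krylov A v)⁻¹ *ᵥ w, fun k => ?_⟩
  have hw' : w = ∑ j, ((krylov A v)⁻¹ *ᵥ w) j • ((A ^ (j : ℕ)) *ᵥ v) := by
    rw [← krylov_mulVec, mulVec_mulVec, mul_nonsing_inv _ hdet.isUnit, one_mulVec]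
  rw [← pow_mulVec_of_mulVec_eq_smul hw]
  conv_lhs => rw [hw', mulVec_sum]
  simp only [mulVec_smul, mulVec_mulVec, ← pow_add]

lemma exists_krylov_recurrence (A : Matrix (Fin m) (Fin m) R) (v : Fin m → R) :
    ∃ c : Fin m → R, ∀ k : ℕ,
      (A ^ (k + m)) *ᵥ v = ∑ j : Fin m, c j • ((A ^ (k + (j : ℕ))) *ᵥ v) := by
  nontriviality R
  refine ⟨fun j => -A.charpoly.coeff j, fun k => ?_⟩
  have hdeg : A.charpoly.natDegree = m := by rw [charpoly_natDegree_eq_dim, Fintype.card_fin]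
  have hlead : A.charpoly.coeff m = 1 := by
    have h := A.charpoly_monic.coeff_natDegree
    rwa [hdeg] at h
  have hcayley := aeval_self_charpoly A
  rw [aeval_eq_sum_range, hdeg, Finset.sum_range_succ, hlead, one_smul] at hcayley
  rw [pow_add, eq_neg_of_add_eq_zero_right hcayley, mul_neg, Finset.mul_sum, Finset.sum_range,
    ← Finset.sum_neg_distrib, sum_mulVec]
  simp only [mul_smul_comm, ← pow_add, ← neg_smul, smul_mulVec]

lemma exists_mulVec_eq_smul_of_isRoot_charpoly {n : Type*} [Fintype n] [DecidableEq n]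
    {A : Matrix n n K} {θ : K} (hθ : A.charpoly.IsRoot θ) : ∃ w ≠ 0, A *ᵥ w = θ • w := by
  rw [IsRoot, eval_charpoly] at hθ
  obtain ⟨w, hw0, hw⟩ := exists_mulVec_eq_zero_iff.2 hθ
  refine ⟨w, hw0, ?_⟩
  rw [sub_mulVec, sub_eq_zero, scalar_apply, ← smul_one_eq_diagonal, smul_mulVec, one_mulVec] at hw
  exact hw.symm

end Krylov

section Controlled

open Matrix

variable {m : ℕ}

/-- The functional `w` is determined, with an exponentially small error, by any `m` consecutive
members of the sequence `u` of functionals: if these are at most `D` in modulus at `x`, then `w` is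
at most `C * D * τ ^ k` in modulus at `x`. -/
def IsControlledBy (u : ℕ → Fin m → ℝ) (C τ : ℝ) (w : Fin m → ℝ) : Prop :=
  ∀ (x : Fin m → ℝ) (k : ℕ) (D : ℝ),
    (∀ j < m, |x ⬝ᵥ u (k + j)| ≤ D) → |x ⬝ᵥ w| ≤ C * D * τ ^ k

lemma IsControlledBy.mono [NeZero m] {u : ℕ → Fin m → ℝ} {C C' τ τ' : ℝ} {w : Fin m → ℝ}
    (h : IsControlledBy u C τ w) (hC : 0 ≤ C) (hCC' : C ≤ C') (hτ : 0 ≤ τ) (hττ' : τ ≤ τ') :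
    IsControlledBy u C' τ' w := by
  intro x k D hD
  have hD0 : 0 ≤ D := (abs_nonneg _).trans (hD 0 (NeZero.pos m))
  have hC'0 : 0 ≤ C' := hC.trans hCC'
  refine (h x k D hD).trans ?_
  gcongr

lemma exists_isControlledBy_of_eigenvector [NeZero m] {K : Type*} [RCLike K]
    {A : Matrix (Fin m) (Fin m) ℝ} {v : Fin m → ℝ} (hdet : (krylov A v).det ≠ 0) {θ : K}
    (hθ : θ ≠ 0) {y : Fin m → K} (hy : A.map (algebraMap ℝ K) *ᵥ y = θ • y) {w : Fin m → ℝ}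
    (hw : ∀ x : Fin m → ℝ, |x ⬝ᵥ w| ≤ ‖(algebraMap ℝ K ∘ x) ⬝ᵥ y‖) :
    ∃ C : ℝ, 0 < C ∧ IsControlledBy (fun k => (A ^ k) *ᵥ v) C ‖θ‖⁻¹ w := by
  have hdetK : (krylov (A.map (algebraMap ℝ K)) (algebraMap ℝ K ∘ v)).det ≠ 0 :=
    (det_krylov_map_ne_zero_iff (algebraMap ℝ K).injective A v).2 hdet
  obtain ⟨q, hq⟩ := exists_pow_smul_eigenvector_eq_sum hdetK hy
  refine ⟨1 + ∑ j, ‖q j‖, by positivity, fun x k D hx => (hw x).trans ?_⟩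
  have hD : 0 ≤ D := (abs_nonneg _).trans (hx 0 (NeZero.pos m))
  have hexpand : θ ^ k * ((algebraMap ℝ K ∘ x) ⬝ᵥ y) =
      ∑ j : Fin m, q j * algebraMap ℝ K (x ⬝ᵥ ((A ^ (k + (j : ℕ))) *ᵥ v)) := by
    rw [← smul_eq_mul, ← dotProduct_smul, hq, dotProduct_sum]
    refine Finset.sum_congr rfl fun j _ => ?_
    rw [dotProduct_smul, smul_eq_mul, ← map_pow_mulVec, RingHom.map_dotProduct]
  have hsum : ‖θ‖ ^ k * ‖(algebraMap ℝ K ∘ x) ⬝ᵥ y‖ ≤ (1 + ∑ j, ‖q j‖) * D := by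
    rw [← norm_pow, ← norm_mul, hexpand]
    calc _ ≤ ∑ j : Fin m, ‖q j‖ * D := by
          refine (norm_sum_le _ _).trans (Finset.sum_le_sum fun j _ => ?_)
          rw [norm_mul, norm_algebraMap', Real.norm_eq_abs]
          exact mul_le_mul_of_nonneg_left (hx j j.2) (norm_nonneg _)
      _ ≤ (1 + ∑ j, ‖q j‖) * D := by
          rw [← Finset.sum_mul]
          exact mul_le_mul_of_nonneg_right (by linarith) hD
  rw [inv_pow, ← div_eq_mul_inv, le_div_iff₀ (by positivity), mul_comm]
  exact hsum

lemma eigenvector_ne_smul_ofReal {A : Matrix (Fin m) (Fin m) ℝ} {lam : ℝ} {w : Fin m → ℝ}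
    (hw : A *ᵥ w = lam • w) {θ : ℂ} (hne : θ ≠ lam) {u : Fin m → ℂ} (hu0 : u ≠ 0)
    (hu : A.map Complex.ofReal *ᵥ u = θ • u) (c : ℂ) : u ≠ c • (Complex.ofReal ∘ w) := by
  rintro rfl
  have hwC : A.map Complex.ofReal *ᵥ (Complex.ofReal ∘ w) =
      (lam : ℂ) • (Complex.ofReal ∘ w) := by
    ext i
    have h := congrArg Complex.ofReal (congrFun hw i)
    simpa [mulVec, dotProduct] using h
  rw [mulVec_smul, hwC, smul_comm, ← sub_eq_zero, ← sub_smul] at hu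
  exact (smul_eq_zero.1 hu).elim (fun h => hne (sub_eq_zero.1 h).symm) hu0

lemma exists_real_functional_notMem_span {w : Fin m → ℝ} {u : Fin m → ℂ}
    (hu : ∀ c : ℂ, u ≠ c • (Complex.ofReal ∘ w)) :
    ∃ b : Fin m → ℝ, b ∉ Submodule.span ℝ {w} ∧
      ∀ x : Fin m → ℝ, |x ⬝ᵥ b| ≤ ‖(Complex.ofReal ∘ x) ⬝ᵥ u‖ := by
  have hre (x : Fin m → ℝ) : (Complex.ofReal ∘ x) ⬝ᵥ u =
      ⟨x ⬝ᵥ fun i => (u i).re, x ⬝ᵥ fun i => (u i).im⟩ := by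
    apply Complex.ext <;> simp [dotProduct]
  simp only [Submodule.mem_span_singleton]
  by_cases hw : ∃ c : ℝ, c • w = fun i => (u i).re
  · obtain ⟨c, hc⟩ := hw
    refine ⟨fun i => (u i).im, ?_, fun x => ?_⟩
    · rintro ⟨c', hc'⟩
      refine hu ⟨c, c'⟩ (funext fun i => Complex.ext ?_ ?_)
      · simpa using (congrFun hc i).symm
      · simpa using (congrFun hc' i).symm
    · rw [hre]
      exact Complex.abs_im_le_norm ⟨_, _⟩
  · refine ⟨fun i => (u i).re, hw, fun x => ?_⟩
    rw [hre]
    exact Complex.abs_re_le_norm ⟨_, _⟩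

end Controlled

/-! ### Pairings of a roof vector with the columns of `S ^ n` -/

section Spectrum

open Matrix Polynomial

lemma nodup_roots_charpoly_intCast {n : Type*} [Fintype n] [DecidableEq n] {A : Matrix n n ℤ}
    (hA : Irreducible (A.map (Int.cast : ℤ → ℚ)).charpoly) :
    (A.map (Int.cast : ℤ → ℂ)).charpoly.roots.Nodup := by
  have hmap : (A.map (Int.cast : ℤ → ℂ)).charpoly =
      (A.map (Int.cast : ℤ → ℚ)).charpoly.map (algebraMap ℚ ℂ) := by
    rw [← charpoly_map]
    congr 1
  exact nodup_roots (hmap ▸ hA.separable.map)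

lemma two_le_countP_of_lt_getD_one {α : Type*} [LinearOrder α] {l : List α}
    (hl : l.Pairwise (· ≥ ·)) {c d : α} (hdc : d ≤ c) (hc : c < l.getD 1 d) :
    2 ≤ l.countP (c < ·) := by
  match l with
  | [] => exact absurd hc hdc.not_gt
  | [_] => exact absurd hc hdc.not_gt
  | a :: b :: t =>
    have hcb : c < b := hc
    have hba : b ≤ a := (List.pairwise_cons.1 hl).1 b List.mem_cons_self
    rw [List.countP_cons_of_pos (by simpa using hcb.trans_le hba),
      List.countP_cons_of_pos (by simpa using hcb)]
    omega

lemma exists_ne_of_two_le_countP {α : Type*} {s : Multiset α} (hs : s.Nodup)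
    {P : α → Prop} [DecidablePred P] (hP : 2 ≤ s.countP P) (a : α) : ∃ b ∈ s, b ≠ a ∧ P b := by
  rw [Multiset.countP_eq_card_filter] at hP
  obtain ⟨b, hb, hba⟩ := Finset.exists_mem_ne (s := ⟨s.filter P, hs.filter P⟩) hP a
  obtain ⟨hbs, hPb⟩ := Multiset.mem_filter.1 hb
  exact ⟨b, hbs, hba, hPb⟩

end Spectrum

namespace Substitution

open Matrix

variable {m : ℕ} {ζ : Substitution m}

lemma two_le_of_one_lt_secondModulus (hθ : 1 < ζ.secondModulus) : 2 ≤ m := by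
  by_contra! hm
  have hlen : ζ.eigenvalueModuli.length ≤ 1 := by
    rw [eigenvalueModuli, Multiset.length_sort, Multiset.card_map]
    refine (Polynomial.card_roots' _).trans ?_
    rw [charpoly_natDegree_eq_dim, Fintype.card_fin]
    omega
  rw [secondModulus, List.getD_eq_default _ _ hlen] at hθ
  linarith

lemma exists_isRoot_charpoly_ne (hirr : Irreducible (ζ.matrix.map (Int.cast : ℤ → ℚ)).charpoly)
    (hθ : 1 < ζ.secondModulus) (lam : ℂ) :
    ∃ θ : ℂ, (ζ.matrix.map (Int.cast : ℤ → ℂ)).charpoly.IsRoot θ ∧ θ ≠ lam ∧ 1 < ‖θ‖ := by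
  have hcount := two_le_countP_of_lt_getD_one (Multiset.pairwise_sort _ _) zero_le_one hθ
  rw [← Multiset.coe_countP, Multiset.sort_eq, Multiset.countP_map,
    ← Multiset.countP_eq_card_filter] at hcount
  obtain ⟨θ, hroot, hne, hθ1⟩ :=
    exists_ne_of_two_le_countP (nodup_roots_charpoly_intCast hirr) hcount lam
  exact ⟨θ, Polynomial.isRoot_of_mem_roots hroot, hne, hθ1⟩

lemma isPrimitive_matrix_real (hprim : ζ.Primitive) :
    (ζ.matrix.map (Int.cast : ℤ → ℝ)).IsPrimitive := by
  obtain ⟨p, hp0, hp⟩ := hprim.exists_pos_pow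
  refine ⟨fun i j => by simp [matrix], p, hp0, fun i j => ?_⟩
  have hpow : ζ.matrix.map (Int.cast : ℤ → ℝ) ^ p = (ζ.matrix ^ p).map (Int.cast : ℤ → ℝ) :=
    (Matrix.map_pow ζ.matrix (Int.castRingHom ℝ) p).symm
  rw [hpow]
  exact Int.cast_pos.2 (hp i j)

lemma exists_controlled_functionals (hprim : ζ.Primitive)
    (hirr : Irreducible (ζ.matrix.map (Int.cast : ℤ → ℚ)).charpoly)
    (hθ : 1 < ζ.secondModulus) {v : Fin m → ℤ} (hv : v ≠ 0) :
    ∃ (w b : Fin m → ℝ) (C τ : ℝ), 0 < τ ∧ τ < 1 ∧ (∀ i, 0 < w i) ∧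
      b ∉ Submodule.span ℝ {w} ∧
      IsControlledBy (fun k => Int.cast ∘ ((ζ.matrix ^ k) *ᵥ v)) C τ w ∧
      IsControlledBy (fun k => Int.cast ∘ ((ζ.matrix ^ k) *ᵥ v)) C τ b := by
  have hm : 2 ≤ m := two_le_of_one_lt_secondModulus hθ
  have : NeZero m := ⟨by omega⟩
  set A : Matrix (Fin m) (Fin m) ℝ := ζ.matrix.map (Int.cast : ℤ → ℝ) with hA
  have hAC : A.map Complex.ofReal = ζ.matrix.map (Int.cast : ℤ → ℂ) := by ext i j; simp [hA]
  have hpow (k : ℕ) : Int.cast ∘ ((ζ.matrix ^ k) *ᵥ v) = (A ^ k) *ᵥ (Int.cast ∘ v : Fin m → ℝ) :=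
    map_pow_mulVec (Int.castRingHom ℝ) ζ.matrix v k
  have hdet : (krylov A (Int.cast ∘ v)).det ≠ 0 := by
    have hvQ : (Int.cast ∘ v : Fin m → ℚ) ≠ 0 := fun h =>
      hv (funext fun i => Int.cast_injective (α := ℚ) ((congrFun h i).trans Int.cast_zero.symm))
    exact (det_krylov_map_ne_zero_iff (RingHom.injective_int (Int.castRingHom ℝ)) _ _).2 <|
      (det_krylov_map_ne_zero_iff (RingHom.injective_int (Int.castRingHom ℚ)) _ _).1 <|
        det_krylov_ne_zero hirr hvQ
  obtain ⟨lam, w, hw0, hw, hmax⟩ := exists_perron_eigenvector (isPrimitive_matrix_real hprim)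
  obtain ⟨θ, hroot, hne, hθ1⟩ := exists_isRoot_charpoly_ne hirr hθ (lam : ℂ)
  obtain ⟨u, hu0, hu⟩ := exists_mulVec_eq_smul_of_isRoot_charpoly hroot
  rw [← hAC] at hu
  have hlam1 : 1 < lam := hθ1.trans_le (hmax θ u hu0 hu)
  have hlam0 : 0 < lam := zero_lt_one.trans hlam1
  obtain ⟨b, hb, hbu⟩ :=
    exists_real_functional_notMem_span (eigenvector_ne_smul_ofReal hw hne hu0 hu)
  obtain ⟨C₁, hC₁, hCw⟩ := exists_isControlledBy_of_eigenvector (K := ℝ) hdet hlam0.ne' (y := w)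
    (by simpa using hw) (fun _ => le_rfl)
  obtain ⟨C₂, hC₂, hCb⟩ := exists_isControlledBy_of_eigenvector (K := ℂ) hdet
    (norm_pos_iff.1 (zero_lt_one.trans hθ1)) hu hbu
  rw [Real.norm_of_nonneg hlam0.le] at hCw
  simp only [hpow]
  exact ⟨w, b, max C₁ C₂, max lam⁻¹ ‖θ‖⁻¹, lt_max_of_lt_left (inv_pos.2 hlam0),
    max_lt (inv_lt_one_of_one_lt₀ hlam1) (inv_lt_one_of_one_lt₀ hθ1), hw0, hb,
    hCw.mono hC₁.le (le_max_left _ _) (inv_pos.2 hlam0).le (le_max_left _ _),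
    hCb.mono hC₂.le (le_max_right _ _) (by positivity) (le_max_right _ _)⟩

end Substitution

/-! ### The Erdős–Kahane argument -/

section Sparse

lemma volume_image_le_card_mul_ofReal {α ι : Type*} (B : Set α) (g : α → ℝ) (code : α → ι)
    (I : Finset ι) (hcode : ∀ x ∈ B, code x ∈ I) {d : ℝ}
    (hd : ∀ x ∈ B, ∀ y ∈ B, code x = code y → |g x - g y| ≤ d) :
    volume (g '' B) ≤ I.card * ENNReal.ofReal d := by
  have hcover : g '' B ⊆ ⋃ i ∈ I, g '' {x ∈ B | code x = i} := by
    rintro _ ⟨x, hx, rfl⟩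
    simp only [mem_iUnion]
    exact ⟨code x, hcode x hx, x, ⟨hx, rfl⟩, rfl⟩
  refine (measure_mono hcover).trans ((measure_biUnion_finset_le I _).trans ?_)
  rw [← nsmul_eq_mul, ← Finset.sum_const]
  refine Finset.sum_le_sum fun i _ => (Real.volume_le_diam _).trans (Metric.ediam_le ?_)
  rintro _ ⟨x, hx, rfl⟩ _ ⟨y, hy, rfl⟩
  rw [edist_dist, Real.dist_eq]
  exact ENNReal.ofReal_le_ofReal (hd x hx.1 y hy.1 (hx.2.trans hy.2.symm))

/-- The integer sequences of length `n` with entries in `[-H, H]`, at most `J` of them nonzero. -/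
def sparseSequences (n H : ℕ) (J : ℝ) : Finset (Fin n → ℤ) :=
  (Fintype.piFinset fun _ => Finset.Icc (-H : ℤ) H).filter fun e =>
    ((Finset.univ.filter fun k => e k ≠ 0).card : ℝ) ≤ J

lemma sum_Icc_ite_eq_zero (H : ℕ) (t : ℝ) :
    ∑ e ∈ Finset.Icc (-H : ℤ) H, (if e = 0 then 1 else t) = 1 + 2 * H * t := by
  have h0 : (0 : ℤ) ∈ Finset.Icc (-H : ℤ) H := by simp
  have hcard : ((H : ℤ) + 1 - -(H : ℤ)).toNat - 1 = 2 * H := by omega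
  rw [← Finset.add_sum_erase _ _ h0, if_pos rfl,
    Finset.sum_congr rfl (g := fun _ => t) fun e he => if_neg (Finset.ne_of_mem_erase he),
    Finset.sum_const, Finset.card_erase_of_mem h0, Int.card_Icc, nsmul_eq_mul, hcard]
  push_cast
  ring

-- Weight each sequence by `t` to the number of its nonzero entries; the total weight factorizes.
lemma card_sparseSequences_mul_rpow_le (n H : ℕ) (J : ℝ) {t : ℝ} (ht : 0 < t) (ht1 : t ≤ 1) :
    ((sparseSequences n H J).card : ℝ) * t ^ J ≤ (1 + 2 * H * t) ^ n := by
  have htotal : ∑ e ∈ Fintype.piFinset fun _ : Fin n => Finset.Icc (-H : ℤ) H,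
      ∏ k, (if e k = 0 then 1 else t) = (1 + 2 * H * t) ^ n := by
    rw [← Finset.prod_univ_sum (fun _ : Fin n => Finset.Icc (-H : ℤ) H)
      (fun _ e => if e = 0 then 1 else t), Finset.prod_const, Finset.card_univ, Fintype.card_fin,
      sum_Icc_ite_eq_zero]
  rw [← htotal, ← nsmul_eq_mul, ← Finset.sum_const]
  refine (Finset.sum_le_sum fun e he => ?_).trans (Finset.sum_le_sum_of_subset_of_nonneg
    (Finset.filter_subset _ _) fun e _ _ => Finset.prod_nonneg fun k _ => by
      split_ifs <;> positivity)
  have hweight : ∏ k, (if e k = 0 then 1 else t) =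
      t ^ (Finset.univ.filter fun k => e k ≠ 0).card := by
    rw [Finset.prod_ite]
    simp
  rw [hweight, ← Real.rpow_natCast]
  exact Real.rpow_le_rpow_of_exponent_ge ht ht1 (Finset.mem_filter.1 he).2

lemma card_filter_le_mul_count_add (n m : ℕ) (G Q : ℕ → Prop) [DecidablePred G] [DecidablePred Q]
    (h : ∀ k, Q k → ∃ j ≤ m, G (k + j)) :
    ((Finset.range n).filter Q).card ≤ (m + 1) * Nat.count G n + m := by
  set T : Finset ℕ := (Finset.range n).filter G
  have hcover : (Finset.range n).filter Q ⊆ Finset.Ico (n - m) n ∪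
      (Finset.range (m + 1)).biUnion fun j => (Finset.range n).filter fun k => k + j ∈ T := by
    intro k hk
    obtain ⟨hkn, hQ⟩ := Finset.mem_filter.1 hk
    have hkn' := Finset.mem_range.1 hkn
    obtain ⟨j, hj, hG⟩ := h k hQ
    by_cases hlt : k + j < n
    · refine Finset.mem_union_right _ (Finset.mem_biUnion.2 ⟨j, Finset.mem_range.2 (by omega), ?_⟩)
      exact Finset.mem_filter.2 ⟨hkn, Finset.mem_filter.2 ⟨Finset.mem_range.2 hlt, hG⟩⟩
    · exact Finset.mem_union_left _ (Finset.mem_Ico.2 ⟨by omega, hkn'⟩)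
  have hshift : ∀ j ∈ Finset.range (m + 1),
      ((Finset.range n).filter fun k => k + j ∈ T).card ≤ Nat.count G n := fun j _ => by
    rw [Nat.count_eq_card_filter_range]
    exact Finset.card_le_card_of_injOn (fun k => k + j)
      (fun k hk => (Finset.mem_filter.1 hk).2) (fun a _ b _ hab => by simpa using hab)
  have hunion := (Finset.card_le_card hcover).trans (Finset.card_union_le _ _)
  have hbiUnion := Finset.card_biUnion_le_card_mul (Finset.range (m + 1)) _ _ hshift
  rw [Finset.card_range] at hbiUnion
  rw [Nat.card_Ico] at hunion
  omega

end Sparse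

section Defect

variable {m : ℕ} {c : Fin m → ℤ}

/-- The error made at place `k` by an integer sequence `K` in the linear recurrence with
coefficients `c`. -/
def defect (c : Fin m → ℤ) (K : ℕ → ℤ) (k : ℕ) : ℤ :=
  K (k + m) - ∑ j : Fin m, c j * K (k + j)

lemma eq_of_defect_eq {n : ℕ} {K K' : ℕ → ℤ} (hinit : ∀ j < m, K j = K' j)
    (hdefect : ∀ k < n, defect c K k = defect c K' k) : ∀ k < n + m, K k = K' k := by
  intro k
  induction k using Nat.strong_induction_on with
  | _ k ih =>
    intro hk
    rcases lt_or_ge k m with hkm | hkm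
    · exact hinit k hkm
    · obtain ⟨l, rfl⟩ := Nat.exists_eq_add_of_le' hkm
      have hl := hdefect l (by omega)
      have hsum : ∑ j : Fin m, c j * K (l + j) = ∑ j : Fin m, c j * K' (l + j) :=
        Finset.sum_congr rfl fun j _ => by rw [ih (l + j) (by omega) (by omega)]
      rw [defect, defect, hsum] at hl
      omega

variable {x : ℕ → ℝ} (hx : ∀ k, x (k + m) = ∑ j : Fin m, (c j : ℝ) * x (k + j))
include hx

lemma abs_defect_round_le {k : ℕ} {ε : ℝ} (hε : ∀ j ≤ m, distInt (x (k + j)) ≤ ε) :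
    |(defect c (fun k => round (x k)) k : ℝ)| ≤ (1 + ∑ j, |(c j : ℝ)|) * ε := by
  have herr : (defect c (fun k => round (x k)) k : ℝ) = -(x (k + m) - round (x (k + m))) +
      ∑ j : Fin m, (c j : ℝ) * (x (k + j) - round (x (k + j))) := by
    simp only [mul_sub, Finset.sum_sub_distrib, ← hx k, defect]
    push_cast
    ring
  rw [herr, add_mul, one_mul, Finset.sum_mul]
  refine (abs_add_le _ _).trans (add_le_add ?_ ?_)
  · rw [abs_neg]
    exact hε m le_rfl
  · refine (Finset.abs_sum_le_sum_abs _ _).trans (Finset.sum_le_sum fun j _ => ?_)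
    rw [abs_mul]
    exact mul_le_mul_of_nonneg_left (hε j j.2.le) (abs_nonneg _)

lemma exists_le_distInt_of_defect_round_ne_zero {H : ℝ} (hH : 1 + ∑ j, |(c j : ℝ)| ≤ H) {k : ℕ}
    (hk : defect c (fun k => round (x k)) k ≠ 0) : ∃ j ≤ m, 1 / H ≤ distInt (x (k + j)) := by
  have hH0 : 0 < H := lt_of_lt_of_le (by positivity) hH
  obtain ⟨j, hj, hmax⟩ := Finset.exists_max_image (Finset.range (m + 1))
    (fun j => distInt (x (k + j))) ⟨0, by simp⟩
  refine ⟨j, by have := Finset.mem_range.1 hj; omega, ?_⟩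
  have hone : (1 : ℝ) ≤ |(defect c (fun k => round (x k)) k : ℝ)| := by
    exact_mod_cast Int.one_le_abs hk
  rw [div_le_iff₀' hH0]
  calc (1 : ℝ) ≤ (1 + ∑ j, |(c j : ℝ)|) * distInt (x (k + j)) :=
        hone.trans (abs_defect_round_le hx fun i hi => hmax i (Finset.mem_range.2 (by omega)))
    _ ≤ H * distInt (x (k + j)) := mul_le_mul_of_nonneg_right hH (distInt_nonneg _)

lemma defect_round_mem_sparseSequences {H : ℕ} (hH : 1 + ∑ j, |(c j : ℝ)| ≤ H) {n : ℕ} {J : ℝ}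
    (hJ : (farCount (1 / H) x n : ℝ) ≤ J) :
    (fun k : Fin n => defect c (fun k => round (x k)) k) ∈
      sparseSequences n H ((m + 1) * J + m) := by
  refine Finset.mem_filter.2 ⟨Fintype.mem_piFinset.2 fun k => ?_, ?_⟩
  · have hk : |(defect c (fun k => round (x k)) k : ℝ)| ≤ H := by
      have h := abs_defect_round_le hx (k := k) fun j _ => distInt_le_half _
      have hc : 0 ≤ ∑ j, |(c j : ℝ)| := by positivity
      linarith
    rw [Finset.mem_Icc, ← abs_le]
    exact_mod_cast hk
  · have hcount := card_filter_le_mul_count_add n m (fun k => 1 / (H : ℝ) ≤ distInt (x k))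
      (fun k => defect c (fun k => round (x k)) k ≠ 0)
      fun k hk => exists_le_distInt_of_defect_round_ne_zero hx hH hk
    rw [Finset.card_filter, Finset.sum_range, ← Finset.card_filter] at hcount
    calc _ ≤ (m + 1) * (farCount (1 / H) x n : ℝ) + m := by exact_mod_cast hcount
      _ ≤ _ := by gcongr

end Defect

section ErdosKahane

open Matrix

variable {m : ℕ} {c : Fin m → ℤ} {u : ℕ → Fin m → ℝ} {w b : Fin m → ℝ} {C τ : ℝ}

/-- The coordinate on projective space given by the quotient of two linear functionals. -/
def projCoord (w b y : Fin m → ℝ) : ℝ := (y ⬝ᵥ b) / (y ⬝ᵥ w)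

lemma projCoord_smul (w b y : Fin m → ℝ) {ω : ℝ} (hω : ω ≠ 0) :
    projCoord w b (ω • y) = projCoord w b y := by
  rw [projCoord, smul_dotProduct, smul_dotProduct, smul_eq_mul, smul_eq_mul,
    mul_div_mul_left _ _ hω, projCoord]

/-- The exceptional vectors `y` of the Erdős–Kahane argument: among the first `n` pairings
`y ⬝ᵥ u k`, at most `J` are at distance at least `ρ` from the integers. The number `E` bounds the
size of `y`, of `(y ⬝ᵥ w)⁻¹` and of the projective coordinate of `y`. -/
def exceptionalVectors (u : ℕ → Fin m → ℝ) (w b : Fin m → ℝ) (ρ E J : ℝ) (n : ℕ) :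
    Set (Fin m → ℝ) :=
  {y | (∀ i, |y i| ≤ E) ∧ E⁻¹ ≤ |y ⬝ᵥ w| ∧ |projCoord w b y| ≤ E ∧
    (farCount ρ (fun k => y ⬝ᵥ u k) n : ℝ) ≤ J}

lemma dotProduct_recurrence (hu : ∀ k, u (k + m) = ∑ j : Fin m, (c j : ℝ) • u (k + j))
    (y : Fin m → ℝ) (k : ℕ) :
    y ⬝ᵥ u (k + m) = ∑ j : Fin m, (c j : ℝ) * (y ⬝ᵥ u (k + j)) := by
  rw [hu, dotProduct_sum]
  simp only [dotProduct_smul, smul_eq_mul]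

lemma round_dotProduct_mem_piFinset {y : Fin m → ℝ} {E : ℝ} (hy : ∀ i, |y i| ≤ E) {N : ℕ}
    (hN : E * ∑ j : Fin m, ∑ i, |u j i| + 1 ≤ N) :
    (fun j : Fin m => round (y ⬝ᵥ u j)) ∈
      Fintype.piFinset fun _ : Fin m => Finset.Icc (-N : ℤ) N := by
  refine Fintype.mem_piFinset.2 fun j => ?_
  have hdot : |y ⬝ᵥ u j| ≤ E * ∑ j : Fin m, ∑ i, |u j i| := by
    calc |y ⬝ᵥ u j| ≤ ∑ i, E * |u j i| := by
          refine (Finset.abs_sum_le_sum_abs _ _).trans (Finset.sum_le_sum fun i _ => ?_)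
          rw [abs_mul]
          exact mul_le_mul_of_nonneg_right (hy i) (abs_nonneg _)
      _ = E * ∑ i, |u j i| := (Finset.mul_sum _ _ _).symm
      _ ≤ _ := by
          rcases isEmpty_or_nonempty (Fin m) with h | ⟨⟨i⟩⟩
          · exact h.elim j
          refine mul_le_mul_of_nonneg_left ?_ ((abs_nonneg _).trans (hy i))
          exact Finset.single_le_sum (f := fun j : Fin m => ∑ i, |u j i|)
            (fun _ _ => by positivity) (Finset.mem_univ j)
  have hround : |(round (y ⬝ᵥ u j) : ℝ)| ≤ N := by
    have h := abs_sub_round (y ⬝ᵥ u j)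
    rw [abs_le] at h hdot ⊢
    constructor <;> linarith
  rw [Finset.mem_Icc, ← abs_le]
  exact_mod_cast hround

lemma abs_div_sub_div_mul_abs_le {a a' b b' : ℝ} (ha : a ≠ 0) (ha' : a' ≠ 0) :
    |b / a - b' / a'| * |a| ≤ |b - b'| + |b' / a'| * |a - a'| := by
  rw [← abs_mul, ← abs_mul]
  refine (congrArg abs ?_).trans_le (abs_sub _ _)
  field_simp
  ring

lemma abs_projCoord_sub_le_of_round_eq (hw : IsControlledBy u C τ w) (hb : IsControlledBy u C τ b)
    {y y' : Fin m → ℝ} {E : ℝ} (hE : 1 ≤ E) (hyw : E⁻¹ ≤ |y ⬝ᵥ w|) (hyw' : E⁻¹ ≤ |y' ⬝ᵥ w|)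
    (hz : |projCoord w b y'| ≤ E) {n : ℕ}
    (hround : ∀ k < n + m, round (y ⬝ᵥ u k) = round (y' ⬝ᵥ u k)) :
    |projCoord w b y - projCoord w b y'| ≤ 2 * C * τ ^ n * E ^ 2 := by
  have hclose : ∀ j < m, |(y - y') ⬝ᵥ u (n + j)| ≤ 1 := by
    intro j hj
    have h := abs_sub_round (y ⬝ᵥ u (n + j))
    have h' := abs_sub_round (y' ⬝ᵥ u (n + j))
    rw [← hround (n + j) (by omega)] at h'
    rw [sub_dotProduct]
    rw [abs_le] at h h' ⊢
    constructor <;> linarith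
  have hE0 : 0 < E := zero_lt_one.trans_le hE
  have hyw0 : 0 < |y ⬝ᵥ w| := (inv_pos.2 hE0).trans_le hyw
  have hyw0' : 0 < |y' ⬝ᵥ w| := (inv_pos.2 hE0).trans_le hyw'
  have hdw := hw (y - y') n 1 hclose
  have hdb := hb (y - y') n 1 hclose
  rw [sub_dotProduct, mul_one] at hdw hdb
  have hCτ : 0 ≤ C * τ ^ n := (abs_nonneg _).trans hdw
  have hmul : |projCoord w b y - projCoord w b y'| * E⁻¹ ≤ 2 * C * τ ^ n * E := by
    calc _ ≤ |projCoord w b y - projCoord w b y'| * |y ⬝ᵥ w| := by gcongr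
      _ ≤ |y ⬝ᵥ b - y' ⬝ᵥ b| + |projCoord w b y'| * |y ⬝ᵥ w - y' ⬝ᵥ w| :=
          abs_div_sub_div_mul_abs_le (abs_pos.1 hyw0) (abs_pos.1 hyw0')
      _ ≤ C * τ ^ n + E * (C * τ ^ n) := by gcongr
      _ ≤ 2 * C * τ ^ n * E := by nlinarith
  rw [← div_eq_mul_inv, div_le_iff₀ hE0] at hmul
  exact hmul.trans_eq (by ring)

/-- Counts the codes formed by the first `m` rounded pairings and the defects of the sequence of
rounded pairings: the code determines `n + m` rounded pairings, hence almost the projective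
coordinate, and few defects are nonzero if few pairings are far from the integers. -/
lemma volume_image_exceptionalVectors_le_card_mul
    (hu : ∀ k, u (k + m) = ∑ j : Fin m, (c j : ℝ) • u (k + j))
    (hw : IsControlledBy u C τ w) (hb : IsControlledBy u C τ b)
    {H : ℕ} (hH : (1 + ∑ j, |(c j : ℝ)|) ≤ H) {E : ℝ} (hE : 1 ≤ E) {N : ℕ}
    (hN : E * ∑ j : Fin m, ∑ i, |u j i| + 1 ≤ N) (J : ℝ) (n : ℕ) :
    volume (projCoord w b '' exceptionalVectors u w b (1 / H) E J n) ≤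
      (((2 * N + 1) ^ m * (sparseSequences n H ((m + 1) * J + m)).card : ℕ) : ENNReal) *
        ENNReal.ofReal (2 * C * τ ^ n * E ^ 2) := by
  have hcard : (Fintype.piFinset fun _ : Fin m => Finset.Icc (-N : ℤ) N).card =
      (2 * N + 1) ^ m := by
    rw [Fintype.card_piFinset_const, Int.card_Icc]
    congr 1
    omega
  rw [← hcard, ← Finset.card_product]
  refine volume_image_le_card_mul_ofReal (exceptionalVectors u w b (1 / H) E J n)
    (projCoord w b) (fun y => (fun j : Fin m => round (y ⬝ᵥ u j),
      fun k : Fin n => defect c (fun k => round (y ⬝ᵥ u k)) k)) _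
    (fun y ⟨hyE, _, _, hyJ⟩ => Finset.mem_product.2 ⟨round_dotProduct_mem_piFinset hyE hN,
      defect_round_mem_sparseSequences (dotProduct_recurrence hu y) hH hyJ⟩)
    fun y ⟨_, hyw, _, _⟩ y' ⟨_, hyw', hz, _⟩ hcode => ?_
  obtain ⟨hinit, hdefect⟩ := Prod.mk.inj hcode
  exact abs_projCoord_sub_le_of_round_eq hw hb hE hyw hyw' hz <|
    eq_of_defect_eq (fun j hj => congrFun hinit ⟨j, hj⟩) fun k hk => congrFun hdefect ⟨k, hk⟩

lemma exists_volume_image_exceptionalVectors_le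
    (hu : ∀ k, u (k + m) = ∑ j : Fin m, (c j : ℝ) • u (k + j)) (hτ : 0 < τ)
    (hw : IsControlledBy u C τ w) (hb : IsControlledBy u C τ b)
    {H : ℕ} (hH : (1 + ∑ j, |(c j : ℝ)|) ≤ H) :
    ∃ C' : ℝ, 0 < C' ∧ ∀ (E J t : ℝ), 1 ≤ E → 0 < t → t ≤ 1 → ∀ n : ℕ,
      volume (projCoord w b '' exceptionalVectors u w b (1 / H) E J n) ≤
        ENNReal.ofReal ((C' * E) ^ m * (t ^ (-((m + 1) * J + m)) * (1 + 2 * H * t) ^ n) *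
          (C' * τ ^ n * E ^ 2)) := by
  set U : ℝ := ∑ j : Fin m, ∑ i, |u j i|
  have hU0 : 0 ≤ U := by positivity
  refine ⟨max (2 * U + 5) (2 * C), lt_max_of_lt_left (by positivity),
    fun E J t hE ht ht1 n => ?_⟩
  set C' := max (2 * U + 5) (2 * C)
  have hN : E * U + 1 ≤ (⌈E * U⌉₊ + 1 : ℕ) := by
    push_cast
    linarith [Nat.le_ceil (E * U)]
  have hNC' : (2 * (⌈E * U⌉₊ + 1 : ℕ) + 1 : ℝ) ≤ C' * E := by
    have hceil : (⌈E * U⌉₊ : ℝ) < E * U + 1 := Nat.ceil_lt_add_one (by positivity)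
    have hC' : (2 * U + 5) * E ≤ C' * E := by gcongr; exact le_max_left _ _
    push_cast
    nlinarith
  have hsparse : ((sparseSequences n H ((m + 1) * J + m)).card : ℝ) ≤
      t ^ (-((m + 1) * J + m)) * (1 + 2 * H * t) ^ n := by
    rw [Real.rpow_neg ht.le, inv_mul_eq_div, le_div_iff₀ (Real.rpow_pos_of_pos ht _)]
    exact card_sparseSequences_mul_rpow_le n H _ ht ht1
  refine (volume_image_exceptionalVectors_le_card_mul hu hw hb hH hE hN J n).trans ?_
  have hC : 2 * C * τ ^ n * E ^ 2 ≤ C' * τ ^ n * E ^ 2 := by gcongr; exact le_max_right _ _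
  rw [← ENNReal.ofReal_natCast]
  refine (mul_le_mul_right (ENNReal.ofReal_le_ofReal hC) _).trans ?_
  rw [← ENNReal.ofReal_mul (by positivity)]
  refine ENNReal.ofReal_le_ofReal ?_
  push_cast at hNC' ⊢
  gcongr

lemma exists_rpow_neg_mul_pow_le {H a : ℝ} (hH : 0 < H) (ha : 0 < a) (m : ℕ) :
    ∃ t η : ℝ, 0 < t ∧ t ≤ 1 ∧ 0 < η ∧ ∀ n : ℕ,
      t ^ (-((m + 1) * (η * n) + m)) * (1 + 2 * H * t) ^ n ≤
        t ^ (-(m : ℝ)) * Real.exp (2 * a) ^ n := by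
  set t : ℝ := min (1 / 2) (a / (2 * H))
  have ht0 : 0 < t := lt_min (by norm_num) (by positivity)
  have ht1 : t < 1 := (min_le_left _ _).trans_lt (by norm_num)
  have hlogt : Real.log t < 0 := Real.log_neg ht0 ht1
  have hHt : 1 + 2 * H * t ≤ Real.exp a := by
    have : 2 * H * t ≤ a := by
      calc 2 * H * t ≤ 2 * H * (a / (2 * H)) := by gcongr; exact min_le_right _ _
        _ = a := by field_simp
    linarith [Real.add_one_le_exp a]
  refine ⟨t, a / ((m + 1) * -Real.log t), ht0, ht1.le,
    div_pos ha (mul_pos (by positivity) (by linarith)), fun n => ?_⟩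
  set η : ℝ := a / ((m + 1) * -Real.log t) with hη
  have hrpow : t ^ (-((m + 1) * (η * n) + m)) = t ^ (-(m : ℝ)) * Real.exp a ^ n := by
    rw [neg_add, Real.rpow_add ht0, mul_comm, Real.rpow_def_of_pos ht0 (-((m + 1) * (η * n))),
      ← Real.exp_nat_mul, hη]
    congr 2
    have := hlogt.ne
    field_simp
  calc _ ≤ t ^ (-(m : ℝ)) * Real.exp a ^ n * Real.exp a ^ n := by rw [hrpow]; gcongr
    _ = t ^ (-(m : ℝ)) * Real.exp (2 * a) ^ n := by
        rw [mul_assoc, ← mul_pow, ← Real.exp_add, two_mul]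

lemma exists_geometric_bound {C H τ : ℝ} (hC : 0 < C) (hH : 0 < H) (hτ : 0 < τ) (hτ1 : τ < 1)
    (m : ℕ) :
    ∃ t κ η A q : ℝ, 0 < t ∧ t ≤ 1 ∧ 0 < κ ∧ 0 < η ∧ 0 ≤ A ∧ 0 ≤ q ∧ q < 1 ∧ ∀ n : ℕ,
      (C * Real.exp (κ * n)) ^ m * (t ^ (-((m + 1) * (η * n) + m)) * (1 + 2 * H * t) ^ n) *
        (C * τ ^ n * Real.exp (κ * n) ^ 2) ≤ A * q ^ n := by
  obtain ⟨a, rfl⟩ : ∃ a, τ = Real.exp (-(4 * a)) :=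
    ⟨-Real.log τ / 4, by
      rw [mul_div_cancel₀ _ (four_ne_zero (α := ℝ)), neg_neg, Real.exp_log hτ]⟩
  have ha : 0 < a := by linarith [Real.exp_lt_one_iff.1 hτ1]
  obtain ⟨t, η, ht0, ht1, hη, hcount⟩ := exists_rpow_neg_mul_pow_le hH ha m
  refine ⟨t, a / (m + 2), η, C ^ m * t ^ (-(m : ℝ)) * C, Real.exp (-a), ht0, ht1,
    by positivity, hη, by positivity, by positivity, Real.exp_lt_one_iff.2 (by linarith),
    fun n => ?_⟩
  set E := Real.exp (a / (m + 2) * n) with hE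
  have hEpow : E ^ m * E ^ 2 = Real.exp a ^ n := by
    rw [← pow_add, hE, ← Real.exp_nat_mul, ← Real.exp_nat_mul]
    congr 1
    push_cast
    field_simp
  calc _ ≤ (C * E) ^ m * (t ^ (-(m : ℝ)) * Real.exp (2 * a) ^ n) *
          (C * Real.exp (-(4 * a)) ^ n * E ^ 2) :=
        mul_le_mul_of_nonneg_right (mul_le_mul_of_nonneg_left (hcount n) (by positivity))
          (by positivity)
    _ = C ^ m * t ^ (-(m : ℝ)) * C *
          (Real.exp (2 * a) ^ n * (E ^ m * E ^ 2) * Real.exp (-(4 * a)) ^ n) := by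
        rw [mul_pow]
        ring
    _ = C ^ m * t ^ (-(m : ℝ)) * C * Real.exp (-a) ^ n := by
        rw [hEpow, ← mul_pow, ← mul_pow, ← Real.exp_add, ← Real.exp_add]
        congr 3
        ring

lemma smul_mem_exceptionalVectors {s : Fin m → ℝ} {ω ρ E J : ℝ} {n : ℕ} (hE : 1 ≤ E)
    (hs : ‖s‖ ≤ E) (hsw : s ⬝ᵥ w ≠ 0) (hsw' : |s ⬝ᵥ w|⁻¹ ≤ E) (hz : |projCoord w b s| ≤ E)
    (hω : E⁻¹ ≤ |ω|) (hω' : |ω| ≤ E) (hJ : farCount ρ (fun k => ω * (s ⬝ᵥ u k)) n ≤ J) :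
    ω • s ∈ exceptionalVectors u w b ρ (E * E) J n := by
  have hE0 : 0 < E := zero_lt_one.trans_le hE
  have hω0 : ω ≠ 0 := abs_pos.1 ((inv_pos.2 hE0).trans_le hω)
  refine ⟨fun i => ?_, ?_, ?_, ?_⟩
  · rw [Pi.smul_apply, smul_eq_mul, abs_mul]
    exact mul_le_mul hω' ((norm_le_pi_norm s i).trans hs) (abs_nonneg _) hE0.le
  · rw [smul_dotProduct, smul_eq_mul, abs_mul, mul_inv]
    exact mul_le_mul hω (inv_le_of_inv_le₀ (abs_pos.2 hsw) hsw') (by positivity) (abs_nonneg _)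
  · rw [projCoord_smul w b s hω0]
    exact hz.trans (le_mul_of_one_le_left hE0.le hE)
  · simpa only [smul_dotProduct, smul_eq_mul] using hJ

lemma tsum_ne_top_of_le_geometric {f : ℕ → ENNReal} {A q : ℝ} (hA : 0 ≤ A) (hq0 : 0 ≤ q)
    (hq1 : q < 1) (hf : ∀ n, f n ≤ ENNReal.ofReal (A * q ^ n)) : ∑' n, f n ≠ ⊤ := by
  refine ne_top_of_le_ne_top ?_ (ENNReal.tsum_le_tsum hf)
  rw [← ENNReal.ofReal_tsum_of_nonneg (fun n => by positivity)
    ((summable_geometric_of_lt_one hq0 hq1).mul_left A)]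
  exact ENNReal.ofReal_ne_top

lemma exists_erdos_kahane (hu : ∀ k, u (k + m) = ∑ j : Fin m, (c j : ℝ) • u (k + j))
    (hτ : 0 < τ) (hτ1 : τ < 1) (hw : IsControlledBy u C τ w)
    (hb : IsControlledBy u C τ b) :
    ∃ (ρ κ η : ℝ) (N : Set ℝ), 0 < ρ ∧ ρ ≤ 1 ∧ 0 < κ ∧ 0 < η ∧ volume N = 0 ∧
      ∀ s : Fin m → ℝ, s ⬝ᵥ w ≠ 0 → projCoord w b s ∉ N → ∃ n₀ : ℕ, ∀ n ≥ n₀, ∀ ω : ℝ,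
        Real.exp (-(κ * n)) ≤ |ω| → |ω| ≤ Real.exp (κ * n) →
          η * n ≤ farCount ρ (fun k => ω * (s ⬝ᵥ u k)) n := by
  obtain ⟨H, hH⟩ := exists_nat_ge (1 + ∑ j, |(c j : ℝ)|)
  have hH1 : (1 : ℝ) ≤ H := by
    have : 0 ≤ ∑ j, |(c j : ℝ)| := by positivity
    linarith
  obtain ⟨C', hC', hvol⟩ := exists_volume_image_exceptionalVectors_le hu hτ hw hb hH
  obtain ⟨t, κ, η, A, q, ht0, ht1, hκ, hη, hA, hq0, hq1, hAq⟩ :=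
    exists_geometric_bound hC' (zero_lt_one.trans_le hH1) hτ hτ1 m
  set P : ℕ → Set ℝ := fun n => projCoord w b ''
    exceptionalVectors u w b (1 / H) (Real.exp (κ * n)) (η * n) n
  have hsum : ∑' n, volume (P n) ≠ ⊤ := tsum_ne_top_of_le_geometric hA hq0 hq1 fun n =>
    (hvol _ _ t (Real.one_le_exp (by positivity)) ht0 ht1 n).trans
      (ENNReal.ofReal_le_ofReal (hAq n))
  refine ⟨1 / H, κ / 2, η, Filter.limsup P Filter.atTop, by positivity,
    (div_le_one (by positivity)).2 hH1, by positivity, hη, measure_limsup_atTop_eq_zero hsum,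
    fun s hsw hsN => ?_⟩
  rw [Filter.mem_limsup_iff_frequently_mem, Filter.not_frequently] at hsN
  have hexp : Filter.Tendsto (fun n : ℕ => Real.exp (κ / 2 * n)) Filter.atTop Filter.atTop :=
    Real.tendsto_exp_atTop.comp (tendsto_natCast_atTop_atTop.const_mul_atTop (by positivity))
  obtain ⟨n₀, hn₀⟩ := Filter.eventually_atTop.1 <| hsN.and <|
    (hexp.eventually_ge_atTop ‖s‖).and <| (hexp.eventually_ge_atTop |s ⬝ᵥ w|⁻¹).and
      (hexp.eventually_ge_atTop |projCoord w b s|)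
  refine ⟨n₀, fun n hn ω hω hω' => ?_⟩
  obtain ⟨hnP, hns, hnw, hnz⟩ := hn₀ n hn
  by_contra! hlt
  rw [Real.exp_neg] at hω
  have hmem := smul_mem_exceptionalVectors (Real.one_le_exp (by positivity)) hns hsw hnw hnz hω
    hω' hlt.le
  rw [← Real.exp_add, ← add_mul, add_halves] at hmem
  have hω0 : ω ≠ 0 := abs_pos.1 ((inv_pos.2 (Real.exp_pos _)).trans_le hω)
  exact hnP ⟨ω • s, hmem, projCoord_smul w b s hω0⟩

end ErdosKahane

/-! ### Lebesgue measure on the simplex -/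

section Simplex

open Matrix

lemma exists_dotProduct_eq_zero_of_notMem_span {m : ℕ} {w b : Fin m → ℝ}
    (hb : b ∉ Submodule.span ℝ {w}) : ∃ u : Fin m → ℝ, u ⬝ᵥ w = 0 ∧ u ⬝ᵥ b ≠ 0 := by
  obtain ⟨f, hfb, hfw⟩ := Submodule.exists_le_ker_of_notMem hb
  obtain ⟨u, rfl⟩ := (dotProductEquiv ℝ (Fin m)).surjective f
  exact ⟨u, hfw (Submodule.mem_span_singleton_self w), hfb⟩

lemma volume_setOf_add_mul_mem_eq_zero {N : Set ℝ} (hN : volume N = 0) (p : ℝ) {q : ℝ}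
    (hq : q ≠ 0) : volume {t : ℝ | p + t * q ∈ N} = 0 := by
  have hcomp : {t : ℝ | p + t * q ∈ N} = (fun t => t * q) ⁻¹' ((fun t => p + t) ⁻¹' N) := rfl
  rw [hcomp, Real.volume_preimage_mul_right hq, measure_preimage_add, hN, mul_zero]

/-- On a line on which `y ⬝ᵥ w` is constant, the projective coordinate is an affine function. -/
lemma volume_setOf_projCoord_mem_eq_zero {m : ℕ} {w b : Fin m → ℝ}
    (hb : b ∉ Submodule.span ℝ {w}) {N : Set ℝ} (hN : volume N = 0) :
    volume {y : Fin m → ℝ | y ⬝ᵥ w ≠ 0 ∧ projCoord w b y ∈ N} = 0 := by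
  set N' := toMeasurable volume N
  have hN' : volume N' = 0 := (measure_toMeasurable N).trans hN
  suffices ∀ᵐ y : Fin m → ℝ, y ∈ {y | y ⬝ᵥ w ≠ 0 ∧ projCoord w b y ∈ N'}ᶜ from
    measure_mono_null (t := {y | y ⬝ᵥ w ≠ 0 ∧ projCoord w b y ∈ N'})
      (fun y hy => ⟨hy.1, subset_toMeasurable _ _ hy.2⟩) (measure_eq_zero_iff_ae_notMem.2 this)
  have hmeas : MeasurableSet {y : Fin m → ℝ | y ⬝ᵥ w ≠ 0 ∧ projCoord w b y ∈ N'}ᶜ := by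
    have hdot (e : Fin m → ℝ) : Measurable fun y : Fin m → ℝ => y ⬝ᵥ e :=
      Finset.measurable_sum _ fun i _ => (measurable_pi_apply i).mul_const _
    exact ((hdot w (measurableSet_singleton 0).compl).inter
      (((hdot b).div (hdot w)) (measurableSet_toMeasurable _ _))).compl
  obtain ⟨u, huw, hub⟩ := exists_dotProduct_eq_zero_of_notMem_span hb
  refine ae_mem_of_ae_add_linearMap_mem (LinearMap.toSpanSingleton ℝ _ u) volume volume hmeas
    fun y => ?_
  have hline (t : ℝ) : (y + t • u) ⬝ᵥ w = y ⬝ᵥ w := by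
    rw [add_dotProduct, smul_dotProduct, huw, smul_zero, add_zero]
  by_cases hyw : y ⬝ᵥ w = 0
  · exact Filter.Eventually.of_forall fun t ht => ht.1 ((hline t).trans hyw)
  · have hnull := volume_setOf_add_mul_mem_eq_zero hN' (projCoord w b y) (div_ne_zero hub hyw)
    filter_upwards [measure_eq_zero_iff_ae_notMem.1 hnull] with t ht htN
    refine ht ?_
    convert htN.2 using 1
    rw [LinearMap.toSpanSingleton_apply, projCoord, projCoord, hline, add_dotProduct,
      smul_dotProduct, add_div, smul_eq_mul, mul_div_assoc]

/-- The coordinate system on `ℝ ^ (k + 1)` formed by the sum of all coordinates and the last `k`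
coordinates. Its slice at first coordinate `1` parametrizes the hyperplane of the simplex. -/
def sumCoordEquiv (k : ℕ) : (ℝ × (Fin k → ℝ)) ≃ₗ[ℝ] (Fin (k + 1) → ℝ) where
  toFun y := Fin.cons (y.1 - ∑ i, y.2 i) y.2
  invFun x := (∑ i, x i, fun i => x i.succ)
  map_add' y z := by
    ext i
    refine Fin.cases ?_ (fun i => ?_) i
    · simp only [Prod.fst_add, Prod.snd_add, Pi.add_apply, Finset.sum_add_distrib, Fin.cons_zero]
      ring
    · simp
  map_smul' c y := by
    ext i
    refine Fin.cases ?_ (fun i => ?_) i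
    · simp [← Finset.mul_sum, mul_sub]
    · simp
  left_inv y := by simp [Fin.sum_univ_succ]
  right_inv x := by
    ext i
    refine Fin.cases ?_ (fun i => ?_) i
    · simp [Fin.sum_univ_succ]
    · simp

lemma volume_slice_eq_zero_of_cone {k : ℕ} {E : Set (Fin (k + 1) → ℝ)} (hE : volume E = 0)
    (hcone : ∀ c : ℝ, c ≠ 0 → ∀ y ∈ E, c • y ∈ E) :
    volume {y : Fin k → ℝ | sumCoordEquiv k (1, y) ∈ E} = 0 := by
  have hprod : ∀ᵐ y : ℝ × (Fin k → ℝ), sumCoordEquiv k y ∉ E := by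
    have hHaar : (volume : Measure (ℝ × (Fin k → ℝ))).IsAddHaarMeasure :=
      inferInstanceAs ((volume : Measure ℝ).prod (volume : Measure (Fin k → ℝ))).IsAddHaarMeasure
    have hmap := (sumCoordEquiv k).toContinuousLinearEquiv.isAddHaarMeasure_map volume
    have hnull := Measure.absolutelyContinuous_isAddHaarMeasure (Measure.map
      (sumCoordEquiv k).toContinuousLinearEquiv volume) volume hE
    exact ae_of_ae_map (sumCoordEquiv k).toContinuousLinearEquiv.continuous.aemeasurable
      (measure_eq_zero_iff_ae_notMem.1 hnull)
  obtain ⟨σ, hσ, hσ0⟩ : ∃ σ : ℝ, (∀ᵐ y : Fin k → ℝ, sumCoordEquiv k (σ, y) ∉ E) ∧ σ ≠ 0 :=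
    ((Measure.ae_ae_of_ae_prod hprod).and (Measure.ae_ne volume 0)).exists
  have hscale : {y : Fin k → ℝ | sumCoordEquiv k (1, y) ∈ E} ⊆
      (σ • ·) ⁻¹' {y | sumCoordEquiv k (σ, y) ∈ E} := by
    intro y hy
    have h := hcone σ hσ0 _ hy
    rwa [← map_smul, Prod.smul_mk, smul_eq_mul, mul_one] at h
  have hnull : volume {y : Fin k → ℝ | sumCoordEquiv k (σ, y) ∈ E} = 0 :=
    measure_eq_zero_iff_ae_notMem.2 hσ
  refine measure_mono_null hscale ?_
  rw [Measure.addHaar_preimage_smul _ hσ0, hnull, mul_zero]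

lemma hausdorffMeasure_inter_eq_zero_of_cone {k : ℕ} {E : Set (Fin (k + 1) → ℝ)}
    (hE : volume E = 0) (hcone : ∀ c : ℝ, c ≠ 0 → ∀ y ∈ E, c • y ∈ E) :
    Measure.hausdorffMeasure (k : ℝ) (E ∩ {s | ∑ i, s i = 1}) = 0 := by
  have hlip := (sumCoordEquiv k).toContinuousLinearEquiv.lipschitz.comp
    (LipschitzWith.prodMk_left (1 : ℝ))
  have hsub : E ∩ {s | ∑ i, s i = 1} ⊆
      (sumCoordEquiv k).toContinuousLinearEquiv ∘ Prod.mk 1 ''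
        {y : Fin k → ℝ | sumCoordEquiv k (1, y) ∈ E} := by
    rintro s ⟨hsE, hs⟩
    have hsymm : (sumCoordEquiv k).symm s = (1, fun i => s i.succ) := Prod.ext hs rfl
    have happly := (LinearEquiv.symm_apply_eq _).1 hsymm
    exact ⟨fun i => s i.succ, happly ▸ hsE, happly.symm⟩
  refine measure_mono_null hsub (le_antisymm ?_ bot_le)
  refine (hlip.hausdorffMeasure_image_le k.cast_nonneg _).trans ?_
  have hvol := hausdorffMeasure_pi_real (ι := Fin k)
  rw [Fintype.card_fin] at hvol
  rw [hvol, volume_slice_eq_zero_of_cone hE hcone, mul_zero]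

lemma measurableSet_openSimplex (m : ℕ) : MeasurableSet (openSimplex m) := by
  have hinter : openSimplex m = (⋂ j, {s | 0 < s j}) ∩ {s | ∑ j, s j = 1} := by
    ext s
    simp [openSimplex]
  rw [hinter]
  exact (MeasurableSet.iInter fun j =>
    measurableSet_lt measurable_const (measurable_pi_apply j)).inter
      (measurableSet_eq_fun (Finset.measurable_sum _ fun i _ => measurable_pi_apply i)
        measurable_const)

lemma ae_simplexMeasure_mem_openSimplex (m : ℕ) : ∀ᵐ s ∂(simplexMeasure m), s ∈ openSimplex m :=
  ae_restrict_mem (measurableSet_openSimplex m)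

lemma ae_simplexMeasure_projCoord_notMem {m : ℕ} [NeZero m] {w b : Fin m → ℝ}
    (hb : b ∉ Submodule.span ℝ {w}) {N : Set ℝ} (hN : volume N = 0) :
    ∀ᵐ s ∂(simplexMeasure m), s ⬝ᵥ w ≠ 0 → projCoord w b s ∉ N := by
  obtain ⟨k, rfl⟩ := Nat.exists_eq_succ_of_ne_zero (NeZero.ne m)
  have hnull := hausdorffMeasure_inter_eq_zero_of_cone
    (volume_setOf_projCoord_mem_eq_zero hb hN) fun c hc y ⟨hyw, hyN⟩ =>
      ⟨by rw [smul_dotProduct]; exact smul_ne_zero hc hyw, by rwa [projCoord_smul w b y hc]⟩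
  have hdim : ((k.succ : ℕ) : ℝ) - 1 = k := by push_cast; ring
  rw [← hdim] at hnull
  rw [simplexMeasure]
  filter_upwards [ae_restrict_of_ae (measure_eq_zero_iff_ae_notMem.1 hnull),
    ae_restrict_mem (measurableSet_openSimplex (k + 1))] with s hs hsimplex hsw hsN
  exact hs ⟨⟨hsw, hsN⟩, hsimplex.2⟩

end Simplex

/-! ### Flow lines -/

section Roof

variable {m : ℕ} {s : Fin m → ℝ}

lemma le_one_of_mem_openSimplex (hs : s ∈ openSimplex m) (a : Fin m) : s a ≤ 1 :=
  hs.2 ▸ Finset.single_le_sum (fun b _ => (hs.1 b).le) (Finset.mem_univ a)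

lemma roofSum_zero (x : ℤ → Fin m) : roofSum s x 0 = 0 := by simp [roofSum]

lemma roofSum_add_one (x : ℤ → Fin m) (n : ℤ) :
    roofSum s x (n + 1) = roofSum s x n + s (x n) := by
  rcases lt_or_ge n 0 with hn | hn
  · have hins : Finset.Ico n 0 = insert n (Finset.Ico (n + 1) 0) := by ext i; simp; omega
    rw [roofSum, roofSum, Finset.Ico_eq_empty (b := n) (by omega),
      Finset.Ico_eq_empty (b := n + 1) (by omega), hins, Finset.sum_insert (by simp)]
    ring
  · have hins : Finset.Ico 0 (n + 1) = insert n (Finset.Ico 0 n) := by ext i; simp; omega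
    rw [roofSum, roofSum, Finset.Ico_eq_empty (a := n) (by omega),
      Finset.Ico_eq_empty (a := n + 1) (by omega), hins, Finset.sum_insert (by simp)]
    ring

lemma strictMono_roofSum (hs : ∀ j, 0 < s j) (x : ℤ → Fin m) : StrictMono (roofSum s x) :=
  strictMono_int_of_lt_succ fun n => by
    rw [roofSum_add_one]
    exact lt_add_of_pos_right _ (hs _)

lemma exists_mul_le_roofSum (hs : ∀ j, 0 < s j) (x : ℤ → Fin m) :
    ∃ δ > 0, ∀ n : ℕ, δ * n ≤ roofSum s x n ∧ roofSum s x (-n) ≤ -(δ * n) := by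
  obtain ⟨a, -, ha⟩ := Finset.exists_min_image Finset.univ s ⟨x 0, Finset.mem_univ _⟩
  refine ⟨s a, hs a, fun n => ?_⟩
  induction n with
  | zero => simp [roofSum_zero]
  | succ n ih =>
    have hpos := roofSum_add_one (s := s) x n
    have hneg := roofSum_add_one (s := s) x (-(n + 1 : ℕ))
    rw [show -((n + 1 : ℕ) : ℤ) + 1 = -n by push_cast; ring] at hneg
    have hx := ha (x n) (Finset.mem_univ _)
    have hx' := ha (x (-(n + 1 : ℕ))) (Finset.mem_univ _)
    push_cast at *
    constructor <;> linarith [ih.1, ih.2]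

lemma tileIndex_spec (hs : ∀ j, 0 < s j) (x : ℤ → Fin m) (u : ℝ) :
    roofSum s x (tileIndex s x u) ≤ u ∧ u < roofSum s x (tileIndex s x u + 1) := by
  obtain ⟨δ, hδ, hbound⟩ := exists_mul_le_roofSum hs x
  obtain ⟨n, hn⟩ := exists_nat_gt (|u| / δ)
  rw [div_lt_iff₀ hδ, mul_comm] at hn
  have hne : {n : ℤ | roofSum s x n ≤ u}.Nonempty :=
    ⟨-n, (hbound n).2.trans (by linarith [neg_abs_le u])⟩
  have hbdd : BddAbove {n : ℤ | roofSum s x n ≤ u} := by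
    refine ⟨n, fun k (hk : roofSum s x k ≤ u) => ?_⟩
    refine ((strictMono_roofSum hs x).lt_iff_lt.1 ?_).le
    linarith [(hbound n).1, le_abs_self u]
  refine ⟨Int.csSup_mem hne hbdd, not_le.1 fun hle => ?_⟩
  have : tileIndex s x u + 1 ≤ tileIndex s x u := le_csSup hbdd hle
  omega

lemma tileIndex_eq (hs : ∀ j, 0 < s j) (x : ℤ → Fin m) {u : ℝ} {n : ℤ}
    (hn : roofSum s x n ≤ u) (hn' : u < roofSum s x (n + 1)) : tileIndex s x u = n := by
  obtain ⟨hle, hlt⟩ := tileIndex_spec hs x u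
  have h := (strictMono_roofSum hs x).lt_iff_lt.1 (hn.trans_lt hlt)
  have h' := (strictMono_roofSum hs x).lt_iff_lt.1 (hle.trans_lt hn')
  omega

/-- The function `ψ` read along the flow line through `(x, 0)`. -/
def flowLine (s : Fin m → ℝ) (ψ : Fin m → ℝ → ℂ) (x : ℤ → Fin m) (u : ℝ) : ℂ :=
  ψ (x (tileIndex s x u)) (u - roofSum s x (tileIndex s x u))

lemma cylFun_suspensionFlow (ψ : Fin m → ℝ → ℂ) (τ : ℝ) (y : (ℤ → Fin m) × ℝ) :
    cylFun ψ (suspensionFlow s τ y) = flowLine s ψ y.1 (y.2 + τ) := by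
  simp [cylFun, suspensionFlow, flowLine]

lemma flowLine_eq (hs : ∀ j, 0 < s j) (ψ : Fin m → ℝ → ℂ) (x : ℤ → Fin m) {u : ℝ} {n : ℤ}
    (hn : roofSum s x n ≤ u) (hn' : u < roofSum s x (n + 1)) :
    flowLine s ψ x u = ψ (x n) (u - roofSum s x n) := by
  rw [flowLine, tileIndex_eq hs x hn hn']

lemma measurable_roofSum (s : Fin m → ℝ) (n : ℤ) :
    Measurable fun x : ℤ → Fin m => roofSum s x n := by
  have h (i : ℤ) : Measurable fun x : ℤ → Fin m => s (x i) :=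
    (measurable_of_countable s).comp (measurable_pi_apply i)
  exact (Finset.measurable_sum _ fun i _ => h i).sub (Finset.measurable_sum _ fun i _ => h i)

lemma measurable_tileIndex (hs : ∀ j, 0 < s j) :
    Measurable fun y : (ℤ → Fin m) × ℝ => tileIndex s y.1 y.2 := by
  refine measurable_to_countable' fun n => ?_
  have hfiber : (fun y : (ℤ → Fin m) × ℝ => tileIndex s y.1 y.2) ⁻¹' {n} =
      {y | roofSum s y.1 n ≤ y.2} ∩ {y | y.2 < roofSum s y.1 (n + 1)} :=
    Set.ext fun y => ⟨by rintro rfl; exact tileIndex_spec hs y.1 y.2,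
      fun hy => tileIndex_eq hs y.1 hy.1 hy.2⟩
  rw [hfiber]
  exact (measurableSet_le ((measurable_roofSum s n).comp measurable_fst) measurable_snd).inter
    (measurableSet_lt measurable_snd ((measurable_roofSum s (n + 1)).comp measurable_fst))

lemma measurable_flowLine (hs : ∀ j, 0 < s j) {ψ : Fin m → ℝ → ℂ} (hψ : ∀ a, Measurable (ψ a)) :
    Measurable fun y : (ℤ → Fin m) × ℝ => flowLine s ψ y.1 y.2 := by
  have hψ' : Measurable fun z : Fin m × ℝ => ψ z.1 z.2 := measurable_from_prod_countable_right hψ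
  have htile : Measurable fun z : ℤ × ((ℤ → Fin m) × ℝ) =>
      ψ (z.2.1 z.1) (z.2.2 - roofSum s z.2.1 z.1) :=
    measurable_from_prod_countable_right fun n =>
      hψ'.comp (((measurable_pi_apply n).comp measurable_fst).prodMk
        (measurable_snd.sub ((measurable_roofSum s n).comp measurable_fst)))
  exact htile.comp ((measurable_tileIndex hs).prodMk measurable_id)

/-- The block of `n` letters of the two-sided sequence `x` that starts at position `p`. -/
def block (x : ℤ → Fin m) (p : ℤ) (n : ℕ) : List (Fin m) := List.ofFn fun i : Fin n => x (p + i)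

lemma block_succ (x : ℤ → Fin m) (p : ℤ) (n : ℕ) :
    block x p (n + 1) = x p :: block x (p + 1) n := by
  simp [block, List.ofFn_succ, add_assoc, add_comm (1 : ℤ)]

lemma block_add (x : ℤ → Fin m) (p : ℤ) (k n : ℕ) :
    block x p (k + n) = block x p k ++ block x (p + k) n := by
  simp [block, List.ofFn_add, add_assoc]

lemma exists_block_isInfix {ζ : Substitution m} {x : ℤ → Fin m} (hx : x ∈ ζ.space) (p : ℤ) (n : ℕ) :
    ∃ k a, block x p n <:+: ζ.iter k a := by
  set N : ℕ := p.natAbs + n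
  obtain ⟨k, a, hN⟩ := hx N
  refine ⟨k, a, List.IsInfix.trans ?_ hN⟩
  have hcentral : centralBlock x N = block x (-N) (2 * N + 1) := by
    simp only [centralBlock, block, neg_add_eq_sub]
  obtain ⟨i, hi⟩ : ∃ i : ℕ, p = -N + i := ⟨(p + N).toNat, by omega⟩
  obtain ⟨j, hj⟩ : ∃ j : ℕ, 2 * N + 1 = i + (n + j) := ⟨2 * N + 1 - i - n, by omega⟩
  rw [hcentral, hj, block_add, block_add, ← hi, ← List.append_assoc]
  exact List.infix_append _ _ _

lemma roofWord_block (x : ℤ → Fin m) (p : ℤ) (n : ℕ) :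
    roofWord s (block x p n) = roofSum s x (p + n) - roofSum s x p := by
  induction n generalizing p with
  | zero => simp [block, roofWord]
  | succ n ih =>
    rw [block_succ, roofWord_cons, ih, roofSum_add_one, Nat.cast_succ, add_comm (n : ℤ),
      ← add_assoc]
    ring

lemma roofWord_nonneg (hs : ∀ j, 0 ≤ s j) (w : List (Fin m)) : 0 ≤ roofWord s w :=
  List.sum_nonneg fun t ht => by
    obtain ⟨j, -, rfl⟩ := List.mem_map.1 ht
    exact hs j

namespace Substitution

variable {ζ : Substitution m} {p : ℕ} (hp : ∀ a b, a ∈ ζ.iter p b)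
include hp

lemma one_le_roofWord_iter (hs : s ∈ openSimplex m) (b : Fin m) : 1 ≤ roofWord s (ζ.iter p b) := by
  rw [roofWord_eq_dotProduct, ← hs.2]
  refine Finset.sum_le_sum fun a _ => le_mul_of_one_le_right (hs.1 a).le ?_
  have hcount : (1 : ℤ) ≤ popVec (ζ.iter p b) a :=
    Nat.one_le_cast.2 (List.count_pos_iff.2 (hp a b))
  exact Int.cast_one_le_of_pos hcount

lemma length_le_roofWord_iterWord (hs : s ∈ openSimplex m) (w : List (Fin m)) :
    (w.length : ℝ) ≤ roofWord s (ζ.iterWord p w) := by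
  induction w with
  | nil => simp [roofWord]
  | cons b w ih =>
    rw [iterWord_cons, roofWord_append, List.length_cons, Nat.cast_succ]
    linarith [one_le_roofWord_iter hp hs b]

lemma length_le_of_isInfix_iter (hs : s ∈ openSimplex m) {k : ℕ} {a : Fin m} {w : List (Fin m)}
    (hw : w <:+: ζ.iter k a) : (w.length : ℝ) ≤ ζ.maxLen p * (2 + roofWord s w) := by
  obtain ⟨u, w', v, rfl, hu, hv⟩ := ζ.exists_eq_append_iterWord_append_of_isInfix p hw
  have hnonneg := roofWord_nonneg fun j => (hs.1 j).le
  have hlength : (u ++ ζ.iterWord p w' ++ v).length ≤ ζ.maxLen p * (2 + w'.length) := by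
    have := ζ.length_iterWord_le p w'
    simp only [List.length_append]
    nlinarith
  calc ((u ++ ζ.iterWord p w' ++ v).length : ℝ) ≤ ζ.maxLen p * (2 + w'.length) := by
        exact_mod_cast hlength
    _ ≤ ζ.maxLen p * (2 + roofWord s (u ++ ζ.iterWord p w' ++ v)) := by
        rw [roofWord_append, roofWord_append]
        gcongr
        linarith [length_le_roofWord_iterWord hp hs w', hnonneg u, hnonneg v]

end Substitution

end Roof

/-! ### Twisted integrals along flow lines -/

section TwistedIntegral

variable {m : ℕ} {s : Fin m → ℝ} {ψ : Fin m → ℝ → ℂ} {L : ℝ}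

/-- The twisted integral of `ψ a` over a tile of type `a`, that is, over `[0, s a]`. -/
def tileIntegral (ω : ℝ) (s : Fin m → ℝ) (ψ : Fin m → ℝ → ℂ) (a : Fin m) : ℂ :=
  ∫ u in (0 : ℝ)..(s a), 𝐞 (-(ω * u)) * ψ a u

lemma norm_fourierChar_mul (t : ℝ) (z : ℂ) : ‖(𝐞 t : ℂ) * z‖ = ‖z‖ := by
  rw [norm_mul, Circle.norm_coe, one_mul]

lemma coe_fourierChar_add (t u : ℝ) : (𝐞 (t + u) : ℂ) = 𝐞 t * 𝐞 u := by
  rw [AddChar.map_add_eq_mul, Circle.coe_mul]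

lemma norm_flowLine_le (hb : ∀ a t, ‖ψ a t‖ ≤ L) (x : ℤ → Fin m) (u : ℝ) :
    ‖flowLine s ψ x u‖ ≤ L := hb _ _

lemma intervalIntegrable_fourierChar_mul_flowLine (hs : ∀ j, 0 < s j)
    (hψ : ∀ a, Measurable (ψ a)) (hb : ∀ a t, ‖ψ a t‖ ≤ L) (ω : ℝ) (x : ℤ → Fin m) (A B : ℝ) :
    IntervalIntegrable (fun u => 𝐞 (-(ω * u)) * flowLine s ψ x u) volume A B := by
  have hmeas : Measurable fun u => (𝐞 (-(ω * u)) : ℂ) * flowLine s ψ x u := by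
    refine Measurable.mul ?_ ((measurable_flowLine hs hψ).comp measurable_prodMk_left)
    exact Continuous.measurable (by fun_prop)
  refine (intervalIntegrable_const (c := L)).mono_fun' hmeas.aestronglyMeasurable
    (Filter.Eventually.of_forall fun u => ?_)
  exact (norm_fourierChar_mul _ _).trans_le (norm_flowLine_le hb x u)

lemma integral_flowLine_tile (hs : ∀ j, 0 < s j) (ω : ℝ) (x : ℤ → Fin m) (p : ℤ) :
    ∫ u in (roofSum s x p)..(roofSum s x (p + 1)), 𝐞 (-(ω * u)) * flowLine s ψ x u =
      𝐞 (-(ω * roofSum s x p)) * tileIntegral ω s ψ (x p) := by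
  have hcongr : ∫ u in (roofSum s x p)..(roofSum s x (p + 1)), 𝐞 (-(ω * u)) * flowLine s ψ x u =
      ∫ u in (roofSum s x p)..(roofSum s x (p + 1)),
        𝐞 (-(ω * u)) * ψ (x p) (u - roofSum s x p) := by
    refine intervalIntegral.integral_congr_ae ?_
    filter_upwards [Measure.ae_ne volume (roofSum s x (p + 1))] with u hu hmem
    rw [uIoc_of_le (strictMono_roofSum hs x (lt_add_one p)).le] at hmem
    rw [flowLine_eq hs ψ x hmem.1.le (lt_of_le_of_ne hmem.2 hu)]
  have hshift := intervalIntegral.integral_comp_add_right (a := 0) (b := s (x p))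
    (fun u => 𝐞 (-(ω * u)) * ψ (x p) (u - roofSum s x p)) (roofSum s x p)
  rw [zero_add, add_comm (s (x p)), ← roofSum_add_one] at hshift
  rw [hcongr, ← hshift, tileIntegral, ← intervalIntegral.integral_const_mul]
  refine intervalIntegral.integral_congr fun u _ => ?_
  simp only [add_sub_cancel_right]
  rw [mul_add, neg_add, coe_fourierChar_add]
  ring

lemma integral_flowLine_block (hs : ∀ j, 0 < s j) (hψ : ∀ a, Measurable (ψ a))
    (hb : ∀ a t, ‖ψ a t‖ ≤ L) (ω : ℝ) (x : ℤ → Fin m) (p : ℤ) (n : ℕ) :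
    ∫ u in (roofSum s x p)..(roofSum s x (p + n)), 𝐞 (-(ω * u)) * flowLine s ψ x u =
      𝐞 (-(ω * roofSum s x p)) * twistedSum ω s (tileIntegral ω s ψ) (block x p n) := by
  induction n generalizing p with
  | zero => simp [block, twistedSum]
  | succ n ih =>
    have hint := intervalIntegrable_fourierChar_mul_flowLine hs hψ hb ω x
    rw [← intervalIntegral.integral_add_adjacent_intervals (hint _ (roofSum s x (p + 1)))
      (hint _ _), integral_flowLine_tile hs, Nat.cast_succ, add_comm (n : ℤ), ← add_assoc, ih,
      block_succ, twistedSum, roofSum_add_one, mul_add ω, neg_add, coe_fourierChar_add]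
    ring

lemma norm_integral_fourierChar_mul_le {φ : ℝ → ℂ} (hφ : ∀ u, ‖φ u‖ ≤ L) (ω A B : ℝ) :
    ‖∫ u in A..B, 𝐞 (-(ω * u)) * φ u‖ ≤ L * |B - A| :=
  intervalIntegral.norm_integral_le_of_norm_le_const fun u _ =>
    (norm_fourierChar_mul _ _).trans_le (hφ u)

/-- The two incomplete tiles at the ends of `[A, A + R]` account for the term `2 * L`. -/
lemma exists_norm_integral_flowLine_le (hs : ∀ j, 0 < s j) (hs1 : ∀ j, s j ≤ 1)
    (hψ : ∀ a, Measurable (ψ a)) (hb : ∀ a t, ‖ψ a t‖ ≤ L) (ω : ℝ) (x : ℤ → Fin m) (A : ℝ) {R : ℝ}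
    (hR : 0 ≤ R) :
    ∃ (p : ℤ) (n : ℕ), roofWord s (block x p n) ≤ R + 1 ∧
      ‖∫ u in A..(A + R), 𝐞 (-(ω * u)) * flowLine s ψ x u‖ ≤
        2 * L + ‖twistedSum ω s (tileIntegral ω s ψ) (block x p n)‖ := by
  obtain ⟨hp, hp'⟩ := tileIndex_spec hs x A
  obtain ⟨hq, hq'⟩ := tileIndex_spec hs x (A + R)
  set p := tileIndex s x A
  set q := tileIndex s x (A + R)
  have hpq : p < q + 1 :=
    (strictMono_roofSum hs x).lt_iff_lt.1 (hp.trans_lt (by linarith))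
  obtain ⟨n, hn⟩ : ∃ n : ℕ, q = p + n := ⟨(q - p).toNat, by omega⟩
  rw [roofSum_add_one] at hp' hq'
  have hpA : |A - roofSum s x p| ≤ 1 := by rw [abs_le]; constructor <;> linarith [hs1 (x p)]
  have hqB : |A + R - roofSum s x q| ≤ 1 := by rw [abs_le]; constructor <;> linarith [hs1 (x q)]
  refine ⟨p, n, by rw [roofWord_block, ← hn]; linarith [(abs_le.1 hpA).2], ?_⟩
  set f : ℝ → ℂ := fun u => 𝐞 (-(ω * u)) * flowLine s ψ x u with hf
  have hint := intervalIntegrable_fourierChar_mul_flowLine hs hψ hb ω x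
  have hend (C D : ℝ) (hCD : |D - C| ≤ 1) : ‖∫ u in C..D, f u‖ ≤ L :=
    (norm_integral_fourierChar_mul_le (norm_flowLine_le hb x) ω C D).trans
      (mul_le_of_le_one_right ((norm_nonneg _).trans (hb (x 0) 0)) hCD)
  have hdiff := intervalIntegral.integral_interval_sub_interval_comm (hint A (A + R))
    (hint (roofSum s x p) (roofSum s x q)) (hint A (roofSum s x p))
  have hmid : ‖∫ u in (roofSum s x p)..(roofSum s x q), f u‖ =
      ‖twistedSum ω s (tileIntegral ω s ψ) (block x p n)‖ := by
    rw [hn, hf, integral_flowLine_block hs hψ hb, norm_fourierChar_mul]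
  have hsub :
      ‖(∫ u in A..(A + R), f u) - ∫ u in (roofSum s x p)..(roofSum s x q), f u‖ ≤ L + L := by
    rw [hdiff]
    refine (norm_sub_le _ _).trans (add_le_add (hend _ _ ?_) ?_)
    · rwa [abs_sub_comm]
    · exact hend _ _ (by rwa [abs_sub_comm])
  have htriangle := norm_le_norm_add_norm_sub'
    (∫ u in A..(A + R), f u) (∫ u in (roofSum s x p)..(roofSum s x q), f u)
  linarith

lemma norm_tileIntegral_le (hs : s ∈ openSimplex m) (hb : ∀ a t, ‖ψ a t‖ ≤ L) (ω : ℝ)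
    (a : Fin m) : ‖tileIntegral ω s ψ a‖ ≤ L := by
  refine (norm_integral_fourierChar_mul_le (hb a) ω 0 (s a)).trans
    (mul_le_of_le_one_right ((norm_nonneg _).trans (hb a 0)) ?_)
  rw [sub_zero, abs_of_pos (hs.1 a)]
  exact le_one_of_mem_openSimplex hs a

lemma norm_integral_le_of_norm_add_shift_le {E : Type*} [NormedAddCommGroup E] [NormedSpace ℝ E]
    {g : ℝ → E} (hg : Continuous g) {M δ h : ℝ} (hM : ∀ u, ‖g u‖ ≤ M)
    (hδ : ∀ u, ‖g u + g (u + h)‖ ≤ δ) (A B : ℝ) :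
    2 * ‖∫ u in A..B, g u‖ ≤ δ * |B - A| + 2 * (M * |h|) := by
  have hint (C D : ℝ) : IntervalIntegrable g volume C D := hg.intervalIntegrable C D
  have hg' : Continuous fun u => g (u + h) := by fun_prop
  have hadd : ‖(∫ u in A..B, g u) + ∫ u in A..B, g (u + h)‖ ≤ δ * |B - A| := by
    rw [← intervalIntegral.integral_add (hint _ _) (hg'.intervalIntegrable _ _)]
    exact intervalIntegral.norm_integral_le_of_norm_le_const fun u _ => hδ u
  have hsmall (C : ℝ) : ‖∫ u in C..(C + h), g u‖ ≤ M * |h| := by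
    simpa using intervalIntegral.norm_integral_le_of_norm_le_const (a := C) (b := C + h)
      fun u _ => hM u
  have hsub : ‖(∫ u in A..B, g u) - ∫ u in A..B, g (u + h)‖ ≤ 2 * (M * |h|) := by
    rw [intervalIntegral.integral_comp_add_right,
      intervalIntegral.integral_interval_sub_interval_comm (hint _ _) (hint _ _) (hint _ _)]
    linarith [norm_sub_le (∫ u in A..(A + h), g u) (∫ u in B..(B + h), g u), hsmall A, hsmall B]
  calc 2 * ‖∫ u in A..B, g u‖
      = ‖((∫ u in A..B, g u) + ∫ u in A..B, g (u + h)) +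
          ((∫ u in A..B, g u) - ∫ u in A..B, g (u + h))‖ := by
        rw [add_add_sub_cancel, ← two_smul ℝ, norm_smul, Real.norm_ofNat]
    _ ≤ δ * |B - A| + 2 * (M * |h|) := (norm_add_le _ _).trans (add_le_add hadd hsub)

lemma fourierChar_neg_half : (𝐞 (-(1 / 2)) : ℂ) = -1 := by
  rw [Real.fourierChar_apply, show 2 * Real.pi * -(1 / 2) = -Real.pi by ring]
  push_cast
  rw [neg_mul, Complex.exp_neg, Complex.exp_pi_mul_I]
  norm_num

/-- A shift by half a period `1 / (2 * ω)` changes the sign of the character. -/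
lemma norm_integral_fourierChar_mul_le_of_lipschitz {φ : ℝ → ℂ} {K : NNReal}
    (hφ : LipschitzWith K φ) {M : ℝ} (hM : ∀ u, ‖φ u‖ ≤ M) {ω : ℝ} (hω : ω ≠ 0) (A B : ℝ) :
    ‖∫ u in A..B, 𝐞 (-(ω * u)) * φ u‖ ≤ (K * |B - A| + 2 * M) / (4 * |ω|) := by
  have hφc := hφ.continuous
  have hcont : Continuous fun u => (𝐞 (-(ω * u)) : ℂ) * φ u := by fun_prop
  have hshift (u : ℝ) : ‖𝐞 (-(ω * u)) * φ u + 𝐞 (-(ω * (u + 1 / (2 * ω)))) * φ (u + 1 / (2 * ω))‖ ≤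
      K * |1 / (2 * ω)| := by
    have hperiod : -(ω * (u + 1 / (2 * ω))) = -(ω * u) + -(1 / 2) := by field_simp; ring
    rw [hperiod, coe_fourierChar_add, fourierChar_neg_half, mul_neg_one, neg_mul, ← sub_eq_add_neg,
      ← mul_sub, norm_fourierChar_mul]
    simpa [Real.dist_eq] using hφ.norm_sub_le u (u + 1 / (2 * ω))
  have h := norm_integral_le_of_norm_add_shift_le hcont
    (fun u => (norm_fourierChar_mul _ _).trans_le (hM u)) hshift A B
  have hω' : 0 < |ω| := abs_pos.2 hω
  rw [le_div_iff₀ (by positivity)]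
  have habs : |1 / (2 * ω)| = 1 / (2 * |ω|) := by rw [abs_div, abs_mul]; simp
  rw [habs] at h
  have := mul_le_mul_of_nonneg_right h (mul_nonneg zero_le_two hω'.le)
  field_simp at this
  linarith

lemma norm_tileIntegral_le_div (hs : s ∈ openSimplex m) {K : NNReal}
    (hψ : ∀ a, LipschitzWith K (ψ a)) (hb : ∀ a t, ‖ψ a t‖ ≤ K) {ω : ℝ} (hω : ω ≠ 0) (a : Fin m) :
    ‖tileIntegral ω s ψ a‖ ≤ K / |ω| := by
  refine (norm_integral_fourierChar_mul_le_of_lipschitz (hψ a) (hb a) hω 0 (s a)).trans ?_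
  have hω' : 0 < |ω| := abs_pos.2 hω
  rw [div_le_div_iff₀ (by positivity) hω', sub_zero, abs_of_pos (hs.1 a)]
  have hKω := mul_nonneg K.coe_nonneg hω'.le
  nlinarith [mul_nonneg hKω (sub_nonneg.2 (le_one_of_mem_openSimplex hs a))]

end TwistedIntegral

/-! ### Spectral measures -/

section Spectral

lemma intervalIntegral_integral_swap_of_bound {Y E : Type*} [MeasurableSpace Y]
    [NormedAddCommGroup E] [NormedSpace ℝ E] {ν : Measure Y} [IsFiniteMeasure ν] {F : ℝ → Y → E}
    (hF : StronglyMeasurable (Function.uncurry F)) {C : ℝ} (hC : ∀ t y, ‖F t y‖ ≤ C) (A B : ℝ) :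
    ∫ t in A..B, ∫ y, F t y ∂ν = ∫ y, (∫ t in A..B, F t y) ∂ν :=
  have : IsFiniteMeasure ((volume : Measure ℝ).restrict (uIoc A B)) :=
    inferInstanceAs (IsFiniteMeasure (volume.restrict (Ioc _ _)))
  intervalIntegral_integral_swap (Integrable.of_bound hF.aestronglyMeasurable C
    (Filter.Eventually.of_forall fun z => hC z.1 z.2))

lemma norm_fourierChar_sub_one_le (x : ℝ) : ‖(𝐞 x : ℂ) - 1‖ ≤ 2 * Real.pi * |x| := by
  rw [Real.fourierChar_apply, mul_comm]
  refine Real.norm_exp_I_mul_ofReal_sub_one_le.trans (le_of_eq ?_)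
  rw [Real.norm_eq_abs, abs_mul, abs_of_pos Real.two_pi_pos]

/-- The Dirichlet integral `∫₀ᴿ e^{2πitξ} dt`, whose modulus is of size `R` for `|ξ|` up to
a constant multiple of `1 / R`. -/
def dirichletIntegral (R ξ : ℝ) : ℂ := ∫ t in (0 : ℝ)..R, 𝐞 (t * ξ)

lemma continuous_dirichletIntegral (R : ℝ) : Continuous (dirichletIntegral R) :=
  intervalIntegral.continuous_parametric_intervalIntegral_of_continuous' (by fun_prop) _ _

lemma norm_dirichletIntegral_le {R : ℝ} (hR : 0 ≤ R) (ξ : ℝ) : ‖dirichletIntegral R ξ‖ ≤ R := by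
  refine (intervalIntegral.norm_integral_le_of_norm_le_const fun t _ =>
    (Circle.norm_coe (𝐞 (t * ξ))).le).trans ?_
  rw [sub_zero, abs_of_nonneg hR, one_mul]

lemma half_le_norm_dirichletIntegral {R r ξ : ℝ} (hR : 0 ≤ R) (hrR : r * R ≤ 1 / 16)
    (hξ : |ξ| ≤ r) : R / 2 ≤ ‖dirichletIntegral R ξ‖ := by
  have hdiff : ‖dirichletIntegral R ξ - R‖ ≤ 1 / 2 * R := by
    have hsub : dirichletIntegral R ξ - R = ∫ t in (0 : ℝ)..R, ((𝐞 (t * ξ) : ℂ) - 1) := by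
      have hcont : Continuous fun t : ℝ => (𝐞 (t * ξ) : ℂ) := by fun_prop
      rw [intervalIntegral.integral_sub (hcont.intervalIntegrable _ _) intervalIntegrable_const]
      simp [dirichletIntegral]
    have hbound : ∀ t ∈ uIoc 0 R, ‖(𝐞 (t * ξ) : ℂ) - 1‖ ≤ 1 / 2 := fun t ht => by
      rw [uIoc_of_le hR] at ht
      have htξ : |t * ξ| ≤ 1 / 16 := by
        rw [abs_mul, abs_of_pos ht.1]
        calc t * |ξ| ≤ R * r := mul_le_mul ht.2 hξ (abs_nonneg _) hR
          _ ≤ 1 / 16 := by linarith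
      refine (norm_fourierChar_sub_one_le _).trans ?_
      nlinarith [Real.pi_lt_four, Real.pi_pos]
    rw [hsub]
    refine (intervalIntegral.norm_integral_le_of_norm_le_const hbound).trans_eq ?_
    rw [sub_zero, abs_of_nonneg hR]
  have hnorm : ‖(R : ℂ)‖ = R := by rw [Complex.norm_real, Real.norm_eq_abs, abs_of_nonneg hR]
  have htriangle := norm_sub_norm_le (R : ℂ) (dirichletIntegral R ξ)
  rw [norm_sub_rev] at htriangle
  linarith

lemma conj_dirichletIntegral {R : ℝ} (hR : 0 ≤ R) (ξ : ℝ) :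
    conj (dirichletIntegral R ξ) = ∫ u in (0 : ℝ)..R, (𝐞 (-(u * ξ)) : ℂ) := by
  rw [dirichletIntegral, intervalIntegral.integral_of_le hR, intervalIntegral.integral_of_le hR,
    ← integral_conj]
  simp only [AddChar.map_neg_eq_inv, Circle.coe_inv_eq_conj]

section FiniteMeasure

variable (σ : Measure ℝ) [IsFiniteMeasure σ]

lemma integral_norm_dirichletIntegral_sq {R : ℝ} (hR : 0 ≤ R) (ω : ℝ) :
    ((∫ x, ‖dirichletIntegral R (x - ω)‖ ^ 2 ∂σ : ℝ) : ℂ) =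
      ∫ u in (0 : ℝ)..R, ∫ x, dirichletIntegral R (x - ω) * 𝐞 (-(u * (x - ω))) ∂σ := by
  have hcont := continuous_dirichletIntegral R
  have hcont' : Continuous (Function.uncurry fun u x : ℝ =>
      dirichletIntegral R (x - ω) * (𝐞 (-(u * (x - ω))) : ℂ)) := by
    unfold Function.uncurry
    fun_prop
  rw [intervalIntegral_integral_swap_of_bound hcont'.stronglyMeasurable (C := R),
    ← integral_complex_ofReal]
  · refine integral_congr_ae (Filter.Eventually.of_forall fun x => ?_)
    simp only
    rw [intervalIntegral.integral_const_mul, ← conj_dirichletIntegral hR, Complex.mul_conj,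
      Complex.normSq_eq_norm_sq]
  · intro u x
    rw [norm_mul, Circle.norm_coe, mul_one]
    exact norm_dirichletIntegral_le hR _

lemma half_sq_mul_measureReal_Icc_le {R r : ℝ} (hR : 0 ≤ R) (hrR : r * R ≤ 1 / 16) (ω : ℝ) :
    (R / 2) ^ 2 * σ.real (Icc (ω - r) (ω + r)) ≤ ∫ x, ‖dirichletIntegral R (x - ω)‖ ^ 2 ∂σ := by
  have hcont := continuous_dirichletIntegral R
  have hint : Integrable (fun x => ‖dirichletIntegral R (x - ω)‖ ^ 2) σ :=
    Integrable.of_bound (Continuous.aestronglyMeasurable (by fun_prop)) (R ^ 2)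
      (Filter.Eventually.of_forall fun x => by
        rw [Real.norm_of_nonneg (by positivity)]
        gcongr
        exact norm_dirichletIntegral_le hR _)
  have hsub : Icc (ω - r) (ω + r) ⊆ {x | (R / 2) ^ 2 ≤ ‖dirichletIntegral R (x - ω)‖ ^ 2} := by
    intro x hx
    have hxω : |x - ω| ≤ r := by rw [abs_le]; constructor <;> linarith [hx.1, hx.2]
    exact pow_le_pow_left₀ (by positivity) (half_le_norm_dirichletIntegral hR hrR hxω) 2
  exact (mul_le_mul_of_nonneg_left (measureReal_mono hsub) (by positivity)).trans
    (mul_meas_ge_le_integral_of_nonneg (Filter.Eventually.of_forall fun x => by positivity) hint _)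

lemma integral_dirichletIntegral_mul (R ω u : ℝ) :
    ∫ x, dirichletIntegral R (x - ω) * 𝐞 (-(u * (x - ω))) ∂σ =
      ∫ τ in (-u)..(R - u), 𝐞 (-(ω * τ)) * ∫ x, (𝐞 (x * τ) : ℂ) ∂σ := by
  have hcont : Continuous (Function.uncurry fun τ x : ℝ => (𝐞 (-(ω * τ)) * 𝐞 (x * τ) : ℂ)) := by
    unfold Function.uncurry
    fun_prop
  simp only [← integral_const_mul]
  rw [intervalIntegral_integral_swap_of_bound hcont.stronglyMeasurable (C := 1)
    fun τ x => by rw [norm_fourierChar_mul, Circle.norm_coe]]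
  refine integral_congr_ae (Filter.Eventually.of_forall fun x => ?_)
  simp only [dirichletIntegral, ← intervalIntegral.integral_mul_const]
  have hshift := intervalIntegral.integral_comp_sub_right (a := 0) (b := R)
    (fun τ => (𝐞 (-(ω * τ)) * 𝐞 (x * τ) : ℂ)) u
  rw [zero_sub] at hshift
  rw [← hshift]
  refine intervalIntegral.integral_congr fun t _ => ?_
  simp only [← coe_fourierChar_add]
  ring_nf

end FiniteMeasure

namespace IsSpectralMeasure

variable {Y : Type*} [MeasurableSpace Y] {ν : Measure Y} {h : ℝ → Y → Y} {f : Y → ℂ} {σ : Measure ℝ}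

lemma integral_fourierChar (hσ : IsSpectralMeasure ν h f σ) (τ : ℝ) :
    ∫ x, (𝐞 (x * τ) : ℂ) ∂σ = ∫ y, f (h τ y) * conj (f y) ∂ν := by
  rw [← hσ.fourier]
  refine integral_congr_ae (Filter.Eventually.of_forall fun x => ?_)
  simp only [Real.fourierChar_apply]
  push_cast
  ring_nf

variable [IsZeroOrProbabilityMeasure ν] (hσ : IsSpectralMeasure ν h f σ) (hf : Measurable f)
  (hfh : Measurable fun z : ℝ × Y => f (h z.1 z.2)) {L : ℝ} (hfb : ∀ y, ‖f y‖ ≤ L)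
include hσ hf hfh hfb

lemma integral_dirichletIntegral_mul_eq (R ω u : ℝ) :
    ∫ x, dirichletIntegral R (x - ω) * 𝐞 (-(u * (x - ω))) ∂σ =
      ∫ y, conj (f y) * (∫ τ in (-u)..(R - u), 𝐞 (-(ω * τ)) * f (h τ y)) ∂ν := by
  have := hσ.isFiniteMeasure
  have hmeas : Measurable (Function.uncurry fun (τ : ℝ) (y : Y) =>
      (𝐞 (-(ω * τ)) : ℂ) * (f (h τ y) * conj (f y))) :=
    (Continuous.measurable (f := fun τ : ℝ => (𝐞 (-(ω * τ)) : ℂ)) (by fun_prop)).comp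
      measurable_fst |>.mul
        (hfh.mul (Complex.continuous_conj.measurable.comp (hf.comp measurable_snd)))
  rw [integral_dirichletIntegral_mul]
  simp only [hσ.integral_fourierChar, ← integral_const_mul]
  rw [intervalIntegral_integral_swap_of_bound hmeas.stronglyMeasurable (C := L * L)]
  · refine integral_congr_ae (Filter.Eventually.of_forall fun y => ?_)
    simp only
    rw [← intervalIntegral.integral_const_mul]
    refine intervalIntegral.integral_congr fun τ _ => ?_
    ring
  · intro τ y
    rw [norm_fourierChar_mul, norm_mul, RCLike.norm_conj]
    exact mul_le_mul (hfb _) (hfb _) (norm_nonneg _) ((norm_nonneg _).trans (hfb y))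

lemma measureReal_Icc_le (hL : 0 ≤ L) {ω R B r : ℝ} (hR : 0 < R) (hrR : r * R ≤ 1 / 16)
    (hB : ∀ᵐ y ∂ν, ∀ u : ℝ, ‖∫ τ in (-u)..(R - u), 𝐞 (-(ω * τ)) * f (h τ y)‖ ≤ B) (hB0 : 0 ≤ B) :
    σ.real (Icc (ω - r) (ω + r)) ≤ 4 * L * B / R := by
  have := hσ.isFiniteMeasure
  have hinner (u : ℝ) :
      ‖∫ x, dirichletIntegral R (x - ω) * 𝐞 (-(u * (x - ω))) ∂σ‖ ≤ L * B := by
    rw [hσ.integral_dirichletIntegral_mul_eq hf hfh hfb]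
    refine (norm_integral_le_of_norm_le_const (C := L * B) ?_).trans
      (mul_le_of_le_one_right (by positivity) measureReal_le_one)
    filter_upwards [hB] with y hy
    rw [norm_mul, RCLike.norm_conj]
    exact mul_le_mul (hfb y) (hy u) (norm_nonneg _) hL
  have hsq : ∫ x, ‖dirichletIntegral R (x - ω)‖ ^ 2 ∂σ ≤ L * B * R := by
    refine (le_abs_self _).trans ?_
    rw [← Real.norm_eq_abs, ← Complex.norm_real, integral_norm_dirichletIntegral_sq σ hR.le]
    refine (intervalIntegral.norm_integral_le_of_norm_le_const fun u _ => hinner u).trans_eq ?_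
    rw [sub_zero, abs_of_pos hR]
  have hcheb := (half_sq_mul_measureReal_Icc_le σ hR.le hrR ω).trans hsq
  rw [le_div_iff₀ hR]
  refine le_of_mul_le_mul_right ?_ hR
  linarith

end IsSpectralMeasure

end Spectral

/-! ### Lipschitz data -/

section LipData

lemma norm_le_lipNormIcc {b : ℝ} {φ : ℝ → ℂ} {K : NNReal} (hφ : LipschitzOnWith K φ (Icc 0 b))
    {t : ℝ} (ht : t ∈ Icc 0 b) : ‖φ t‖ ≤ lipNormIcc b φ := by
  have hbdd : BddAbove ((fun t => ‖φ t‖) '' Icc 0 b) :=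
    (isCompact_Icc.image_of_continuousOn hφ.continuousOn.norm).bddAbove
  exact (le_csSup hbdd ⟨t, ht, rfl⟩).trans
    (le_add_of_nonneg_right (Real.sInf_nonneg fun _ hk => hk.1))

lemma norm_sub_le_lipNormIcc_mul {b : ℝ} {φ : ℝ → ℂ} {K : NNReal}
    (hφ : LipschitzOnWith K φ (Icc 0 b)) {t u : ℝ} (ht : t ∈ Icc 0 b) (hu : u ∈ Icc 0 b) :
    ‖φ t - φ u‖ ≤ lipNormIcc b φ * |t - u| := by
  rcases eq_or_ne t u with rfl | hne
  · simp only [sub_self, norm_zero, abs_zero, mul_zero, le_refl]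
  have hpos : 0 < |t - u| := abs_pos.2 (sub_ne_zero.2 hne)
  have hsup : 0 ≤ sSup ((fun t => ‖φ t‖) '' Icc 0 b) :=
    Real.sSup_nonneg (by rintro _ ⟨t, -, rfl⟩; exact norm_nonneg _)
  have hinf : ‖φ t - φ u‖ / |t - u| ≤
      sInf {K : ℝ | 0 ≤ K ∧ ∀ t ∈ Icc 0 b, ∀ u ∈ Icc 0 b, ‖φ t - φ u‖ ≤ K * |t - u|} := by
    refine le_csInf ⟨K, K.coe_nonneg, fun t ht u hu => ?_⟩ fun k hk =>
      (div_le_iff₀ hpos).2 (hk.2 t ht u hu)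
    simpa only [dist_eq_norm, Real.norm_eq_abs] using hφ.dist_le_mul t ht u hu
  exact (div_le_iff₀ hpos).1 (hinf.trans (le_add_of_nonneg_left hsup))

variable {m : ℕ} {s : Fin m → ℝ} {ψ : Fin m → ℝ → ℂ}

lemma lipNormIcc_le_cylLipNorm (s : Fin m → ℝ) (ψ : Fin m → ℝ → ℂ) (a : Fin m) :
    lipNormIcc (s a) (ψ a) ≤ cylLipNorm s ψ :=
  le_ciSup (f := fun a => lipNormIcc (s a) (ψ a)) (Set.finite_range _).bddAbove a

/-- The extension of each `ψ a` from `[0, s a]` to the line that is constant on both sides. It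
turns Lipschitz data into globally Lipschitz functions without changing the cylindrical function
on the suspension space. -/
def clampData (s : Fin m → ℝ) (ψ : Fin m → ℝ → ℂ) (a : Fin m) (t : ℝ) : ℂ :=
  ψ a (max 0 (min t (s a)))

lemma clampData_eq {a : Fin m} {t : ℝ} (ht : t ∈ Icc 0 (s a)) : clampData s ψ a t = ψ a t := by
  rw [clampData, min_eq_left ht.2, max_eq_right ht.1]

lemma clamp_mem_Icc {b : ℝ} (hb : 0 ≤ b) (t : ℝ) : max 0 (min t b) ∈ Icc 0 b :=
  ⟨le_max_left _ _, max_le hb (min_le_right _ _)⟩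

lemma norm_clampData_le (hs : ∀ j, 0 < s j) (hψ : IsLipData s ψ) (a : Fin m) (t : ℝ) :
    ‖clampData s ψ a t‖ ≤ cylLipNorm s ψ :=
  (norm_le_lipNormIcc (hψ a).choose_spec (clamp_mem_Icc (hs a).le t)).trans
    (lipNormIcc_le_cylLipNorm s ψ a)

lemma lipschitzWith_clampData (hs : ∀ j, 0 < s j) (hψ : IsLipData s ψ) (a : Fin m) :
    LipschitzWith (cylLipNorm s ψ).toNNReal (clampData s ψ a) := by
  refine LipschitzWith.of_dist_le_mul fun t u => ?_
  have hclamp : |max 0 (min t (s a)) - max 0 (min u (s a))| ≤ |t - u| := by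
    simpa only [NNReal.coe_one, one_mul, Real.dist_eq, id] using
      (((LipschitzWith.id (α := ℝ)).min_const (s a)).const_max 0).dist_le_mul t u
  have hnonneg : 0 ≤ cylLipNorm s ψ := (norm_nonneg _).trans (norm_clampData_le hs hψ a t)
  rw [dist_eq_norm, Real.dist_eq, Real.coe_toNNReal _ hnonneg]
  exact (norm_sub_le_lipNormIcc_mul (hψ a).choose_spec (clamp_mem_Icc (hs a).le t)
    (clamp_mem_Icc (hs a).le u)).trans
      (mul_le_mul (lipNormIcc_le_cylLipNorm s ψ a) hclamp (abs_nonneg _) hnonneg)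

lemma flowLine_clampData (hs : ∀ j, 0 < s j) (x : ℤ → Fin m) (u : ℝ) :
    flowLine s (clampData s ψ) x u = flowLine s ψ x u := by
  obtain ⟨hlow, hupp⟩ := tileIndex_spec hs x u
  rw [roofSum_add_one] at hupp
  exact clampData_eq ⟨by linarith, by linarith⟩

lemma measurableSet_space (ζ : Substitution m) : MeasurableSet ζ.space := by
  have hspace : ζ.space = ⋂ n : ℕ,
      (fun (x : ℤ → Fin m) (i : Fin (2 * n + 1)) => x ((i : ℤ) - n)) ⁻¹'
        {g | ∃ (k : ℕ) (a : Fin m), List.ofFn g <:+: ζ.iter k a} := by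
    ext x
    simp only [Substitution.space, centralBlock, mem_ofPred_eq, mem_iInter, mem_preimage]
  rw [hspace]
  exact MeasurableSet.iInter fun n => measurable_pi_lambda _ (fun i => measurable_pi_apply _)
    (Set.toFinite _).measurableSet

lemma measurableSet_suspensionSpace (ζ : Substitution m) (s : Fin m → ℝ) :
    MeasurableSet (suspensionSpace ζ s) := by
  have hroof : Measurable fun p : (ℤ → Fin m) × ℝ => s (p.1 0) :=
    (measurable_of_countable s).comp ((measurable_pi_apply 0).comp measurable_fst)
  exact (measurable_fst (measurableSet_space ζ)).inter
    ((measurableSet_le measurable_const measurable_snd).inter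
      (measurableSet_lt measurable_snd hroof))

lemma ae_mem_suspensionSpace (ζ : Substitution m) (s : Fin m → ℝ) (μ : Measure (ℤ → Fin m)) :
    ∀ᵐ y ∂(suspensionMeasure ζ s μ), y ∈ suspensionSpace ζ s :=
  ProbabilityTheory.ae_cond_mem (measurableSet_suspensionSpace ζ s)

lemma IsSpectralMeasure.clampData (hs : ∀ j, 0 < s j) {ζ : Substitution m}
    {μ : Measure (ℤ → Fin m)} {σ : Measure ℝ}
    (hσ : IsSpectralMeasure (suspensionMeasure ζ s μ) (suspensionFlow s) (cylFun ψ) σ) :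
    IsSpectralMeasure (suspensionMeasure ζ s μ) (suspensionFlow s) (cylFun (clampData s ψ)) σ where
  isFiniteMeasure := hσ.isFiniteMeasure
  fourier t := by
    rw [hσ.fourier]
    refine integral_congr_ae ?_
    filter_upwards [ae_mem_suspensionSpace ζ s μ] with y hy
    rw [cylFun_suspensionFlow, cylFun_suspensionFlow, flowLine_clampData hs]
    congr 2
    exact (clampData_eq ⟨hy.2.1, hy.2.2.le⟩).symm

end LipData

/-! ### Bounds for the spectral measure -/

section SpectralBounds

variable {m : ℕ} {ζ : Substitution m} {s : Fin m → ℝ} {ψ : Fin m → ℝ → ℂ} {L : ℝ}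

lemma measurable_cylFun (hψ : ∀ a, Measurable (ψ a)) : Measurable (cylFun ψ) := by
  have hpair : Measurable fun z : Fin m × ℝ => ψ z.1 z.2 := measurable_from_prod_countable_right hψ
  have hletter : Measurable fun y : (ℤ → Fin m) × ℝ => y.1 0 :=
    (measurable_pi_apply 0).comp measurable_fst
  exact hpair.comp (hletter.prodMk measurable_snd)

lemma measurable_cylFun_suspensionFlow (hs : ∀ j, 0 < s j) (hψ : ∀ a, Measurable (ψ a)) :
    Measurable fun z : ℝ × ((ℤ → Fin m) × ℝ) => cylFun ψ (suspensionFlow s z.1 z.2) := by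
  simp only [cylFun_suspensionFlow]
  exact (measurable_flowLine hs hψ).comp ((measurable_fst.comp measurable_snd).prodMk
    ((measurable_snd.comp measurable_snd).add measurable_fst))

lemma integral_cylFun_suspensionFlow (ω R u : ℝ) (y : (ℤ → Fin m) × ℝ) :
    ∫ τ in (-u)..(R - u), 𝐞 (-(ω * τ)) * cylFun ψ (suspensionFlow s τ y) =
      𝐞 (ω * y.2) * ∫ v in (y.2 - u)..(y.2 - u + R), 𝐞 (-(ω * v)) * flowLine s ψ y.1 v := by
  have hshift := intervalIntegral.integral_comp_add_right (a := -u) (b := R - u)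
    (fun v => 𝐞 (-(ω * v)) * flowLine s ψ y.1 v) y.2
  rw [show -u + y.2 = y.2 - u by ring, show R - u + y.2 = y.2 - u + R by ring] at hshift
  rw [← hshift, ← intervalIntegral.integral_const_mul]
  refine intervalIntegral.integral_congr fun τ _ => ?_
  simp only [cylFun_suspensionFlow]
  rw [← mul_assoc, ← coe_fourierChar_add, add_comm y.2 τ]
  congr 3
  ring

section Spectral

variable {μ : Measure (ℤ → Fin m)} {σ : Measure ℝ}
  (hσ : IsSpectralMeasure (suspensionMeasure ζ s μ) (suspensionFlow s) (cylFun ψ) σ)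
include hσ

lemma IsSpectralMeasure.measureReal_Icc_le_of_flowLine (hs : ∀ j, 0 < s j) (hL : 0 ≤ L)
    (hψ : ∀ a, Measurable (ψ a)) (hb : ∀ a t, ‖ψ a t‖ ≤ L) {ω r R B : ℝ} (hR : 0 < R)
    (hrR : r * R ≤ 1 / 16) (hB0 : 0 ≤ B)
    (hB : ∀ x ∈ ζ.space, ∀ A : ℝ,
      ‖∫ u in A..(A + R), 𝐞 (-(ω * u)) * flowLine s ψ x u‖ ≤ B * R) :
    σ.real (Icc (ω - r) (ω + r)) ≤ 4 * L * B := by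
  have : IsZeroOrProbabilityMeasure (suspensionMeasure ζ s μ) := by
    unfold suspensionMeasure
    infer_instance
  refine (hσ.measureReal_Icc_le (measurable_cylFun hψ) (measurable_cylFun_suspensionFlow hs hψ)
    (fun y => hb _ _) hL hR hrR (B := B * R) ?_ (by positivity)).trans_eq (by field_simp)
  filter_upwards [ae_mem_suspensionSpace ζ s μ] with y hy u
  rw [integral_cylFun_suspensionFlow, norm_fourierChar_mul]
  exact hB y.1 hy.1 (y.2 - u)

lemma IsSpectralMeasure.measureReal_Icc_le_four_mul_sq (hs : ∀ j, 0 < s j) (hL : 0 ≤ L)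
    (hψ : ∀ a, Measurable (ψ a)) (hb : ∀ a t, ‖ψ a t‖ ≤ L) (ω : ℝ) {r : ℝ} (hr : 0 < r) :
    σ.real (Icc (ω - r) (ω + r)) ≤ 4 * L ^ 2 := by
  rw [sq, ← mul_assoc]
  refine hσ.measureReal_Icc_le_of_flowLine hs hL hψ hb (R := 1 / (16 * r)) (by positivity)
    (by field_simp; norm_num) hL fun x _ A => ?_
  refine (norm_integral_fourierChar_mul_le (norm_flowLine_le hb x) ω _ _).trans_eq ?_
  rw [add_sub_cancel_left, abs_of_pos (by positivity)]

end Spectral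

lemma exists_norm_integral_flowLine_le_twistedSum {p : ℕ} (hp : ∀ a b, a ∈ ζ.iter p b)
    (hs : s ∈ openSimplex m) (hψ : ∀ a, Measurable (ψ a)) (hb : ∀ a t, ‖ψ a t‖ ≤ L) (ω : ℝ)
    {x : ℤ → Fin m} (hx : x ∈ ζ.space) (A : ℝ) {R : ℝ} (hR : 1 ≤ R) :
    ∃ w : List (Fin m), (∃ k a, w <:+: ζ.iter k a) ∧ (w.length : ℝ) ≤ ζ.maxLen p * (4 * R) ∧
      ‖∫ u in A..(A + R), 𝐞 (-(ω * u)) * flowLine s ψ x u‖ ≤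
        2 * L + ‖twistedSum ω s (tileIntegral ω s ψ) w‖ := by
  obtain ⟨i, n, hlen, hint⟩ := exists_norm_integral_flowLine_le hs.1
    (le_one_of_mem_openSimplex hs) hψ hb ω x A (zero_le_one.trans hR)
  obtain ⟨k, a, hinf⟩ := exists_block_isInfix hx i n
  refine ⟨block x i n, ⟨k, a, hinf⟩,
    (Substitution.length_le_of_isInfix_iter hp hs hinf).trans ?_, hint⟩
  gcongr
  linarith

lemma norm_integral_flowLine_le_div {p : ℕ} (hp : ∀ a b, a ∈ ζ.iter p b) (hs : s ∈ openSimplex m)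
    {K : NNReal} (hψ : ∀ a, LipschitzWith K (ψ a)) (hb : ∀ a t, ‖ψ a t‖ ≤ K) {ω : ℝ} (hω : ω ≠ 0)
    {x : ℤ → Fin m} (hx : x ∈ ζ.space) (A : ℝ) {R : ℝ} (hR : 1 ≤ R) :
    ‖∫ u in A..(A + R), 𝐞 (-(ω * u)) * flowLine s ψ x u‖ ≤
      K * (2 / R + 4 * ζ.maxLen p / |ω|) * R := by
  obtain ⟨w, -, hlen, hint⟩ := exists_norm_integral_flowLine_le_twistedSum hp hs
    (fun a => (hψ a).continuous.measurable) hb ω hx A hR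
  have hR0 : R ≠ 0 := by positivity
  calc _ ≤ 2 * K + ‖twistedSum ω s (tileIntegral ω s ψ) w‖ := hint
    _ ≤ 2 * K + K / |ω| * w.length := by
      gcongr
      exact norm_twistedSum_le ω s (norm_tileIntegral_le_div hs hψ hb hω) w
    _ ≤ 2 * K + K / |ω| * (ζ.maxLen p * (4 * R)) := by gcongr
    _ = _ := by field_simp

lemma IsSpectralMeasure.measureReal_Icc_le_inv {p : ℕ} (hp : ∀ a b, a ∈ ζ.iter p b)
    (hs : s ∈ openSimplex m) {K : NNReal} (hψ : ∀ a, LipschitzWith K (ψ a))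
    (hb : ∀ a t, ‖ψ a t‖ ≤ K) {μ : Measure (ℤ → Fin m)} {σ : Measure ℝ}
    (hσ : IsSpectralMeasure (suspensionMeasure ζ s μ) (suspensionFlow s) (cylFun ψ) σ) {ω r : ℝ}
    (hω : ω ≠ 0) (hr : 0 < r) (hr16 : r ≤ 1 / 16) :
    σ.real (Icc (ω - r) (ω + r)) ≤ K ^ 2 * (128 * r + 16 * ζ.maxLen p * |ω|⁻¹) := by
  have hR : 1 ≤ 1 / (16 * r) := by
    rw [le_div_iff₀ (by positivity)]
    linarith
  refine (hσ.measureReal_Icc_le_of_flowLine hs.1 K.coe_nonneg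
    (fun a => (hψ a).continuous.measurable) hb (zero_lt_one.trans_le hR)
    (by field_simp; norm_num) (by positivity)
    fun x hx A => norm_integral_flowLine_le_div hp hs hψ hb hω hx A hR).trans_eq ?_
  field_simp
  ring

lemma norm_twistedSum_le_of_isInfix_iter {ω M δ : ℝ} {φ : Fin m → ℂ} (hφ : ∀ a, ‖φ a‖ ≤ M)
    (hM : 0 ≤ M) (hδ : 0 ≤ δ) {n : ℕ}
    (hdecay : ∀ w, ‖twistedSum ω s φ (ζ.iterWord n w)‖ ≤ δ * (ζ.iterWord n w).length)
    {k : ℕ} {a : Fin m} {w : List (Fin m)} (hw : w <:+: ζ.iter k a) :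
    ‖twistedSum ω s φ w‖ ≤ 2 * M * ζ.maxLen n + δ * w.length := by
  obtain ⟨u, v, t, rfl, hu, ht⟩ := ζ.exists_eq_append_iterWord_append_of_isInfix n hw
  have hend {z : List (Fin m)} (hz : z.length ≤ ζ.maxLen n) :
      ‖twistedSum ω s φ z‖ ≤ M * ζ.maxLen n :=
    (norm_twistedSum_le ω s hφ z).trans (by gcongr)
  have hmid : (ζ.iterWord n v).length ≤ (u ++ ζ.iterWord n v ++ t).length := by
    simp only [List.length_append]
    omega
  calc _ ≤ ‖twistedSum ω s φ u‖ + ‖twistedSum ω s φ (ζ.iterWord n v)‖ + ‖twistedSum ω s φ t‖ :=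
        (norm_twistedSum_append_le ω s φ _ _).trans
          (add_le_add_left (norm_twistedSum_append_le ω s φ _ _) _)
    _ ≤ M * ζ.maxLen n + δ * (ζ.iterWord n v).length + M * ζ.maxLen n :=
        add_le_add (add_le_add (hend hu) (hdecay v)) (hend ht)
    _ ≤ M * ζ.maxLen n + δ * (u ++ ζ.iterWord n v ++ t).length + M * ζ.maxLen n := by gcongr
    _ = _ := by ring

lemma norm_integral_flowLine_le_of_decay {p : ℕ} (hp : ∀ a b, a ∈ ζ.iter p b)
    (hs : s ∈ openSimplex m) (hL : 0 ≤ L) (hψ : ∀ a, Measurable (ψ a)) (hb : ∀ a t, ‖ψ a t‖ ≤ L)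
    {ω ε : ℝ} (hε : 0 ≤ ε) {n : ℕ}
    (hdecay : ∀ w, ‖twistedSum ω s (tileIntegral ω s ψ) (ζ.iterWord n w)‖ ≤
      L * ε * (ζ.iterWord n w).length)
    {x : ℤ → Fin m} (hx : x ∈ ζ.space) (A : ℝ) {R : ℝ} (hR : 1 ≤ R) :
    ‖∫ u in A..(A + R), 𝐞 (-(ω * u)) * flowLine s ψ x u‖ ≤
      L * (2 + 2 * ζ.maxLen n + 4 * ζ.maxLen p * ε * R) := by
  obtain ⟨w, ⟨k, a, hw⟩, hlen, hint⟩ :=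
    exists_norm_integral_flowLine_le_twistedSum hp hs hψ hb ω hx A hR
  calc _ ≤ 2 * L + ‖twistedSum ω s (tileIntegral ω s ψ) w‖ := hint
    _ ≤ 2 * L + (2 * L * ζ.maxLen n + L * ε * w.length) := by
      gcongr
      exact norm_twistedSum_le_of_isInfix_iter (norm_tileIntegral_le hs hb ω) hL
        (mul_nonneg hL hε) hdecay hw
    _ ≤ 2 * L + (2 * L * ζ.maxLen n + L * ε * (ζ.maxLen p * (4 * R))) := by gcongr
    _ = _ := by ring

end SpectralBounds

/-! ### Decay of twisted sums for almost every roof vector -/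

section Decay

variable {m : ℕ} {ζ : Substitution m}

lemma dotProduct_pos_of_mem_openSimplex {s w : Fin m → ℝ} (hs : s ∈ openSimplex m)
    (hw : ∀ i, 0 < w i) : 0 < s ⬝ᵥ w := by
  have : Nonempty (Fin m) := by
    by_contra h
    rw [not_nonempty_iff] at h
    simpa using hs.2
  exact Finset.sum_pos (fun i _ => mul_pos (hs.1 i) (hw i)) Finset.univ_nonempty

lemma dotProduct_intCast_pow_mulVec_popVec (s : Fin m → ℝ) (k : ℕ) (w : List (Fin m)) :
    s ⬝ᵥ (Int.cast ∘ ((ζ.matrix ^ k).mulVec (popVec w))) = roofWord s (ζ.iterWord k w) := by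
  rw [roofWord_eq_dotProduct, ζ.popVec_iterWord]
  rfl

lemma exists_intCast_pow_mulVec_recurrence (A : Matrix (Fin m) (Fin m) ℤ) (v : Fin m → ℤ) :
    ∃ c : Fin m → ℤ, ∀ k : ℕ, (Int.cast ∘ ((A ^ (k + m)).mulVec v) : Fin m → ℝ) =
      ∑ j : Fin m, (c j : ℝ) • (Int.cast ∘ ((A ^ (k + (j : ℕ))).mulVec v) : Fin m → ℝ) := by
  obtain ⟨c, hc⟩ := exists_krylov_recurrence A v
  refine ⟨c, fun k => ?_⟩
  ext i
  rw [hc k]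
  simp [Finset.sum_apply]

lemma exists_ae_farCount_roofWord (hprim : ζ.Primitive)
    (hirr : Irreducible (ζ.matrix.map (Int.cast : ℤ → ℚ)).charpoly)
    (hθ : 1 < ζ.secondModulus) (c : Fin m) (v : List (Fin m)) :
    ∃ ρ κ η : ℝ, 0 < ρ ∧ ρ ≤ 1 ∧ 0 < κ ∧ 0 < η ∧ ∀ᵐ s ∂(simplexMeasure m),
      ∃ n₀ : ℕ, ∀ n ≥ n₀, ∀ ω : ℝ, Real.exp (-(κ * n)) ≤ |ω| → |ω| ≤ Real.exp (κ * n) →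
        η * n ≤ farCount ρ (fun k => ω * roofWord s (ζ.iterWord k (c :: v))) n := by
  have : NeZero m := ⟨by have := Substitution.two_le_of_one_lt_secondModulus hθ; omega⟩
  have hpop : popVec (c :: v) ≠ 0 := fun h => by
    have := congrFun h c
    simp only [popVec, List.count_cons_self, Pi.zero_apply] at this
    omega
  obtain ⟨coef, hrec⟩ := exists_intCast_pow_mulVec_recurrence ζ.matrix (popVec (c :: v))
  obtain ⟨w, b, C, τ, hτ, hτ1, hwpos, hbw, hw, hb⟩ :=
    Substitution.exists_controlled_functionals hprim hirr hθ hpop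
  obtain ⟨ρ, κ, η, N, hρ, hρ1, hκ, hη, hN, hEK⟩ := exists_erdos_kahane hrec hτ hτ1 hw hb
  refine ⟨ρ, κ, η, hρ, hρ1, hκ, hη, ?_⟩
  filter_upwards [ae_simplexMeasure_mem_openSimplex m, ae_simplexMeasure_projCoord_notMem hbw hN]
    with s hs hsN
  have hsw := (dotProduct_pos_of_mem_openSimplex hs hwpos).ne'
  simpa only [dotProduct_intCast_pow_mulVec_popVec] using hEK s hsw (hsN hsw)

lemma exists_ae_norm_twistedSum_iterWord_le (hprim : ζ.Primitive)
    (hirr : Irreducible (ζ.matrix.map (Int.cast : ℤ → ℚ)).charpoly)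
    (hθ : 1 < ζ.secondModulus) :
    ∃ (q : ℕ) (β κ : ℝ), 0 < β ∧ β < 1 ∧ 0 < κ ∧ ∀ᵐ s ∂(simplexMeasure m),
      ∃ n₀ : ℕ, ∀ n ≥ n₀, ∀ ω : ℝ, ω ≠ 0 → |(Real.log |ω|)| ≤ κ * n →
        ∀ (φ : Fin m → ℂ) (M : ℝ), (∀ a, ‖φ a‖ ≤ M) → ∀ w : List (Fin m),
          ‖twistedSum ω s φ (ζ.iterWord (n + q) w)‖ ≤
            M * β ^ n * (ζ.iterWord (n + q) w).length := by
  obtain ⟨p, hp⟩ := hprim.exists_forall_mem_iter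
  obtain ⟨q, c, v, hv⟩ := Substitution.exists_return_word hp
    (Substitution.two_le_of_one_lt_secondModulus hθ)
  obtain ⟨ρ, κ, η, hρ, hρ1, hκ, hη, hfar⟩ := exists_ae_farCount_roofWord hprim hirr hθ c v
  obtain ⟨ν, hν, hν1, hdecay⟩ := hv.exists_norm_twistedSum_iterWord_le hp hρ hρ1
  refine ⟨q, ν ^ η, κ, Real.rpow_pos_of_pos hν η, Real.rpow_lt_one hν.le hν1 hη, hκ, ?_⟩
  filter_upwards [hfar] with s ⟨n₀, hn₀⟩
  refine ⟨n₀, fun n hn ω hω hωn φ M hφ w => (hdecay ω s φ M hφ n w).trans ?_⟩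
  have hωpos : 0 < |ω| := abs_pos.2 hω
  have hcount := hn₀ n hn ω ((Real.le_log_iff_exp_le hωpos).1 (abs_le.1 hωn).1)
    ((Real.log_le_iff_le_exp hωpos).1 (abs_le.1 hωn).2)
  have hM : 0 ≤ M := (norm_nonneg _).trans (hφ c)
  gcongr
  rw [← Real.rpow_natCast, ← Real.rpow_mul_natCast hν.le]
  exact Real.rpow_le_rpow_of_exponent_ge hν hν1.le hcount

end Decay

section Scales

lemma exists_le_rpow_neg {Q β : ℝ} (hQ : 1 < Q) (hβ : 0 < β) (hβ1 : β < 1) :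
    ∃ γ : ℝ, 0 < γ ∧ γ ≤ 1 / 2 ∧ β ≤ Q ^ (-(2 * γ)) := by
  have hlog : Real.logb Q β < 0 := Real.logb_neg hQ hβ hβ1
  refine ⟨min (-Real.logb Q β / 2) (1 / 2), lt_min (by linarith) (by norm_num),
    min_le_right _ _, ?_⟩
  have hexp : Real.logb Q β ≤ -(2 * min (-Real.logb Q β / 2) (1 / 2)) := by
    linarith [min_le_left (-Real.logb Q β / 2) (1 / 2)]
  calc β = Q ^ Real.logb Q β := (Real.rpow_logb (zero_lt_one.trans hQ) hQ.ne' hβ).symm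
    _ ≤ _ := Real.rpow_le_rpow_of_exponent_le hQ.le hexp

lemma pow_le_mul_rpow_neg {Q β γ R : ℝ} {n : ℕ} (hQ : 1 < Q) (hβ : 0 ≤ β) (hγ : 0 ≤ γ)
    (hγ2 : γ ≤ 1 / 2) (hβQ : β ≤ Q ^ (-(2 * γ))) (hR : 0 < R) (hRn : √R < Q ^ (n + 1)) :
    β ^ n ≤ Q * R ^ (-γ) := by
  have hQ0 : 0 < Q := zero_lt_one.trans hQ
  calc β ^ n ≤ (Q ^ (-(2 * γ))) ^ n := by gcongr
    _ = Q ^ (2 * γ) * (Q ^ (n + 1)) ^ (-(2 * γ)) := by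
      rw [← Real.rpow_mul_natCast hQ0.le, ← Real.rpow_natCast Q, ← Real.rpow_mul hQ0.le,
        ← Real.rpow_add hQ0]
      congr 1
      push_cast
      ring
    _ ≤ Q ^ (1 : ℝ) * √R ^ (-(2 * γ)) := by
      refine mul_le_mul (Real.rpow_le_rpow_of_exponent_le hQ.le (by linarith)) ?_ (by positivity)
        (by positivity)
      exact Real.rpow_le_rpow_of_nonpos (Real.sqrt_pos.2 hR) hRn.le (by linarith)
    _ = Q * R ^ (-γ) := by
      rw [Real.rpow_one, Real.sqrt_eq_rpow, ← Real.rpow_mul hR.le]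
      congr 2
      ring

lemma exists_nat_pow_near_sqrt {Q κ ℓ R : ℝ} {n₀ : ℕ} (hQ : 1 < Q) (hκ : 0 < κ) (hℓ : 0 ≤ ℓ)
    (hR : Q ^ (2 * (n₀ + 1 + ℓ / κ)) ≤ R) :
    ∃ n ≥ n₀, ℓ ≤ κ * n ∧ Q ^ n ≤ √R ∧ √R < Q ^ (n + 1) := by
  have hQ0 : 0 < Q := zero_lt_one.trans hQ
  have hℓκ : 0 ≤ ℓ / κ := by positivity
  have hsqrt : Q ^ (n₀ + 1 + ℓ / κ) ≤ √R := by
    refine Real.le_sqrt_of_sq_le (hR.trans_eq' ?_)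
    rw [← Real.rpow_mul_natCast hQ0.le, mul_comm]
    norm_num
  obtain ⟨n, hn, hn'⟩ := exists_nat_pow_near
    ((Real.one_le_rpow hQ.le (by positivity)).trans hsqrt) hQ
  have hexp : n₀ + 1 + ℓ / κ < n + 1 := by
    refine (Real.rpow_lt_rpow_left_iff hQ).1 ((hsqrt.trans_lt hn').trans_eq ?_)
    exact_mod_cast (Real.rpow_natCast Q (n + 1)).symm
  refine ⟨n, ?_, ?_, hn, hn'⟩
  · have : (n₀ : ℝ) < n := by linarith
    exact_mod_cast this.le
  · rw [← div_le_iff₀' hκ]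
    have : (0 : ℝ) ≤ n₀ := n₀.cast_nonneg
    linarith

end Scales

/-! ### The low-frequency and high-frequency regimes -/

section Regimes

variable {m : ℕ} {ζ : Substitution m}

lemma norm_integral_flowLine_le_rpow {p : ℕ} (hp : ∀ a b, a ∈ ζ.iter p b) {s : Fin m → ℝ}
    (hs : s ∈ openSimplex m) {ψ : Fin m → ℝ → ℂ} {L : ℝ} (hL : 0 ≤ L)
    (hψ : ∀ a, Measurable (ψ a)) (hb : ∀ a t, ‖ψ a t‖ ≤ L) {ω Q β γ R : ℝ} {n q : ℕ}
    (hQ : 1 < Q) (hζQ : ζ.maxLen 1 ≤ Q) (hβ : 0 < β) (hγ : 0 < γ) (hγ2 : γ ≤ 1 / 2)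
    (hβQ : β ≤ Q ^ (-(2 * γ))) (hR : 1 ≤ R) (hnR : Q ^ n ≤ √R) (hRn : √R < Q ^ (n + 1))
    (hdecay : ∀ w, ‖twistedSum ω s (tileIntegral ω s ψ) (ζ.iterWord (n + q) w)‖ ≤
      L * β ^ n * (ζ.iterWord (n + q) w).length)
    {x : ℤ → Fin m} (hx : x ∈ ζ.space) (A : ℝ) :
    ‖∫ u in A..(A + R), 𝐞 (-(ω * u)) * flowLine s ψ x u‖ ≤
      L * ((2 + 2 * Q ^ q + 4 * ζ.maxLen p * Q) * R ^ (-γ)) * R := by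
  have hR0 : 0 < R := zero_lt_one.trans_le hR
  have hRγ : R ^ (-γ) * R = R ^ (1 - γ) := by
    rw [← Real.rpow_add_one hR0.ne', neg_add_eq_sub]
  have hone : 1 ≤ R ^ (1 - γ) := Real.one_le_rpow hR (by linarith)
  have hlen : (ζ.maxLen (n + q) : ℝ) ≤ Q ^ q * R ^ (1 - γ) :=
    calc (ζ.maxLen (n + q) : ℝ) ≤ (ζ.maxLen 1 : ℝ) ^ (n + q) := by
          exact_mod_cast ζ.maxLen_le_pow (n + q)
      _ ≤ Q ^ (n + q) := by gcongr
      _ = Q ^ q * Q ^ n := by rw [pow_add, mul_comm]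
      _ ≤ Q ^ q * R ^ (1 - γ) := by
        gcongr
        rw [Real.sqrt_eq_rpow] at hnR
        exact hnR.trans (Real.rpow_le_rpow_of_exponent_le hR (by linarith))
  have hβR : β ^ n * R ≤ Q * R ^ (1 - γ) := by
    rw [← hRγ, ← mul_assoc]
    gcongr
    exact pow_le_mul_rpow_neg hQ hβ.le hγ.le hγ2 hβQ hR0 hRn
  calc _ ≤ L * (2 + 2 * ζ.maxLen (n + q) + 4 * ζ.maxLen p * β ^ n * R) :=
        norm_integral_flowLine_le_of_decay hp hs hL hψ hb (by positivity) hdecay hx A hR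
    _ = L * (2 * 1 + 2 * ζ.maxLen (n + q) + 4 * ζ.maxLen p * (β ^ n * R)) := by ring
    _ ≤ L * (2 * R ^ (1 - γ) + 2 * (Q ^ q * R ^ (1 - γ)) +
          4 * ζ.maxLen p * (Q * R ^ (1 - γ))) := by gcongr
    _ = _ := by rw [← hRγ]; ring

lemma rpow_neg_one_div_sixteen_mul {r : ℝ} (hr : 0 < r) (γ : ℝ) :
    (1 / (16 * r)) ^ (-γ) = 16 ^ γ * r ^ γ := by
  rw [one_div, Real.inv_rpow (by positivity), Real.rpow_neg (by positivity), inv_inv,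
    Real.mul_rpow (by norm_num) hr.le]

lemma rpow_le_one_div_sixteen_mul {Q κ ℓ r b : ℝ} (hQ : 0 < Q) (hr : 0 < r)
    (hrle : r ≤ 1 / (16 * Q ^ (2 * b)) * Real.exp (-(2 * Real.log Q / κ * ℓ))) :
    Q ^ (2 * (b + ℓ / κ)) ≤ 1 / (16 * r) := by
  have hexp : Real.exp (2 * Real.log Q / κ * ℓ) = Q ^ (2 * (ℓ / κ)) := by
    rw [Real.rpow_def_of_pos hQ]
    ring_nf
  rw [mul_add, Real.rpow_add hQ, le_one_div (by positivity) (by positivity)]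
  rw [Real.exp_neg, hexp] at hrle
  calc 16 * r ≤ 16 * (1 / (16 * Q ^ (2 * b)) * (Q ^ (2 * (ℓ / κ)))⁻¹) := by gcongr
    _ = _ := by field_simp

lemma exists_ae_measureReal_Icc_le_rpow_of_le_exp (hprim : ζ.Primitive)
    (hirr : Irreducible (ζ.matrix.map (Int.cast : ℤ → ℚ)).charpoly)
    (hθ : 1 < ζ.secondModulus) :
    ∃ γ Z C : ℝ, 0 < γ ∧ γ ≤ 1 / 2 ∧ 0 < Z ∧ 0 < C ∧ ∀ᵐ s ∂(simplexMeasure m),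
      ∃ r₁ : ℝ, 0 < r₁ ∧ r₁ ≤ 1 ∧ ∀ (ψ : Fin m → ℝ → ℂ) (L : ℝ), 0 ≤ L →
        (∀ a, Measurable (ψ a)) → (∀ a t, ‖ψ a t‖ ≤ L) →
          ∀ (μ : Measure (ℤ → Fin m)) (σ : Measure ℝ),
            IsSpectralMeasure (suspensionMeasure ζ s μ) (suspensionFlow s) (cylFun ψ) σ →
              ∀ ω : ℝ, ω ≠ 0 → ∀ r : ℝ, 0 < r → r ≤ r₁ * Real.exp (-(Z * |(Real.log |ω|)|)) →
                σ.real (Icc (ω - r) (ω + r)) ≤ C * L ^ 2 * r ^ γ := by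
  obtain ⟨p, hp⟩ := hprim.exists_forall_mem_iter
  obtain ⟨q, β, κ, hβ, hβ1, hκ, hae⟩ := exists_ae_norm_twistedSum_iterWord_le hprim hirr hθ
  set Q : ℝ := ζ.maxLen 1 + 2
  have hζQ : (ζ.maxLen 1 : ℝ) ≤ Q := by linarith
  have hQ : 1 < Q := by
    have : (0 : ℝ) ≤ ζ.maxLen 1 := Nat.cast_nonneg _
    linarith
  have hlogQ : 0 < Real.log Q := Real.log_pos hQ
  obtain ⟨γ, hγ, hγ2, hβQ⟩ := exists_le_rpow_neg hQ hβ hβ1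
  set K : ℝ := 2 + 2 * Q ^ q + 4 * ζ.maxLen p * Q
  refine ⟨γ, 2 * Real.log Q / κ, 4 * K * 16 ^ γ, hγ, hγ2, by positivity, by positivity, ?_⟩
  filter_upwards [ae_simplexMeasure_mem_openSimplex m, hae] with s hs ⟨n₀, hn₀⟩
  have hQn₀ : 1 ≤ Q ^ (2 * ((n₀ : ℝ) + 1)) := Real.one_le_rpow hQ.le (by positivity)
  refine ⟨1 / (16 * Q ^ (2 * ((n₀ : ℝ) + 1))), by positivity,
    (div_le_one (by positivity)).2 (by linarith), ?_⟩
  intro ψ L hL hψ hb μ σ hσ ω hω r hr hrle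
  have hR := rpow_le_one_div_sixteen_mul (by positivity) hr hrle
  have hR1 : 1 ≤ 1 / (16 * r) := (Real.one_le_rpow hQ.le (by positivity)).trans hR
  obtain ⟨n, hn, hωn, hnR, hRn⟩ := exists_nat_pow_near_sqrt hQ hκ (abs_nonneg _) hR
  refine (hσ.measureReal_Icc_le_of_flowLine hs.1 hL hψ hb (B := L * (K * (1 / (16 * r)) ^ (-γ)))
    (zero_lt_one.trans_le hR1) (by field_simp; norm_num) (by positivity) fun x hx A =>
      norm_integral_flowLine_le_rpow hp hs hL hψ hb hQ hζQ hβ hγ hγ2 hβQ hR1 hnR hRn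
        (hn₀ n hn ω hω hωn _ L (norm_tileIntegral_le hs hb ω)) hx A).trans_eq ?_
  rw [rpow_neg_one_div_sixteen_mul hr]
  ring

lemma le_mul_exp_neg_abs_log_or_inv_le_rpow {ω r r₁ Z : ℝ} (hω : 0 < ω) (hZ : 0 < Z)
    (hr₁ : 0 < r₁) (hr₁1 : r₁ ≤ 1) (hr : r < r₁ ^ 3 * ω ^ Z) :
    r ≤ r₁ * Real.exp (-(Z * |Real.log ω|)) ∨ ω⁻¹ ≤ r ^ (1 / (2 * Z)) := by
  have hX : 0 < ω ^ Z := Real.rpow_pos_of_pos hω Z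
  rcases le_total ω 1 with hω1 | hω1
  · left
    have hexp : Real.exp (-(Z * |Real.log ω|)) = ω ^ Z := by
      rw [abs_of_nonpos (Real.log_nonpos hω.le hω1), Real.rpow_def_of_pos hω]
      ring_nf
    rw [hexp]
    refine hr.le.trans ?_
    gcongr
    exact pow_le_of_le_one hr₁.le hr₁1 (by norm_num)
  · rw [or_iff_not_imp_left, not_le]
    intro hlarge
    have hexp : Real.exp (-(Z * |Real.log ω|)) = (ω ^ Z)⁻¹ := by
      rw [abs_of_nonneg (Real.log_nonneg hω1), Real.rpow_def_of_pos hω, ← Real.exp_neg]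
      ring_nf
    rw [hexp] at hlarge
    have hinv : (ω ^ Z)⁻¹ ≤ r₁ := by
      have hsq : (ω ^ Z)⁻¹ ^ 2 ≤ r₁ ^ 2 := by
        have hlt := hlarge.trans hr
        rw [← div_eq_mul_inv, div_lt_iff₀ hX] at hlt
        rw [inv_pow, inv_le_iff_one_le_mul₀ (by positivity)]
        nlinarith
      exact le_of_sq_le_sq hsq hr₁.le
    calc ω⁻¹ = ((ω ^ Z)⁻¹ ^ 2) ^ (1 / (2 * Z)) := by
          rw [← Real.rpow_neg hω.le, ← Real.rpow_mul_natCast hω.le, ← Real.rpow_mul hω.le,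
            ← Real.rpow_neg_one]
          congr 1
          push_cast
          field_simp
      _ ≤ r ^ (1 / (2 * Z)) := by
          gcongr
          calc (ω ^ Z)⁻¹ ^ 2 = (ω ^ Z)⁻¹ * (ω ^ Z)⁻¹ := sq _
            _ ≤ r₁ * (ω ^ Z)⁻¹ := by gcongr
            _ ≤ r := hlarge.le

lemma IsSpectralMeasure.measureReal_Icc_le_rpow_of_inv_le {p : ℕ} (hp : ∀ a b, a ∈ ζ.iter p b)
    {s : Fin m → ℝ} (hs : s ∈ openSimplex m) {ψ : Fin m → ℝ → ℂ} {K : NNReal}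
    (hψ : ∀ a, LipschitzWith K (ψ a)) (hb : ∀ a t, ‖ψ a t‖ ≤ K) {μ : Measure (ℤ → Fin m)}
    {σ : Measure ℝ}
    (hσ : IsSpectralMeasure (suspensionMeasure ζ s μ) (suspensionFlow s) (cylFun ψ) σ)
    {ω r γ δ : ℝ} (hω : ω ≠ 0) (hr : 0 < r) (hγ : 0 ≤ γ) (hγ1 : γ ≤ 1) (hγδ : γ ≤ δ)
    (hωr : |ω|⁻¹ ≤ r ^ δ) :
    σ.real (Icc (ω - r) (ω + r)) ≤ (128 + 16 * ζ.maxLen p) * (K : ℝ) ^ 2 * r ^ γ := by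
  rcases le_total r (1 / 16) with hr16 | hr16
  · have hr1 : r ≤ 1 := hr16.trans (by norm_num)
    calc σ.real (Icc (ω - r) (ω + r))
        ≤ (K : ℝ) ^ 2 * (128 * r + 16 * ζ.maxLen p * |ω|⁻¹) :=
          hσ.measureReal_Icc_le_inv hp hs hψ hb hω hr hr16
      _ ≤ (K : ℝ) ^ 2 * (128 * r ^ γ + 16 * ζ.maxLen p * r ^ γ) := by
        gcongr
        · simpa only [Real.rpow_one] using Real.rpow_le_rpow_of_exponent_ge hr hr1 hγ1
        · exact hωr.trans (Real.rpow_le_rpow_of_exponent_ge hr hr1 hγδ)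
      _ = _ := by ring
  · have hpow : 1 / 16 ≤ r ^ γ :=
      calc (1 / 16 : ℝ) = (1 / 16) ^ (1 : ℝ) := (Real.rpow_one _).symm
        _ ≤ (1 / 16) ^ γ :=
          Real.rpow_le_rpow_of_exponent_ge (by norm_num) (by norm_num) hγ1
        _ ≤ r ^ γ := by gcongr
    calc σ.real (Icc (ω - r) (ω + r)) ≤ 4 * (K : ℝ) ^ 2 :=
          hσ.measureReal_Icc_le_four_mul_sq hs.1 K.coe_nonneg
            (fun a => (hψ a).continuous.measurable) hb ω hr
      _ = 64 * (K : ℝ) ^ 2 * (1 / 16) := by ring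
      _ ≤ (128 + 16 * ζ.maxLen p) * (K : ℝ) ^ 2 * r ^ γ := by
        gcongr
        have : (0 : ℝ) ≤ ζ.maxLen p := Nat.cast_nonneg _
        linarith

lemma exists_ae_measureReal_Icc_le_rpow (hprim : ζ.Primitive)
    (hirr : Irreducible (ζ.matrix.map (Int.cast : ℤ → ℚ)).charpoly)
    (hθ : 1 < ζ.secondModulus) :
    ∃ γ Z C : ℝ, 0 < γ ∧ 0 < Z ∧ 0 < C ∧ ∀ᵐ s ∂(simplexMeasure m),
      s ∈ openSimplex m ∧ ∃ r₀ : ℝ, 0 < r₀ ∧ ∀ (ψ : Fin m → ℝ → ℂ) (K : NNReal),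
        (∀ a, LipschitzWith K (ψ a)) → (∀ a t, ‖ψ a t‖ ≤ K) →
          ∀ (μ : Measure (ℤ → Fin m)) (σ : Measure ℝ),
            IsSpectralMeasure (suspensionMeasure ζ s μ) (suspensionFlow s) (cylFun ψ) σ →
              ∀ ω : ℝ, ω ≠ 0 → ∀ r : ℝ, 0 < r → r < r₀ * |ω| ^ Z →
                σ.real (Icc (ω - r) (ω + r)) ≤ C * (K : ℝ) ^ 2 * r ^ γ := by
  obtain ⟨p, hp⟩ := hprim.exists_forall_mem_iter
  obtain ⟨γ, Z, C, hγ, hγ2, hZ, hC, hae⟩ :=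
    exists_ae_measureReal_Icc_le_rpow_of_le_exp hprim hirr hθ
  refine ⟨min γ (1 / (2 * Z)), Z, max C (128 + 16 * ζ.maxLen p), by positivity, hZ,
    by positivity, ?_⟩
  filter_upwards [ae_simplexMeasure_mem_openSimplex m, hae] with s hs ⟨r₁, hr₁, hr₁1, hdecay⟩
  refine ⟨hs, r₁ ^ 3, by positivity, fun ψ K hψ hb μ σ hσ ω hω r hr hrω => ?_⟩
  rcases le_mul_exp_neg_abs_log_or_inv_le_rpow (abs_pos.2 hω) hZ hr₁ hr₁1 hrω with hrω | hrω
  · have hr1 : r ≤ 1 := hrω.trans (mul_le_one₀ hr₁1 (by positivity)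
      (Real.exp_le_one_iff.2 (neg_nonpos.2 (by positivity))))
    refine (hdecay ψ K K.coe_nonneg (fun a => (hψ a).continuous.measurable) hb μ σ hσ ω hω r hr
      hrω).trans (mul_le_mul ?_ ?_ (by positivity) (by positivity))
    · gcongr
      exact le_max_left _ _
    · exact Real.rpow_le_rpow_of_exponent_ge hr hr1 (min_le_left _ _)
  · refine (hσ.measureReal_Icc_le_rpow_of_inv_le hp hs hψ hb hω hr (by positivity)
      ((min_le_left _ _).trans (hγ2.trans (by norm_num))) (min_le_right γ _) hrω).trans ?_
    gcongr
    exact le_max_right _ _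

end Regimes

end

theorem mainTheorem3_general {m : ℕ} (ζ : Substitution m) (hprim : ζ.Primitive)
    (hirr : Irreducible (ζ.matrix.map (Int.cast : ℤ → ℚ)).charpoly)
    (hθ : 1 < ζ.secondModulus) :
    ∃ γ Z C : ℝ, 0 < γ ∧ 0 < Z ∧ 0 < C ∧
      ∀ᵐ s ∂(simplexMeasure m), ∃ r₀ : ℝ, 0 < r₀ ∧
        ∀ μ : Measure (ℤ → Fin m), IsFiniteMeasure μ →
          ∀ ψ : Fin m → ℝ → ℂ, IsLipData s ψ →
            ∀ σ : Measure ℝ,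
              IsSpectralMeasure (suspensionMeasure ζ s μ) (suspensionFlow s) (cylFun ψ) σ →
                ∀ ω : ℝ, ω ≠ 0 → ∀ r : ℝ, 0 < r → r < r₀ * |ω| ^ Z →
                  σ.real (Icc (ω - r) (ω + r)) ≤ C * cylLipNorm s ψ ^ 2 * r ^ γ := by
  obtain ⟨γ, Z, C, hγ, hZ, hC, hae⟩ := exists_ae_measureReal_Icc_le_rpow hprim hirr hθ
  refine ⟨γ, Z, C, hγ, hZ, hC, ?_⟩
  filter_upwards [hae] with s ⟨hs, r₀, hr₀, hbound⟩
  refine ⟨r₀, hr₀, fun μ _ ψ hψ σ hσ ω hω r hr hrω => ?_⟩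
  have hb := norm_clampData_le hs.1 hψ
  have : NeZero m := ⟨by have := Substitution.two_le_of_one_lt_secondModulus hθ; omega⟩
  have hL : 0 ≤ cylLipNorm s ψ := (norm_nonneg _).trans (hb 0 0)
  simpa only [Real.coe_toNNReal _ hL] using
    hbound (clampData s ψ) (cylLipNorm s ψ).toNNReal (lipschitzWith_clampData hs.1 hψ)
      (fun a t => (hb a t).trans (Real.le_coe_toNNReal _)) μ σ (hσ.clampData hs.1) ω hω r hr hrω

theorem mainTheorem3 {m : ℕ} (ζ : Substitution m) (hprim : ζ.Primitive) (haper : ζ.Aperiodic)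
    (hirr : Irreducible (ζ.matrix.map (Int.cast : ℤ → ℚ)).charpoly)
    (hθ : 1 < ζ.secondModulus) :
    ∃ γ Z : ℝ, 0 < γ ∧ 0 < Z ∧ ∃ C : ℝ → ℝ, (∀ L, 0 < C L) ∧
      ∀ μ : Measure (ℤ → Fin m), ζ.IsInvariantMeasure μ →
        ∀ᵐ s ∂(simplexMeasure m), ∃ r₀ : ℝ, 0 < r₀ ∧
          ∀ ψ : Fin m → ℝ → ℂ, IsLipData s ψ →
            ∀ σ : Measure ℝ,
              IsSpectralMeasure (suspensionMeasure ζ s μ) (suspensionFlow s) (cylFun ψ) σ →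
                ∀ ω : ℝ, ω ≠ 0 → ∀ r : ℝ, 0 < r → r < r₀ * |ω| ^ Z →
                  σ.real (Icc (ω - r) (ω + r)) ≤ C (cylLipNorm s ψ) * r ^ γ := by
  obtain ⟨γ, Z, C, hγ, hZ, hC, hae⟩ := mainTheorem3_general ζ hprim hirr hθ
  refine ⟨γ, Z, hγ, hZ, fun L => C * (L ^ 2 + 1), fun L => by positivity, fun μ hμ => ?_⟩
  filter_upwards [hae] with s ⟨r₀, hr₀, hbound⟩
  have := hμ.isProbabilityMeasure
  refine ⟨r₀, hr₀, fun ψ hψ σ hσ ω hω r hr hrω =>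
    (hbound μ inferInstance ψ hψ σ hσ ω hω r hr hrω).trans ?_⟩
  gcongr
  exact le_add_of_nonneg_right zero_le_one
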